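/- **Setting.** Let $H$ be the bipartite graph with vertices $c,d,b_i,z_i$ ($i=0,1,2$, indices mod $3$) and edges $z_ib_i$, $b_ic$, $cd$; the even vertices are $c,z_0,z_1,z_2$. Its Perron–Frobenius eigenvalue is $\delta=\sqrt{(5+\sqrt{21})/2}$, with eigenvector $\lambda(z_i)=\sqrt{\tfrac{7-\sqrt{21}}{42}}$, $\lambda(b_i)=\sqrt{\tfrac{7+\sqrt{21}}{42}}$, $\lambda(d)=\sqrt{\tfrac{21-3\sqrt{21}}{42}}$, $\lambda(c)=\sqrt{\tfrac{21+3\sqrt{21}}{42}}$. Let $q>1$ with $q+q^{-1}=\delta$ and $[n]=\frac{q^n-q^{-n}}{q-q^{-1}}$. Let $PABG(H)$ be the planar algebra of $H$: its $n$-box spaces have as bases the loops of length $2n$ on $H$ based at an even vertex ($+$, star in an unshaded region) or an odd vertex ($-$, star in a shaded region). Loops are read clockwise from the star, a tangle acts by the sum over its states (even vertices on unshaded regions, odd ones on shaded regions), and each local maximum or minimum of a string contributes $\sqrt{\lambda(\text{convex side})/\lambda(\text{concave side})}$. The inner product is $\langle x,y\rangle=Z(y^*x)$, where the trace $Z$ sends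 a vertex $a$ to $\lambda(a)^2$. Let $f^{(8)}$ be the Jones–Wenzl idempotent on $8$ strings. **Generators.** Let $\rho(l_1l_2l_3l_4l_5l_6)=\sqrt{\frac{\lambda(l_1)\lambda(l_4)}{\lambda(l_5)\lambda(l_2)}}\;l_5l_6l_1l_2l_3l_4$ (rotation by two strings), $R=\sqrt{\lambda(d)/\lambda(b_0)}$, $\theta=\sqrt{\lambda(c)/\lambda(z_0)}$, and, in $PABG(H)_{3,+}$, $$B_{k}=\sum_{i}\big(cb_icb_icb_{i+k}-\theta\, cb_iz_ib_icb_{i+k}\big),\quad D=\sum_i\big(cdcb_icb_i-\theta\,cdcb_iz_ib_i\big),\quad E_k=\sum_i cdcb_icb_{i+k}\quad(k=1,2).$$ Put $$T=(1+\rho+\rho^2)\Big(tB_1+t'B_2+s\,cb_0cb_1cb_2+\bar s\,cb_0cb_2cb_1-\tfrac{t+t'}{R}D-\tfrac{t+t'+s}{R}E_1+\tfrac{2(t+t')+s}{R}E_2\Big)$$ with $t=\frac{1}{12}\big(-3+\sqrt{21}+\sqrt{-114+26\sqrt{21}}\big)$, $t'=\frac14\big(-7-\sqrt{21}+\sqrt{54+14\sqrt{21}}\big)t$,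 $s=\frac{3-\sqrt{21}}4+\frac i2\sqrt{\frac{-57+13\sqrt{21}}6}$; and, with $\omega=e^{2\pi i/3}$, $\eta=1+i\sqrt3$, $$Q=\eta\,(1+\omega^2\rho+\omega\rho^2)\Big(\tau B_1+\tau'B_2-\tfrac{\omega^2(\tau+\tau')}{R}D-\tfrac{\tau+\omega\tau'}{R}E_1-\tfrac{\tau'+\omega\tau}{R}E_2\Big)$$ with $\Psi=\frac{1-\theta^2-\theta}2$, $\tau=\sqrt{\frac{[4]}{1+\Psi^2}\cdot\frac{5}{(246+54\sqrt{21})\sqrt3}}$, $\tau'=\Psi\tau$. **Diagrams.** Number the eight strings entering the top of $f^{(8)}$ from left to right by $1,\dots,8$; the other eight ends of $f^{(8)}$ are the boundary points of a 4-box. For $E,F,G\in\{T,Q\}$: * *Unshaded setting* (outer region unshaded). $(E)$ is the diagram in which $E$ is attached to strings $2,\dots,7$ of $f^{(8)}$ with its star at the bottom, between strings $2$ and $3$, and a cap passes over $E$ and joins strings $1$ and $8$. $(F,G)$ is the diagram in which $F$ is attached to strings $1,\dots,4$ and $G$, to its right, to strings $5,\dots,8$, both stars are at the top (in the outer region), and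 $F$ and $G$ are joined by two strings. Put $u=(T)$, $v=(Q)$ and $$M=(T,Q)-\frac{\langle (T,Q),u\rangle}{\langle u,u\rangle}u-\frac{\langle (T,Q),v\rangle}{\langle v,v\rangle}v .$$ * *Shaded setting* (outer region shaded). $(E)_0$ is the same diagram as $(E)$, but with the star of $E$ on its left, between strings $1$ and $2$. $(F,G)_0$ is the same diagram as $(F,G)$, but with the star of $F$ between strings $1$ and $2$ and the star of $G$ between strings $7$ and $8$. Put $u_0=(T)_0$, $v_0=(Q)_0$ and let $M'$ be $(T,Q)_0$ minus its orthogonal projections to $u_0$ and to $v_0$. **Theorem (4-box relations).** Each of $(T,Q)$, $(Q,T)$, $(T,T)$, $(Q,Q)$ lies in $\operatorname{span}_{\mathbb C}\{u,v,M\}$, and each of $(T,Q)_0$, $(Q,T)_0$, $(T,T)_0$, $(Q,Q)_0$ lies in $\operatorname{span}_{\mathbb C}\{u_0,v_0,M'\}$. -/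

import Mathlib

noncomputable section

open Matrix

namespace Planar2221

/-! ## The bipartite graph `H` and its Perron-Frobenius data -/

/-- Vertices of the graph `2221`: three legs `c - b i - z i` and one leg `c - d`. -/
inductive Vtx : Type
  | z (i : Fin 3)
  | b (i : Fin 3)
  | c
  | d
  deriving DecidableEq, Fintype

open Vtx

/-- The edges of `H`, each listed in one direction. -/
def edge : Vtx → Vtx → Bool
  | z i, b j => i == j
  | b _, c => true
  | d, c => true
  | _, _ => false

/-- The graph `H`. -/
def H : SimpleGraph Vtx := SimpleGraph.fromRel (fun x y => edge x y = true)

instance : DecidableRel H.Adj := by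
  unfold H
  infer_instance

/-- The even vertices `z 0, z 1, z 2, c`; these label the unshaded regions. -/
def isEven : Vtx → Bool
  | z _ => true
  | c => true
  | _ => false

/-- The Perron-Frobenius eigenvector, normalised to have norm `√2`. -/
def lam : Vtx → ℝ
  | z _ => √((7 - √21) / 42)
  | b _ => √((7 + √21) / 42)
  | d => √((21 - 3 * √21) / 42)
  | c => √((21 + 3 * √21) / 42)

/-- The Perron-Frobenius eigenvalue of `H`: the loop parameter. -/
def delta : ℝ := √((5 + √21) / 2)

/-- The root `q > 1` of `q + q⁻¹ = delta`. -/
def q : ℝ := (delta + √(delta ^ 2 - 4)) / 2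

/-- The quantum number `[n]`. -/
def qnum (n : ℕ) : ℝ := (q ^ n - (q⁻¹) ^ n) / (q - q⁻¹)

/-! ## Paths, loops and boxes of the graph planar algebra -/

/-- Paths of length `n` on `H`.  The labels that a state gives, from left to right, to the `n + 1`
regions met by a horizontal line crossing `n` strings form such a path. -/
def Path (n : ℕ) : Type :=
  {p : Fin (n + 1) → Vtx // ∀ i : Fin n, H.Adj (p i.castSucc) (p i.succ)}

instance (n : ℕ) : Fintype (Path n) := by
  unfold Path
  infer_instance

instance (n : ℕ) : DecidableEq (Path n) := by
  unfold Path
  infer_instance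

/-- The `j`-th vertex of a path of length `n` (used for `0 ≤ j ≤ n`). -/
def Path.vtx {n : ℕ} (p : Path n) (j : ℕ) : Vtx := p.1 (Fin.ofNat (n + 1) j)

/-- Loops of length `2 * k` based at an even vertex. -/
def Loop (k : ℕ) : Type :=
  {p : Path (2 * k) // p.vtx 0 = p.vtx (2 * k) ∧ isEven (p.vtx 0) = true}

instance (k : ℕ) : Fintype (Loop k) := by
  unfold Loop
  infer_instance

/-- The box space `PABG(H)_{k,+}`, with basis the even based loops of length `2 * k`; a loop is
read clockwise around the box, starting from the starred region. -/
abbrev PABG (k : ℕ) : Type := Loop k → ℂ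

/-- The coefficient in `X` of the loop `w 0, w 1, …, w (2 * k)`; it is `0` if this sequence is not
a loop based at an even vertex. -/
def PABG.coeff {k : ℕ} (X : PABG k) (w : ℕ → Vtx) : ℂ :=
  ∑ l : Loop k, if ∀ j ≤ 2 * k, l.1.vtx j = w j then X l else 0

/-- The basis element of `PABG(H)_{3,+}` given by the loop `v₁ v₂ v₃ v₄ v₅ v₆ (v₁)`. -/
def loop (v₁ v₂ v₃ v₄ v₅ v₆ : Vtx) : PABG 3 := fun l =>
  if l.1.vtx 0 = v₁ ∧ l.1.vtx 1 = v₂ ∧ l.1.vtx 2 = v₃ ∧ l.1.vtx 3 = v₄ ∧ l.1.vtx 4 = v₅ ∧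
    l.1.vtx 5 = v₆ then 1 else 0

/-- The rotation by two strings on `PABG(H)_{3,+}`:
`rho (l₁l₂l₃l₄l₅l₆) = √(λ(l₁)λ(l₄) / (λ(l₅)λ(l₂))) l₅l₆l₁l₂l₃l₄`, extended linearly. -/
def rho (X : PABG 3) : PABG 3 := fun l =>
  (√(lam (l.1.vtx 2) * lam (l.1.vtx 5) / (lam (l.1.vtx 0) * lam (l.1.vtx 3))) : ℝ) *
    X.coeff (fun j => l.1.vtx ((j + 2) % 6))

/-! ## The two generators -/

/-- `R = √(λ(d)/λ(b))`. -/
def R : ℝ := √(lam d / lam (b 0))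

/-- `θ = √(λ(c)/λ(z))`. -/
def theta : ℝ := √(lam c / lam (z 0))

/-- `(1 + f₂)(c bᵢ c bᵢ c bⱼ)`, where `f₂` replaces the third vertex `c` by `zᵢ`, with the factor
`-√(λ(c)/λ(z))`. -/
def loopB (i j : Fin 3) : PABG 3 :=
  loop c (b i) c (b i) c (b j) - (theta : ℂ) • loop c (b i) (z i) (b i) c (b j)

/-- `(1 + f₄)(c d c bᵢ c bᵢ)`, where `f₄` replaces the fifth vertex `c` by `zᵢ`, with the factor
`-√(λ(c)/λ(z))`. -/
def loopD (i : Fin 3) : PABG 3 :=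
  loop c d c (b i) c (b i) - (theta : ℂ) • loop c d c (b i) (z i) (b i)

/-- The coefficient `t` of `T`. -/
def tT : ℝ := (-3 + √21 + √(-114 + 26 * √21)) / 12

/-- The coefficient `t₀'` of `T`. -/
def tT' : ℝ := (-7 - √21 + √(54 + 14 * √21)) / 4 * tT

/-- The coefficient `s` of `T`. -/
def sT : ℂ := ((3 - √21) / 4 : ℝ) + (√((-57 + 13 * √21) / 6) / 2 : ℝ) * Complex.I

/-- The element to which `1 + ρ + ρ²` is applied to obtain `T`.  The sums over `i` are the
symmetrisations `1 + α + α²` over the three legs of `H`. -/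
def seedT : PABG 3 :=
  (tT : ℂ) • ∑ i : Fin 3, loopB i (i + 1)
  + (tT' : ℂ) • ∑ i : Fin 3, loopB i (i + 2)
  + sT • loop c (b 0) c (b 1) c (b 2)
  + star sT • loop c (b 0) c (b 2) c (b 1)
  - (((tT + tT') / R : ℝ) : ℂ) • ∑ i : Fin 3, loopD i
  - ((tT + tT' + sT) / R) • ∑ i : Fin 3, loop c d c (b i) c (b (i + 1))
  + ((2 * (tT + tT') + sT) / R) • ∑ i : Fin 3, loop c d c (b i) c (b (i + 2))

/-- The generator `T`, of rotational eigenvalue `1`. -/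
def T : PABG 3 := seedT + rho seedT + rho (rho seedT)

/-- `ω = exp(2πi/3)`. -/
def omega : ℂ := Complex.exp (2 * Real.pi * Complex.I / 3)

/-- `η = 1 + i√3`. -/
def eta : ℂ := 1 + Complex.I * (√3 : ℝ)

/-- `Ψ = (1 - θ² - θ)/2`. -/
def Psi : ℝ := (1 - theta ^ 2 - theta) / 2

/-- The coefficient `t` of `Q`. -/
def tQ : ℝ := √(qnum 4 / (1 + Psi ^ 2) * (5 / ((246 + 54 * √21) * √3)))

/-- The coefficient `t₀'` of `Q`. -/
def tQ' : ℝ := Psi * tQ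

/-- The element to which `η (1 + ω² ρ + ω ρ²)` is applied to obtain `Q`. -/
def seedQ : PABG 3 :=
  (tQ : ℂ) • ∑ i : Fin 3, loopB i (i + 1)
  + (tQ' : ℂ) • ∑ i : Fin 3, loopB i (i + 2)
  - (omega ^ 2 / R * (tQ + tQ')) • ∑ i : Fin 3, loopD i
  - ((tQ + omega * tQ') / R) • ∑ i : Fin 3, loop c d c (b i) c (b (i + 1))
  - ((tQ' + omega * tQ) / R) • ∑ i : Fin 3, loop c d c (b i) c (b (i + 2))

/-- The generator `Q`, of rotational eigenvalue `ω`. -/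
def Q : PABG 3 := eta • (seedQ + omega ^ 2 • rho seedQ + omega • rho (rho seedQ))

/-! ## Tangles in standard form

A planar diagram in standard form (all boxes are rectangles with the star on the left, half of the
strings at the top and half at the bottom) is cut by horizontal lines into slices, each containing
one box, one maximum or one minimum of a string.  A slice with `m` strings at its bottom and `n`
strings at its top acts as a matrix with rows indexed by `Path n` and columns by `Path m`, and
stacking `A` on top of `B` gives `A * B`.  The sum over the intermediate paths in such a product is
the sum over the states of the diagram, and every maximum or minimum contributes the factor
`√(λ(convex side)/λ(concave side))`.  Strings are numbered from the left, starting with `0`. -/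

/-- The slice with a maximum joining the strings `i` and `i + 1` of the `n + 2` strings at the
bottom; the other `n` strings are vertical. -/
def cap (n i : ℕ) : Matrix (Path n) (Path (n + 2)) ℂ := fun s p =>
  if (∀ j ≤ n, (j ≤ i → s.vtx j = p.vtx j) ∧ (i ≤ j → s.vtx j = p.vtx (j + 2))) then
    ((√(lam (p.vtx (i + 1)) / lam (p.vtx i)) : ℝ) : ℂ)
  else 0

/-- The slice with a minimum joining the strings `i` and `i + 1` of the `n + 2` strings at the top:
the mirror image of `cap n i`. -/
def cup (n i : ℕ) : Matrix (Path (n + 2)) (Path n) ℂ := (cap n i)ᵀ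

/-- The slice with the box `X`, in standard form, placed on the strings `i, …, i + k - 1` of `n`
strings; the other strings are vertical. -/
def box {k : ℕ} (n i : ℕ) (X : PABG k) : Matrix (Path n) (Path n) ℂ := fun s p =>
  if (∀ j ≤ n, (j ≤ i ∨ i + k ≤ j) → s.vtx j = p.vtx j) then
    X.coeff (fun j => if j ≤ k then s.vtx (i + j) else p.vtx (i + 2 * k - j))
  else 0

/-- The Jones-Wenzl idempotent `f^(n)` on the first `n` of `8` strings, by Wenzl's relation. -/
def jw : ℕ → Matrix (Path 8) (Path 8) ℂ
  | 0 => 1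
  | 1 => 1
  | n + 2 => jw (n + 1) -
      ((qnum (n + 1) / qnum (n + 2) : ℝ) : ℂ) • (jw (n + 1) * (cup 6 n * cap 6 n) * jw (n + 1))

/-- The space of 4-boxes drawn with all their `8` strings at the bottom. -/
abbrev FourBox : Type := Matrix (Path 0) (Path 8) ℂ

/-- The inner product of two 4-boxes (linear in the first variable): the mirror image of `y` is
glued below `x` along the `8` strings, and the resulting 0-box is evaluated by `Z`, which sends
the vertex `a` to `λ(a)²`. -/
def ip (x y : FourBox) : ℂ := ∑ a : Path 0, ((lam (a.vtx 0) ^ 2 : ℝ) : ℂ) * (x * yᴴ) a a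

/-- The orthogonal projection of `w` to the line spanned by `x`. -/
def proj (x w : FourBox) : FourBox := (ip w x / ip x x) • x

/-! ## The diagrams with an unshaded outer region -/

/-- `E` with a cap over it on `f^(8)`.  The cap joins the strings `0` and `7`; the strings of `E`
are `1, …, 6`, and its star is at its bottom, between the strings `1` and `2`. -/
def capped (E : PABG 3) : FourBox :=
  cap 0 0 * cap 2 1 * cap 4 3 * cap 6 4 * box 8 2 E * jw 8

/-- `(F, G)`: `F` (left) and `G` (right) on `f^(8)`, each with four strings going down, joined to
each other by two strings; both stars are at the top. -/
def joined (F G : PABG 3) : FourBox :=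
  cap 0 0 * cap 2 1 * cap 4 2 * box 6 0 G * cap 6 2 * box 8 0 F * jw 8

/-- `T` with a cap on `f^(8)`. -/
def u : FourBox := capped T

/-- `Q` with a cap on `f^(8)`. -/
def v : FourBox := capped Q

/-- The new 4-box element `M`. -/
def M : FourBox := joined T Q - proj u (joined T Q) - proj v (joined T Q)

/-! ## The diagrams with a shaded outer region -/

/-- `E` with a cap over it on `f^(8)`.  The cap joins the strings `0` and `7`; the strings of `E`
are `1, …, 6`, and its star is on its left, between the strings `0` and `1`. -/
def cappedShaded (E : PABG 3) : FourBox :=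
  cap 0 0 * cap 2 1 * cap 4 2 * cap 6 3 * box 8 1 E * jw 8

/-- `(F, G)`: `F` (left) and `G` (right) on `f^(8)`, each with four strings going down, joined to
each other by two strings; the star of `F` is between the strings `0` and `1`, and that of `G` is
between the strings `6` and `7`. -/
def joinedShaded (F G : PABG 3) : FourBox :=
  cap 0 0 * cap 2 1 * cap 4 2 * cap 6 3 * cap 8 4 * box 10 5 G * cup 8 7 * cup 6 6 * cap 6 0 *
    box 8 1 F * jw 8

/-- `T` with a cap on `f^(8)`, shaded outside. -/
def uShaded : FourBox := cappedShaded T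

/-- `Q` with a cap on `f^(8)`, shaded outside. -/
def vShaded : FourBox := cappedShaded Q

/-- The new 4-box element `M'`. -/
def MShaded : FourBox :=
  joinedShaded T Q - proj uShaded (joinedShaded T Q) - proj vShaded (joinedShaded T Q)

end Planar2221

end

/-!
The labels that a state gives to the nine regions above the Jones-Wenzl idempotent form a path of
length `8` on `H`, so each row of one of the diagrams is a combination of paths, multiplied by
`f^(8)`.  The idempotent annihilates caps (`cap_mul_jw`); hence only the class of the combination
modulo caps matters.  After weighting a path by the square roots of the weights of its vertices, a
cap becomes the sum, with coefficients `1`, of all detours `a x a` at a vertex `a`.  These are the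
relations `z b z = 0`, `d c d = 0`, `b z b = -b c b` and `c d c = -∑ i, c (b i) c` of the
preprojective algebra of `H` (`IsCapFree`, `isCapFree_row`).

The same weights remove the square roots from the local factors of the diagrams and from the
generators: up to nonzero scalars, `T` and `Q` are combinations of weighted loops with coefficients
in `ℤ[θ, ω]`, where `θ ^ 4 = 3 θ ^ 2 + 3` (`scale_smul_T`, `scale_smul_Q`), and the words of the
diagrams and their coefficients are found by gluing loops (`joined_realize`, `capped_realize` and
their shaded analogues).  Everything is invariant under the cyclic symmetry of `H`, so words count
only up to this symmetry.

The theorem thus becomes the existence of six linear relations in the span of words modulo caps,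
namely for `(Q, T)`, `(T, T)` and `(Q, Q)` in both shadings; as `M` is `(T, Q)` minus multiples of
`u` and `v`, the span of `u`, `v` and `M` contains `(T, Q)`.  The relations are certified by exact
arithmetic: eliminating the inner vertices `z i` and `d`, discarding the words that are `0`, and
adding explicit multiples of words with a detour `d c d` leaves a combination all of whose
coefficients are `0` (`vanishes`, `IsCapFree.eval_symm_eq_zero`).
-/

open Matrix

namespace Planar2221

open Vtx

/-! ### Words and their basis vectors -/

/-- The entries `w 0, …, w n` of the sequence `w` form a path on `H`. -/
def IsPath (n : ℕ) (w : ℕ → Vtx) : Prop := ∀ j < n, H.Adj (w j) (w (j + 1))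

/-- The path with vertices `w 0, …, w n`. -/
def Path.ofSeq {n : ℕ} (w : ℕ → Vtx) (h : IsPath n w) : Path n :=
  ⟨fun j => w j, fun i => h i i.2⟩

theorem Path.vtx_ofSeq {n : ℕ} {w : ℕ → Vtx} (h : IsPath n w) {j : ℕ} (hj : j ≤ n) :
    (Path.ofSeq w h).vtx j = w j := by
  simp [Path.ofSeq, Path.vtx, Nat.mod_eq_of_lt (Nat.lt_succ_of_le hj)]

theorem Path.ext_vtx {n : ℕ} {p p' : Path n} (h : ∀ j ≤ n, p.vtx j = p'.vtx j) : p = p' := by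
  apply Subtype.ext
  funext j
  have := h j (Nat.le_of_lt_succ j.2)
  simpa [Path.vtx] using this

theorem Path.isPath {n : ℕ} (p : Path n) : IsPath n p.vtx := by
  intro j hj
  have h := p.2 ⟨j, hj⟩
  have e1 : (Fin.castSucc ⟨j, hj⟩ : Fin (n + 1)) = Fin.ofNat (n + 1) j := by
    ext; simp [Nat.mod_eq_of_lt (show j < n + 1 by omega)]
  have e2 : (Fin.succ ⟨j, hj⟩ : Fin (n + 1)) = Fin.ofNat (n + 1) (j + 1) := by
    ext; simp [Nat.mod_eq_of_lt (show j + 1 < n + 1 by omega)]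
  rw [e1, e2] at h
  exact h

/-- The basis vector of the path `w 0, …, w n`; it is `0` if this sequence is not a path. -/
def vec (n : ℕ) (w : ℕ → Vtx) : Path n → ℂ := fun p => if ∀ j ≤ n, p.vtx j = w j then 1 else 0

theorem vec_of_not_isPath {n : ℕ} {w : ℕ → Vtx} (h : ¬ IsPath n w) : vec n w = 0 := by
  funext p
  rw [vec, if_neg, Pi.zero_apply]
  intro hp
  refine h fun j hj => ?_
  rw [← hp j hj.le, ← hp (j + 1) hj]
  exact p.isPath j hj

theorem vec_congr {n : ℕ} {w w' : ℕ → Vtx} (h : ∀ j ≤ n, w j = w' j) : vec n w = vec n w' := by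
  funext p
  simp only [vec]
  refine if_congr ?_ rfl rfl
  exact forall₂_congr fun j hj => by rw [h j hj]

theorem vec_vtx {n : ℕ} (p : Path n) : vec n p.vtx = Pi.single p 1 := by
  funext p'
  by_cases h : p' = p
  · subst h; simp [vec]
  · rw [Pi.single_eq_of_ne h, vec, if_neg]
    exact fun h' => h (Path.ext_vtx h')

theorem vec_vtx_vecMul {m n : ℕ} (p : Path m) (A : Matrix (Path m) (Path n) ℂ) :
    vec m p.vtx ᵥ* A = A p := by
  rw [vec_vtx, single_one_vecMul]; rfl

theorem vec_vecMul {m n : ℕ} {w : ℕ → Vtx} (h : IsPath m w) (A : Matrix (Path m) (Path n) ℂ) :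
    vec m w ᵥ* A = A (Path.ofSeq w h) := by
  refine Eq.trans ?_ (vec_vtx_vecMul _ A)
  rw [vec_congr fun j hj => (Path.vtx_ofSeq h hj).symm]

theorem matrix_ext_vec {m n : ℕ} {A B : Matrix (Path m) (Path n) ℂ}
    (h : ∀ w, IsPath m w → vec m w ᵥ* A = vec m w ᵥ* B) : A = B := by
  funext p
  rw [← vec_vtx_vecMul p A, ← vec_vtx_vecMul p B]
  exact h _ p.isPath

/-! ### The slices of a tangle acting on basis vectors -/

/-- The sequence `w` with its `i`-th entry `a` replaced by `a, x, a`. -/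
def ins (w : ℕ → Vtx) (i : ℕ) (x : Vtx) : ℕ → Vtx :=
  fun j => if j ≤ i then w j else if j = i + 1 then x else w (j - 2)

/-- The sequence `w` without its entries `w (i + 1)` and `w (i + 2)`. -/
def del (w : ℕ → Vtx) (i : ℕ) : ℕ → Vtx := fun j => if j ≤ i then w j else w (j + 2)

theorem isPath_of_ins {n i : ℕ} {w : ℕ → Vtx} {x : Vtx}
    (h : IsPath (n + 2) (ins w i x)) : IsPath n w := by
  intro j hj
  rcases lt_or_ge j i with hji | hji
  · have := h j (by omega)
    simpa [ins, hji.le, Nat.succ_le_of_lt hji] using this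
  · have := h (j + 2) (by omega)
    have h1 : ¬ j + 2 ≤ i := by omega
    have h2 : ¬ j + 2 + 1 ≤ i := by omega
    have h3 : ¬ j + 2 = i + 1 := by omega
    have h4 : ¬ j + 2 + 1 = i + 1 := by omega
    have h5 : ¬ j + 2 = i := by omega
    simpa [ins, h1, h2, h3, h4, h5] using this

/-- A maximum inserts all possible detours: the row of `cap n i` at the path `w` is the sum of the
paths in which the vertex `a = w i` is replaced by `a, x, a`, weighted by the local factor.  Rows
are written as products with basis vectors, which allows sequences that are not paths. -/
theorem vec_vecMul_cap {n i : ℕ} (hi : i ≤ n) (w : ℕ → Vtx) :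
    vec n w ᵥ* cap n i =
      ∑ x, ((√(lam x / lam (w i)) : ℝ) : ℂ) • vec (n + 2) (ins w i x) := by
  by_cases hw : IsPath n w
  · rw [vec_vecMul hw]
    funext p
    rw [Finset.sum_apply, Finset.sum_eq_single (p.vtx (i + 1))]
    · simp only [cap, Pi.smul_apply, vec, smul_eq_mul, mul_ite, mul_one, mul_zero]
      have key : (∀ j ≤ n, (j ≤ i → (Path.ofSeq w hw).vtx j = p.vtx j) ∧
          (i ≤ j → (Path.ofSeq w hw).vtx j = p.vtx (j + 2))) ↔
          ∀ j ≤ n + 2, p.vtx j = ins w i (p.vtx (i + 1)) j := by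
        constructor
        · intro h j hj
          simp only [ins]
          split_ifs with h1 h2
          · rw [← (h j (by omega)).1 h1, Path.vtx_ofSeq hw (by omega)]
          · rw [h2]
          · have := (h (j - 2) (by omega)).2 (by omega)
            rw [Path.vtx_ofSeq hw (by omega), show j - 2 + 2 = j by omega] at this
            exact this.symm
        · intro h j hj
          rw [Path.vtx_ofSeq hw hj]
          refine ⟨fun h1 => ?_, fun h1 => ?_⟩
          · have := h j (by omega)
            rw [ins, if_pos h1] at this
            exact this.symm
          · have := h (j + 2) (by omega)
            rw [ins, if_neg (by omega), if_neg (by omega)] at this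
            simpa using this.symm
      by_cases hc : ∀ j ≤ n + 2, p.vtx j = ins w i (p.vtx (i + 1)) j
      · rw [if_pos (key.2 hc), if_pos hc]
        have := hc i (by omega)
        rw [ins, if_pos le_rfl] at this
        rw [this]
      · rw [if_neg (fun h => hc (key.1 h)), if_neg hc]
    · intro x _ hx
      rw [Pi.smul_apply, vec, if_neg, smul_zero]
      intro h
      have := h (i + 1) (by omega)
      rw [ins, if_neg (by omega), if_pos rfl] at this
      exact hx this.symm
    · simp
  · rw [vec_of_not_isPath hw, zero_vecMul]
    refine (Finset.sum_eq_zero fun x _ => ?_).symm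
    rw [vec_of_not_isPath fun h => hw (isPath_of_ins h), smul_zero]

/-- A minimum removes a detour, and annihilates the paths that do not have one at its place. -/
theorem vec_vecMul_cup {n i : ℕ} (hi : i ≤ n) {w : ℕ → Vtx} (hadj : H.Adj (w i) (w (i + 1))) :
    vec (n + 2) w ᵥ* cup n i =
      if w i = w (i + 2) then
        ((√(lam (w (i + 1)) / lam (w i)) : ℝ) : ℂ) • vec n (del w i) else 0 := by
  by_cases hw : IsPath (n + 2) w
  · rw [vec_vecMul hw]
    funext p
    simp only [cup, transpose_apply, cap]
    rw [Path.vtx_ofSeq hw (show i + 1 ≤ n + 2 by omega),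
      Path.vtx_ofSeq hw (show i ≤ n + 2 by omega)]
    have key : (∀ j ≤ n, (j ≤ i → p.vtx j = (Path.ofSeq w hw).vtx j) ∧
        (i ≤ j → p.vtx j = (Path.ofSeq w hw).vtx (j + 2))) ↔
        w i = w (i + 2) ∧ ∀ j ≤ n, p.vtx j = del w i j := by
      constructor
      · intro h
        constructor
        · have := h i hi
          rw [Path.vtx_ofSeq hw (by omega), Path.vtx_ofSeq hw (by omega)] at this
          rw [← this.1 le_rfl, ← this.2 le_rfl]
        · intro j hj
          rw [del]
          split_ifs with h1
          · rw [(h j hj).1 h1, Path.vtx_ofSeq hw (by omega)]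
          · rw [(h j hj).2 (by omega), Path.vtx_ofSeq hw (by omega)]
      · rintro ⟨h0, h⟩ j hj
        rw [h j hj, Path.vtx_ofSeq hw (by omega), Path.vtx_ofSeq hw (by omega), del]
        refine ⟨fun h1 => if_pos h1, fun h1 => ?_⟩
        split_ifs with h2
        · rw [show j = i by omega, h0]
        · rfl
    by_cases h0 : w i = w (i + 2)
    · rw [if_pos h0]
      simp only [Pi.smul_apply, vec, smul_eq_mul, mul_ite, mul_one, mul_zero]
      exact if_congr (key.trans (and_iff_right h0)) rfl rfl
    · rw [if_neg h0, if_neg fun h => h0 (key.1 h).1, Pi.zero_apply]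
  · rw [vec_of_not_isPath hw, zero_vecMul]
    split_ifs with h0
    · rw [vec_of_not_isPath, smul_zero]
      intro h
      refine hw fun j hj => ?_
      rcases lt_trichotomy j i with hji | hji | hji
      · have := h j (by omega)
        rwa [del, del, if_pos (by omega), if_pos (by omega)] at this
      · rw [hji]; exact hadj
      · rcases eq_or_ne j (i + 1) with h1 | h1
        · rw [h1, show i + 1 + 1 = i + 2 from rfl, ← h0]; exact hadj.symm
        · have := h (j - 2) (by omega)
          rcases eq_or_ne j (i + 2) with h2 | h2
          · subst h2
            simpa [del, ← h0] using this
          · rw [del, del, if_neg (by omega), if_neg (by omega), show j - 2 + 2 = j by omega,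
              show j - 2 + 1 + 2 = j + 1 by omega] at this
            exact this
    · rfl

/-! ### The Perron-Frobenius eigenvector -/

theorem sq_sqrt_twentyone : √21 ^ 2 = (21 : ℝ) := Real.sq_sqrt (by norm_num)

theorem four_lt_sqrt_twentyone : 4 < √(21 : ℝ) := Real.lt_sqrt_of_sq_lt (by norm_num)

theorem sqrt_twentyone_lt_five : √(21 : ℝ) < 5 := by
  rw [Real.sqrt_lt' (by norm_num)]; norm_num

theorem lam_pos (x : Vtx) : 0 < lam x := by
  have := four_lt_sqrt_twentyone
  have := sqrt_twentyone_lt_five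
  cases x <;> exact Real.sqrt_pos.2 (by linarith)

theorem lam_z (i : Fin 3) : lam (z i) = lam (z 0) := rfl

theorem lam_b (i : Fin 3) : lam (b i) = lam (b 0) := rfl

theorem delta_pos : 0 < delta := Real.sqrt_pos.2 (by positivity)

theorem delta_sq : delta ^ 2 = (5 + √21) / 2 := Real.sq_sqrt (by positivity)

theorem eq_mul_of_sq_eq {x y k : ℝ} (hx : 0 ≤ x) (hy : 0 ≤ y) (hk : 0 ≤ k)
    (h : x ^ 2 = k ^ 2 * y ^ 2) : x = k * y := by
  rw [← mul_pow] at h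
  exact (pow_left_inj₀ hx (mul_nonneg hk hy) two_ne_zero).1 h

theorem lam_sq_z (i : Fin 3) : lam (z i) ^ 2 = (7 - √21) / 42 :=
  Real.sq_sqrt (by linarith [sqrt_twentyone_lt_five])

theorem lam_sq_b (i : Fin 3) : lam (b i) ^ 2 = (7 + √21) / 42 := Real.sq_sqrt (by positivity)

theorem lam_sq_c : lam c ^ 2 = (21 + 3 * √21) / 42 := Real.sq_sqrt (by positivity)

theorem lam_sq_d : lam d ^ 2 = (21 - 3 * √21) / 42 :=
  Real.sq_sqrt (by linarith [sqrt_twentyone_lt_five])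

theorem lam_c_eq : lam c = (3 + √21) / 2 * lam (z 0) := by
  refine eq_mul_of_sq_eq (lam_pos _).le (lam_pos _).le (by positivity) ?_
  rw [lam_sq_c, lam_sq_z]
  linear_combination ((√21 - 1) / 168) * sq_sqrt_twentyone

theorem lam_d_eq : lam d = (√21 - 3) / 2 * lam (b 0) := by
  refine eq_mul_of_sq_eq (lam_pos _).le (lam_pos _).le
    (by linarith [four_lt_sqrt_twentyone]) ?_
  rw [lam_sq_d, lam_sq_b]
  linear_combination ((-√21 - 1) / 168) * sq_sqrt_twentyone

theorem lam_b_eq : lam (b 0) = delta * lam (z 0) := by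
  refine eq_mul_of_sq_eq (lam_pos _).le (lam_pos _).le delta_pos.le ?_
  rw [delta_sq, lam_sq_b, lam_sq_z]
  linear_combination (1 / 84) * sq_sqrt_twentyone

theorem lam_c_eq_delta : lam c = delta * lam d := by
  refine eq_mul_of_sq_eq (lam_pos _).le (lam_pos _).le delta_pos.le ?_
  rw [delta_sq, lam_sq_c, lam_sq_d]
  linear_combination (3 / 84) * sq_sqrt_twentyone

theorem sum_vtx {M : Type*} [AddCommMonoid M] (f : Vtx → M) :
    ∑ x, f x = (∑ i, f (z i)) + (∑ i, f (b i)) + f c + f d := by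
  have : (Finset.univ : Finset Vtx) = {z 0, z 1, z 2, b 0, b 1, b 2, c, d} := by decide
  rw [this]
  simp [Fin.sum_univ_three, add_assoc]

/-- The vector `lam` is an eigenvector of the adjacency matrix of `H` for `delta`. -/
theorem sum_adj_lam (a : Vtx) : ∑ x, (if H.Adj a x then lam x else 0) = delta * lam a := by
  have hb := lam_b_eq
  have hcz := lam_c_eq
  have hd := lam_d_eq
  have hcd := lam_c_eq_delta
  have h2 := delta_sq
  have aux : lam c + lam (z 0) = delta * lam (b 0) := by
    rw [hb, ← mul_assoc, ← sq, h2, hcz]; ring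
  have hc : (lam (b 0) + lam (b 0) + lam (b 0)) + lam d = delta * lam c := by
    have hz : lam (z 0) ≠ 0 := (lam_pos _).ne'
    rw [hd, hcz, hb]; ring
  rw [sum_vtx]
  simp only [Fin.sum_univ_three]
  cases a with
  | z i =>
    rw [lam_z i, ← hb]
    fin_cases i <;>
    simp [H, edge, SimpleGraph.fromRel_adj, lam_b]
  | b i =>
    rw [lam_b i, ← aux]
    fin_cases i <;>
    simp [H, edge, SimpleGraph.fromRel_adj, lam_z, add_comm]
  | c =>
    rw [← hc]
    simp [H, edge, SimpleGraph.fromRel_adj, lam_b]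
  | d =>
    rw [← hcd]
    simp [H, edge, SimpleGraph.fromRel_adj]

theorem sqrt_ratio_mul_self (x a : Vtx) :
    ((√(lam x / lam a) : ℝ) : ℂ) * ((√(lam x / lam a) : ℝ) : ℂ) = ((lam x / lam a : ℝ) : ℂ) := by
  rw [← Complex.ofReal_mul, Real.mul_self_sqrt (div_nonneg (lam_pos _).le (lam_pos _).le)]

theorem sqrt_ratio_mul_inv (x a : Vtx) :
    ((√(lam x / lam a) : ℝ) : ℂ) * ((√(lam a / lam x) : ℝ) : ℂ) = 1 := by
  rw [← Complex.ofReal_mul, ← Real.sqrt_mul (div_nonneg (lam_pos _).le (lam_pos _).le),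
    div_mul_div_cancel₀ (lam_pos _).ne', div_self (lam_pos _).ne', Real.sqrt_one,
    Complex.ofReal_one]

/-! ### The Temperley-Lieb relations -/

theorem isPath_ins_adj {n i : ℕ} {w : ℕ → Vtx} {x : Vtx} (hi : i ≤ n)
    (h : IsPath (n + 2) (ins w i x)) : H.Adj (w i) x := by
  have := h i (by omega)
  simpa [ins] using this

theorem cap_mul_cup_self {n i : ℕ} (hi : i ≤ n) : cap n i * cup n i = (delta : ℂ) • 1 := by
  refine matrix_ext_vec fun w hw => ?_
  rw [← vecMul_vecMul, vec_vecMul_cap hi, sum_vecMul, vecMul_smul, vecMul_one]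
  have : ∀ x, ((√(lam x / lam (w i)) : ℝ) : ℂ) • vec (n + 2) (ins w i x) ᵥ* cup n i =
      (((if H.Adj (w i) x then lam x else 0) / lam (w i) : ℝ) : ℂ) • vec n w := by
    intro x
    split_ifs with hx
    · have e0 : ins w i x i = w i := by simp [ins]
      have e1 : ins w i x (i + 1) = x := by simp [ins]
      have e2 : ins w i x (i + 2) = w i := by simp [ins]
      rw [vec_vecMul_cup hi (by rwa [e0, e1]), if_pos (by rw [e0, e2]), e0, e1, smul_smul,
        sqrt_ratio_mul_self]
      congr 1
      refine vec_congr fun j _ => ?_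
      by_cases hj : j ≤ i
      · simp [del, ins, hj]
      · simp [del, ins, hj, show ¬ j + 2 ≤ i by omega, show ¬ j + 2 = i + 1 by omega]
    · rw [vec_of_not_isPath fun h => hx (isPath_ins_adj hi h)]
      simp
  simp_rw [smul_vecMul, this]
  rw [← Finset.sum_smul, ← Complex.ofReal_sum, ← Finset.sum_div, sum_adj_lam,
    mul_div_cancel_right₀ _ (lam_pos _).ne']

theorem cap_mul_cup_succ {n i : ℕ} (hi : i + 1 ≤ n) : cap n i * cup n (i + 1) = 1 := by
  refine matrix_ext_vec fun w hw => ?_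
  rw [← vecMul_vecMul, vec_vecMul_cap (by omega), sum_vecMul, vecMul_one,
    Finset.sum_eq_single (w (i + 1))]
  · have e1 : ins w i (w (i + 1)) (i + 1) = w (i + 1) := by simp [ins]
    have e2 : ins w i (w (i + 1)) (i + 1 + 1) = w i := by simp [ins]
    have e3 : ins w i (w (i + 1)) (i + 1 + 2) = w (i + 1) := by
      rw [ins, if_neg (by omega), if_neg (by omega)]; rfl
    rw [smul_vecMul, vec_vecMul_cup hi (by rw [e1, e2]; exact (hw i (by omega)).symm),
      if_pos (by rw [e1, e3]), e1, e2, smul_smul, sqrt_ratio_mul_inv, one_smul]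
    refine vec_congr fun j _ => ?_
    rcases lt_trichotomy j (i + 1) with hj | hj | hj
    · simp [del, ins, hj.le, show j ≤ i by omega]
    · simp [del, ins, hj]
    · simp [del, ins, show ¬ j ≤ i + 1 by omega, show ¬ j + 2 ≤ i by omega,
        show ¬ j + 2 = i + 1 by omega]
  · intro x _ hx
    by_cases hadj : H.Adj (w i) x
    · have e1 : ins w i x (i + 1) = x := by simp [ins]
      have e2 : ins w i x (i + 1 + 1) = w i := by simp [ins]
      have e3 : ins w i x (i + 1 + 2) = w (i + 1) := by
        rw [ins, if_neg (by omega), if_neg (by omega)]; rfl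
      rw [smul_vecMul, vec_vecMul_cup hi (by rw [e1, e2]; exact hadj.symm),
        if_neg (by rwa [e1, e3]), smul_zero]
    · rw [vec_of_not_isPath fun h => hadj (isPath_ins_adj (by omega) h)]
      simp
  · simp

theorem cap_succ_mul_cup {n i : ℕ} (hi : i + 1 ≤ n) : cap n (i + 1) * cup n i = 1 := by
  refine matrix_ext_vec fun w hw => ?_
  have e0 : ∀ x, ins w (i + 1) x i = w i := fun x => by simp [ins]
  have e1 : ∀ x, ins w (i + 1) x (i + 1) = w (i + 1) := fun x => by simp [ins]
  have e2 : ∀ x, ins w (i + 1) x (i + 2) = x := fun x => by simp [ins]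
  rw [← vecMul_vecMul, vec_vecMul_cap hi, sum_vecMul, vecMul_one, Finset.sum_eq_single (w i)]
  · rw [smul_vecMul, vec_vecMul_cup (by omega) (by rw [e0, e1]; exact hw i (by omega)),
      if_pos (by rw [e0, e2]), e0, e1, smul_smul, sqrt_ratio_mul_inv, one_smul]
    refine vec_congr fun j _ => ?_
    rcases lt_trichotomy j (i + 1) with hj | hj | hj
    · simp [del, ins, hj.le, show j ≤ i by omega]
    · simp [del, ins, hj]
    · simp [del, ins, show ¬ j ≤ i by omega, show ¬ j + 1 ≤ i by omega,
        show ¬ j = i by omega]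
  · intro x _ hx
    rw [smul_vecMul, vec_vecMul_cup (by omega) (by rw [e0, e1]; exact hw i (by omega)),
      if_neg (by rw [e0, e2]; exact hx.symm), smul_zero]
  · simp

/-- The Temperley-Lieb generator joining the strings `i` and `i + 1` of `8` strings. -/
noncomputable def tl (i : ℕ) : Matrix (Path 8) (Path 8) ℂ := cup 6 i * cap 6 i

theorem tl_mul_self {i : ℕ} (hi : i ≤ 6) : tl i * tl i = (delta : ℂ) • tl i := by
  rw [tl, Matrix.mul_assoc, ← Matrix.mul_assoc (cap 6 i), cap_mul_cup_self hi, Matrix.smul_mul,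
    Matrix.one_mul, Matrix.mul_smul]

theorem tl_succ_mul_mul {i : ℕ} (hi : i + 1 ≤ 6) :
    tl (i + 1) * tl i * tl (i + 1) = tl (i + 1) := by
  calc tl (i + 1) * tl i * tl (i + 1)
      = cup 6 (i + 1) * (cap 6 (i + 1) * cup 6 i) * (cap 6 i * cup 6 (i + 1)) *
          cap 6 (i + 1) := by simp only [tl, Matrix.mul_assoc]
    _ = tl (i + 1) := by
        rw [cap_mul_cup_succ hi, cap_succ_mul_cup hi, Matrix.mul_one, Matrix.mul_one, tl]

theorem vec_vecMul_tl {i : ℕ} (hi : i ≤ 6) {w : ℕ → Vtx} (hadj : H.Adj (w i) (w (i + 1))) :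
    vec 8 w ᵥ* tl i = if w i = w (i + 2) then
      ∑ x, ((√(lam (w (i + 1)) / lam (w i)) * √(lam x / lam (w i)) : ℝ) : ℂ) •
        vec 8 (Function.update w (i + 1) x) else 0 := by
  rw [tl, ← vecMul_vecMul, vec_vecMul_cup hi hadj]
  split_ifs with h
  · have e0 : del w i i = w i := by simp [del]
    rw [smul_vecMul, vec_vecMul_cap hi, e0, Finset.smul_sum]
    refine Finset.sum_congr rfl fun x _ => ?_
    rw [smul_smul, Complex.ofReal_mul]
    congr 1
    refine vec_congr fun j _ => ?_
    rcases lt_trichotomy j (i + 1) with hj | hj | hj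
    · simp [del, ins, show j ≤ i by omega, Function.update_of_ne hj.ne]
    · simp [ins, hj]
    · rw [Function.update_of_ne hj.ne', ins, if_neg (by omega), if_neg (by omega), del]
      split_ifs with h'
      · rw [show j = i + 2 by omega, ← h]; rfl
      · rw [show j - 2 + 2 = j by omega]
  · rw [zero_vecMul]

/-- Temperley-Lieb generators on disjoint pairs of strings commute. -/
theorem tl_mul_tl_of_far {i j : ℕ} (hi : i ≤ 6) (hj : j ≤ 6) (h : i + 2 ≤ j) :
    tl i * tl j = tl j * tl i := by
  refine matrix_ext_vec fun w hw => ?_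
  have ai := hw i (by omega)
  have aj := hw j (by omega)
  rw [← vecMul_vecMul, ← vecMul_vecMul, vec_vecMul_tl hi ai, vec_vecMul_tl hj aj]
  have ui : ∀ x, ∀ k, k ≠ i + 1 → Function.update w (i + 1) x k = w k :=
    fun x k hk => Function.update_of_ne hk _ _
  have uj : ∀ x, ∀ k, k ≠ j + 1 → Function.update w (j + 1) x k = w k :=
    fun x k hk => Function.update_of_ne hk _ _
  have hji : ∀ x, vec 8 (Function.update w (i + 1) x) ᵥ* tl j = if w j = w (j + 2) then
      ∑ y, ((√(lam (w (j + 1)) / lam (w j)) * √(lam y / lam (w j)) : ℝ) : ℂ) •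
        vec 8 (Function.update (Function.update w (i + 1) x) (j + 1) y) else 0 := by
    intro x
    have e0 := ui x j (by omega)
    have e1 := ui x (j + 1) (by omega)
    have e2 := ui x (j + 2) (by omega)
    rw [vec_vecMul_tl hj (by rwa [e0, e1]), e0, e1, e2]
  have hij : ∀ x, vec 8 (Function.update w (j + 1) x) ᵥ* tl i = if w i = w (i + 2) then
      ∑ y, ((√(lam (w (i + 1)) / lam (w i)) * √(lam y / lam (w i)) : ℝ) : ℂ) •
        vec 8 (Function.update (Function.update w (j + 1) x) (i + 1) y) else 0 := by
    intro x
    have e0 := uj x i (by omega)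
    have e1 := uj x (i + 1) (by omega)
    have e2 := uj x (i + 2) (by omega)
    rw [vec_vecMul_tl hi (by rwa [e0, e1]), e0, e1, e2]
  by_cases hwi : w i = w (i + 2) <;> by_cases hwj : w j = w (j + 2)
  · simp only [if_pos hwi, if_pos hwj, sum_vecMul, smul_vecMul] at hij hji ⊢
    simp only [hij, hji, Finset.smul_sum]
    rw [Finset.sum_comm]
    refine Finset.sum_congr rfl fun y _ => Finset.sum_congr rfl fun x _ => ?_
    rw [smul_comm, Function.update_comm (by omega)]
  · simp only [if_pos hwi, if_neg hwj, sum_vecMul, smul_vecMul] at hij hji ⊢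
    simp [hji]
  · simp only [if_neg hwi, if_pos hwj, sum_vecMul, smul_vecMul] at hij hji ⊢
    simp [hij]
  · simp [if_neg hwi, if_neg hwj]

/-! ### The Jones-Wenzl idempotent is annihilated by caps -/

theorem q_spec : 1 < q ∧ q + q⁻¹ = delta := by
  have h1 : delta ^ 2 - 4 = (√21 - 3) / 2 := by rw [delta_sq]; ring
  have h4 : 0 < delta ^ 2 - 4 := by rw [h1]; linarith [four_lt_sqrt_twentyone]
  have hd : 2 < delta := by nlinarith [delta_pos]
  have hs : 0 < √(delta ^ 2 - 4) := Real.sqrt_pos.2 h4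
  have hss : √(delta ^ 2 - 4) ^ 2 = delta ^ 2 - 4 := Real.sq_sqrt h4.le
  have hq : 1 < q := by rw [q]; linarith
  refine ⟨hq, ?_⟩
  have hq0 : q ≠ 0 := by positivity
  have : q * q + 1 = delta * q := by
    rw [q]; linear_combination (1 / 4) * hss
  field_simp
  linear_combination this

theorem q_sub_inv_pos : 0 < q - q⁻¹ := by
  have := inv_lt_one_of_one_lt₀ q_spec.1
  linarith [q_spec.1]

theorem qnum_pos {n : ℕ} (hn : n ≠ 0) : 0 < qnum n := by
  have hq := q_spec.1
  refine div_pos ?_ q_sub_inv_pos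
  have h1 : q⁻¹ ^ n < 1 := pow_lt_one₀ (by positivity) (inv_lt_one_of_one_lt₀ hq) hn
  have h2 : 1 < q ^ n := one_lt_pow₀ hq hn
  linarith

theorem qnum_one : qnum 1 = 1 := by
  rw [qnum, pow_one, pow_one, div_self q_sub_inv_pos.ne']

theorem qnum_two : qnum 2 = delta := by
  rw [qnum, div_eq_iff q_sub_inv_pos.ne', ← q_spec.2]; ring

theorem qnum_add_two (n : ℕ) : qnum (n + 2) + qnum n = delta * qnum (n + 1) := by
  have hq : q * q⁻¹ = 1 := mul_inv_cancel₀ (by linarith [q_spec.1])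
  rw [qnum, qnum, qnum, ← q_spec.2, ← add_div, mul_div_assoc']
  congr 1
  linear_combination -(q ^ n - q⁻¹ ^ n) * hq

/-- The coefficient `[n + 1] / [n + 2]` in Wenzl's relation. -/
noncomputable def wenzl (n : ℕ) : ℂ := ((qnum (n + 1) / qnum (n + 2) : ℝ) : ℂ)

theorem jw_add_two (n : ℕ) :
    jw (n + 2) = jw (n + 1) - wenzl n • (jw (n + 1) * tl n * jw (n + 1)) := rfl

theorem wenzl_ne_zero (n : ℕ) : wenzl n ≠ 0 :=
  Complex.ofReal_ne_zero.2 (div_pos (qnum_pos n.succ_ne_zero) (qnum_pos (by omega))).ne'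

theorem inv_wenzl_zero : (wenzl 0)⁻¹ = delta := by
  rw [wenzl, qnum_one, qnum_two, one_div, Complex.ofReal_inv, inv_inv]

theorem inv_wenzl_succ (n : ℕ) : (wenzl (n + 1))⁻¹ = delta - wenzl n := by
  have h : qnum (n + 3) + qnum (n + 1) = delta * qnum (n + 2) := qnum_add_two (n + 1)
  have h2 : qnum (n + 2) ≠ 0 := (qnum_pos (by omega)).ne'
  have h3 : qnum (n + 3) / qnum (n + 2) = delta - qnum (n + 1) / qnum (n + 2) := by
    field_simp
    linear_combination h
  have h4 : wenzl (n + 1) = ((qnum (n + 2) / qnum (n + 3) : ℝ) : ℂ) := rfl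
  rw [h4, wenzl, ← Complex.ofReal_inv, ← Complex.ofReal_sub, inv_div, h3]

theorem tl_commute_jw {n j : ℕ} (hnj : n ≤ j) (hj : j ≤ 6) : tl j * jw n = jw n * tl j := by
  induction n using Nat.twoStepInduction with
  | zero => rw [jw, Matrix.mul_one, Matrix.one_mul]
  | one => rw [jw, Matrix.mul_one, Matrix.one_mul]
  | more n _ ih =>
    have h1 : tl j * jw (n + 1) = jw (n + 1) * tl j := ih (by omega)
    have h2 : tl n * tl j = tl j * tl n := tl_mul_tl_of_far (by omega) hj hnj
    have h3 : tl j * (jw (n + 1) * tl n * jw (n + 1)) =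
        jw (n + 1) * tl n * jw (n + 1) * tl j := by
      rw [Matrix.mul_assoc _ _ (tl j), ← h1, ← Matrix.mul_assoc, ← Matrix.mul_assoc, h1,
        Matrix.mul_assoc _ (tl j), ← h2]
      simp only [Matrix.mul_assoc, h1]
    rw [jw_add_two, Matrix.mul_sub, Matrix.sub_mul, Matrix.mul_smul, Matrix.smul_mul, h1, h3]

/-- The properties of the Jones-Wenzl idempotents that Wenzl's recursion preserves. -/
structure JonesWenzl (n : ℕ) : Prop where
  idem : jw (n + 1) * jw (n + 1) = jw (n + 1)
  mul_pred : jw (n + 1) * jw n = jw (n + 1)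
  pred_mul : jw n * jw (n + 1) = jw (n + 1)
  tl_mul : ∀ i < n, tl i * jw (n + 1) = 0
  tl_mul_mul_tl : n ≤ 6 → tl n * jw (n + 1) * tl n = (wenzl n)⁻¹ • (jw n * tl n)

/-- Wenzl's induction.  The trace relation at the next string, with coefficient
`(wenzl n)⁻¹ = [n + 2] / [n + 1]`, is what makes the subtracted term in the
recursion an idempotent. -/
theorem jonesWenzl {n : ℕ} (hn : n ≤ 7) : JonesWenzl n := by
  induction n with
  | zero =>
    refine ⟨Matrix.one_mul _, Matrix.one_mul _, Matrix.one_mul _,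
      fun i hi => absurd hi (by omega), fun _ => ?_⟩
    rw [inv_wenzl_zero, jw, jw, Matrix.mul_one, Matrix.one_mul, tl_mul_self (by omega)]
  | succ n ih =>
    obtain ⟨idem, mul_pred, pred_mul, tl_mul, key⟩ := ih (by omega)
    have key := key (by omega)
    have hc : tl n * jw n = jw n * tl n := tl_commute_jw le_rfl (by omega)
    have hx := wenzl_ne_zero n
    set f := jw (n + 1) with hf
    set e := tl n with he
    set x := wenzl n with hxdef
    have hF : jw (n + 1 + 1) = f - x • (f * e * f) := jw_add_two n
    have hFf : jw (n + 1 + 1) * f = jw (n + 1 + 1) := by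
      rw [hF, Matrix.sub_mul, Matrix.smul_mul, Matrix.mul_assoc _ f f, idem]
    have hefe : f * e * f * (f * e * f) = x⁻¹ • (f * e * f) := by
      calc f * e * f * (f * e * f) = f * (e * (f * f) * e) * f := by simp only [Matrix.mul_assoc]
        _ = x⁻¹ • (f * jw n * e * f) := by
          rw [idem, key, Matrix.mul_smul, Matrix.smul_mul, ← Matrix.mul_assoc f]
        _ = _ := by rw [mul_pred]
    have heF : e * jw (n + 1 + 1) = 0 := by
      have h1 : e * (f * e * f) = x⁻¹ • (e * f) := by
        calc e * (f * e * f) = e * f * e * f := by simp only [Matrix.mul_assoc]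
          _ = x⁻¹ • (e * (jw n * f)) := by
            rw [key, Matrix.smul_mul, ← hc, Matrix.mul_assoc]
          _ = _ := by rw [pred_mul]
      rw [hF, Matrix.mul_sub, Matrix.mul_smul, h1, smul_smul, mul_inv_cancel₀ hx, one_smul,
        sub_self]
    have hfF : f * jw (n + 1 + 1) = jw (n + 1 + 1) := by
      rw [hF, Matrix.mul_sub, Matrix.mul_smul, Matrix.mul_assoc f e, ← Matrix.mul_assoc f f,
        idem]
    refine ⟨?_, hFf, hfF, fun i hi => ?_, fun hn6 => ?_⟩
    · have h1 : f * e * f * jw (n + 1 + 1) = 0 := by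
        rw [Matrix.mul_assoc, hfF, Matrix.mul_assoc, heF, Matrix.mul_zero]
      have h2 : (f - x • (f * e * f)) * jw (n + 1 + 1) = jw (n + 1 + 1) := by
        rw [Matrix.sub_mul, Matrix.smul_mul, h1, smul_zero, sub_zero, hfF]
      rwa [← hF] at h2
    · rcases Nat.lt_succ_iff_lt_or_eq.1 hi with hi | rfl
      · rw [← hfF, ← Matrix.mul_assoc, tl_mul i hi, Matrix.zero_mul]
      · exact heF
    · have hg : tl (n + 1) * f = f * tl (n + 1) := tl_commute_jw le_rfl hn6
      set g := tl (n + 1) with hgdef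
      have hgg : g * g = (delta : ℂ) • g := tl_mul_self hn6
      have hgeg : g * e * g = g := tl_succ_mul_mul hn6
      have h1 : g * f * g = (delta : ℂ) • (f * g) := by
        rw [hg, Matrix.mul_assoc, hgg, Matrix.mul_smul]
      have h2 : g * (f * e * f) * g = f * g := by
        calc g * (f * e * f) * g = g * f * e * (f * g) := by simp only [Matrix.mul_assoc]
          _ = f * (g * e * g) * f := by rw [← hg, hg]; simp only [Matrix.mul_assoc]; rw [hg]
          _ = f * (g * f) := by rw [hgeg, Matrix.mul_assoc]
          _ = f * g := by rw [hg, ← Matrix.mul_assoc, idem]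
      rw [inv_wenzl_succ, hF, Matrix.mul_sub, Matrix.sub_mul, h1, Matrix.mul_smul,
        Matrix.smul_mul, h2, sub_smul]

/-- The only property of the Jones-Wenzl idempotent that the relations depend on. -/
theorem cap_mul_jw {i : ℕ} (hi : i ≤ 6) : cap 6 i * jw 8 = 0 := by
  have h : tl i * jw 8 = 0 := (jonesWenzl (n := 7) le_rfl).tl_mul i (by omega)
  have h2 : cap 6 i * (tl i * jw 8) = (delta : ℂ) • (cap 6 i * jw 8) := by
    rw [tl, Matrix.mul_assoc, ← Matrix.mul_assoc (cap 6 i), cap_mul_cup_self hi,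
      Matrix.smul_mul, Matrix.one_mul]
  rw [h, Matrix.mul_zero] at h2
  exact (smul_eq_zero.1 h2.symm).resolve_left (Complex.ofReal_ne_zero.2 delta_pos.ne')

end Planar2221

namespace Planar2221

/-! ### Arithmetic in the ring `ℤ[θ, ω]` -/

/-- The Eisenstein integer `x + y ω + z ω²`.  As `-1 = ω + ω²`, natural coordinates suffice; they
are not unique. -/
structure Eis where
  x : ℕ
  y : ℕ
  z : ℕ

namespace Eis

instance : Add Eis := ⟨fun | ⟨a, b, c⟩, ⟨d, e, f⟩ => ⟨a + d, b + e, c + f⟩⟩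

instance : Mul Eis := ⟨fun
  | ⟨a, b, c⟩, ⟨d, e, f⟩ =>
    ⟨a * d + (b * f + c * e), a * e + (b * d + c * f), a * f + (b * e + c * d)⟩⟩

instance : Neg Eis := ⟨fun | ⟨a, b, c⟩ => ⟨b + c, c + a, a + b⟩⟩

/-- Multiplication by `3`. -/
def triple : Eis → Eis
  | ⟨a, b, c⟩ => ⟨3 * a, 3 * b, 3 * c⟩

/-- The coordinates represent the number `0`; as `1 + ω + ω² = 0` is the only relation, they are
then equal. -/
def isZero : Eis → Bool
  | ⟨a, b, c⟩ => a == b && b == c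

end Eis

/-- The number `c₀ + c₁ θ + c₂ θ² + c₃ θ³`, where `θ⁴ = 3 θ² + 3`. -/
structure Num where
  c₀ : Eis
  c₁ : Eis
  c₂ : Eis
  c₃ : Eis

namespace Num

instance : Add Num := ⟨fun | ⟨a, b, c, d⟩, ⟨e, f, g, h⟩ => ⟨a + e, b + f, c + g, d + h⟩⟩

instance : Neg Num := ⟨fun | ⟨a, b, c, d⟩ => ⟨-a, -b, -c, -d⟩⟩

/-- Multiplication by `θ`. -/
def mulTheta : Num → Num
  | ⟨a, b, c, d⟩ => ⟨d.triple, a, b + d.triple, c⟩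

/-- Multiplication by an Eisenstein integer. -/
def scale (k : Eis) : Num → Num
  | ⟨a, b, c, d⟩ => ⟨k * a, k * b, k * c, k * d⟩

instance : Mul Num := ⟨fun
  | ⟨a, b, c, d⟩, y =>
    y.scale a + (y.scale b + (y.scale c + (y.scale d).mulTheta).mulTheta).mulTheta⟩

/-- The coordinates represent the number `0`. -/
def isZero : Num → Bool
  | ⟨a, b, c, d⟩ => a.isZero && b.isZero && c.isZero && d.isZero

/-- The natural number `n`. -/
def nat (n : ℕ) : Num := ⟨⟨n, 0, 0⟩, ⟨0, 0, 0⟩, ⟨0, 0, 0⟩, ⟨0, 0, 0⟩⟩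

/-- The number `ω`. -/
def om : Num := ⟨⟨0, 1, 0⟩, ⟨0, 0, 0⟩, ⟨0, 0, 0⟩, ⟨0, 0, 0⟩⟩

/-- The number `θ ^ 2`. -/
def thetaSq : Num := ⟨⟨0, 0, 0⟩, ⟨0, 0, 0⟩, ⟨1, 0, 0⟩, ⟨0, 0, 0⟩⟩

end Num

/-- `forceNat f n` is `f n`.  The case distinction makes the kernel evaluate `n` before `f`. -/
def forceNat {α : Type} (f : ℕ → α) : ℕ → α
  | 0 => f 0
  | n + 1 => f (n + 1)

/-- The value `f x`, with the coordinates of `x` evaluated first. -/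
def Eis.force {α : Type} (f : Eis → α) : Eis → α
  | ⟨a, b, c⟩ => forceNat (fun a => forceNat (fun b => forceNat (fun c => f ⟨a, b, c⟩) c) b) a

/-- The value `f x`, with the coordinates of `x` evaluated first. -/
def Num.force {α : Type} (f : Num → α) : Num → α
  | ⟨a, b, c, d⟩ =>
    a.force fun a => b.force fun b => c.force fun c => d.force fun d => f ⟨a, b, c, d⟩

@[simp]
theorem forceNat_eq {α : Type} (f : ℕ → α) (n : ℕ) : forceNat f n = f n := by cases n <;> rfl

@[simp]
theorem Eis.force_eq {α : Type} (f : Eis → α) (x : Eis) : x.force f = f x := by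
  cases x; simp [Eis.force]

@[simp]
theorem Num.force_eq {α : Type} (f : Num → α) (x : Num) : x.force f = f x := by
  cases x; simp [Num.force]

theorem omega_eq : omega = -(1 / 2) + √3 / 2 * Complex.I := by
  rw [omega, show (2 * Real.pi * Complex.I / 3 : ℂ) = (Real.pi - Real.pi / 3 : ℝ) * Complex.I by
    push_cast; ring, Complex.exp_mul_I, ← Complex.ofReal_cos, ← Complex.ofReal_sin,
    Real.cos_pi_sub, Real.sin_pi_sub, Real.cos_pi_div_three, Real.sin_pi_div_three]
  push_cast
  ring

theorem omega_sq : omega ^ 2 = -1 - omega := by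
  have h3 : ((√3 : ℝ) : ℂ) ^ 2 = 3 := by
    rw [← Complex.ofReal_pow, Real.sq_sqrt (by norm_num)]; norm_num
  rw [omega_eq]
  linear_combination (1 / 4) * Complex.I ^ 2 * h3 + (3 / 4) * Complex.I_sq

theorem theta_sq : theta ^ 2 = (3 + √21) / 2 := by
  rw [theta, Real.sq_sqrt (div_nonneg (lam_pos _).le (lam_pos _).le), lam_c_eq,
    mul_div_cancel_right₀ _ (lam_pos _).ne']

theorem theta_pow_four : (theta : ℂ) ^ 4 = 3 * (theta : ℂ) ^ 2 + 3 := by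
  have h : theta ^ 4 = 3 * theta ^ 2 + 3 := by
    rw [show theta ^ 4 = (theta ^ 2) ^ 2 by ring, theta_sq]
    linear_combination (1 / 4) * sq_sqrt_twentyone
  exact_mod_cast h

/-- The complex number represented by an Eisenstein integer. -/
noncomputable def Eis.ev (e : Eis) : ℂ := e.x + e.y * omega + e.z * omega ^ 2

/-- The complex number represented by an element of `ℤ[θ, ω]`. -/
noncomputable def Num.ev (k : Num) : ℂ :=
  k.c₀.ev + k.c₁.ev * theta + k.c₂.ev * (theta : ℂ) ^ 2 + k.c₃.ev * (theta : ℂ) ^ 3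

namespace Eis

theorem ev_add (x y : Eis) : (x + y).ev = x.ev + y.ev := by
  obtain ⟨a, b, c⟩ := x
  obtain ⟨d, e, f⟩ := y
  change (((a + d : ℕ) : ℂ) + ((b + e : ℕ) : ℂ) * omega + ((c + f : ℕ) : ℂ) * omega ^ 2) =
    (a + b * omega + c * omega ^ 2) + (d + e * omega + f * omega ^ 2)
  push_cast
  ring

theorem ev_neg (x : Eis) : (-x).ev = -x.ev := by
  obtain ⟨a, b, c⟩ := x
  change (((b + c : ℕ) : ℂ) + ((c + a : ℕ) : ℂ) * omega + ((a + b : ℕ) : ℂ) * omega ^ 2) =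
    -(a + b * omega + c * omega ^ 2)
  push_cast
  linear_combination (a + b + c : ℂ) * omega_sq

theorem ev_mul (x y : Eis) : (x * y).ev = x.ev * y.ev := by
  obtain ⟨a, b, c⟩ := x
  obtain ⟨d, e, f⟩ := y
  change (((a * d + (b * f + c * e) : ℕ) : ℂ) + ((a * e + (b * d + c * f) : ℕ) : ℂ) * omega +
    ((a * f + (b * e + c * d) : ℕ) : ℂ) * omega ^ 2) =
    (a + b * omega + c * omega ^ 2) * (d + e * omega + f * omega ^ 2)
  push_cast
  linear_combination (-(b * f + c * e + c * f * omega) * (omega - 1) : ℂ) * omega_sq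

theorem ev_triple (x : Eis) : x.triple.ev = 3 * x.ev := by
  obtain ⟨a, b, c⟩ := x
  change (((3 * a : ℕ) : ℂ) + ((3 * b : ℕ) : ℂ) * omega + ((3 * c : ℕ) : ℂ) * omega ^ 2) =
    3 * (a + b * omega + c * omega ^ 2)
  push_cast
  ring

theorem ev_of_isZero {x : Eis} (h : x.isZero = true) : x.ev = 0 := by
  obtain ⟨a, b, c⟩ := x
  obtain ⟨rfl, rfl⟩ : a = b ∧ b = c := by simpa [isZero] using h
  change ((a : ℂ) + a * omega + a * omega ^ 2) = 0
  linear_combination (a : ℂ) * omega_sq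

end Eis

namespace Num

theorem ev_add (x y : Num) : (x + y).ev = x.ev + y.ev := by
  change (x.c₀ + y.c₀).ev + (x.c₁ + y.c₁).ev * theta + (x.c₂ + y.c₂).ev * (theta : ℂ) ^ 2 +
    (x.c₃ + y.c₃).ev * (theta : ℂ) ^ 3 = _
  simp only [Eis.ev_add, ev]
  ring

theorem ev_neg (x : Num) : (-x).ev = -x.ev := by
  change (-x.c₀).ev + (-x.c₁).ev * theta + (-x.c₂).ev * (theta : ℂ) ^ 2 +
    (-x.c₃).ev * (theta : ℂ) ^ 3 = _
  simp only [Eis.ev_neg, ev]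
  ring

theorem ev_mulTheta (x : Num) : x.mulTheta.ev = theta * x.ev := by
  change x.c₃.triple.ev + x.c₀.ev * theta + (x.c₁ + x.c₃.triple).ev * (theta : ℂ) ^ 2 +
    x.c₂.ev * (theta : ℂ) ^ 3 = _
  simp only [Eis.ev_add, Eis.ev_triple, ev]
  linear_combination -x.c₃.ev * theta_pow_four

theorem ev_scale (e : Eis) (x : Num) : (x.scale e).ev = e.ev * x.ev := by
  change (e * x.c₀).ev + (e * x.c₁).ev * theta + (e * x.c₂).ev * (theta : ℂ) ^ 2 +
    (e * x.c₃).ev * (theta : ℂ) ^ 3 = _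
  simp only [Eis.ev_mul, ev]
  ring

theorem ev_mul (x y : Num) : (x * y).ev = x.ev * y.ev := by
  change (y.scale x.c₀ + (y.scale x.c₁ +
    (y.scale x.c₂ + (y.scale x.c₃).mulTheta).mulTheta).mulTheta).ev = _
  simp only [ev_add, ev_mulTheta, ev_scale]
  rw [ev.eq_def x]
  ring

theorem ev_of_isZero {x : Num} (h : x.isZero = true) : x.ev = 0 := by
  obtain ⟨a, b, c, d⟩ := x
  obtain ⟨⟨⟨ha, hb⟩, hc⟩, hd⟩ : ((a.isZero = true ∧ b.isZero = true) ∧ c.isZero = true) ∧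
      d.isZero = true := by simpa [isZero] using h
  simp [ev, Eis.ev_of_isZero ha, Eis.ev_of_isZero hb, Eis.ev_of_isZero hc, Eis.ev_of_isZero hd]

theorem ev_nat (n : ℕ) : (nat n).ev = n := by simp [nat, ev, Eis.ev]

theorem ev_om : om.ev = omega := by simp [om, ev, Eis.ev]

theorem ev_thetaSq : thetaSq.ev = (theta : ℂ) ^ 2 := by simp [thetaSq, ev, Eis.ev]

end Num

end Planar2221

namespace Planar2221

open Vtx

/-! ### Formal combinations of loops -/

/-- Formal linear combinations of elements of `α`. -/
abbrev Combo (α : Type) : Type := List (Num × α)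

/-- Multiplication of a formal combination by a number. -/
def Combo.smul {α : Type} (k : Num) (l : Combo α) : Combo α :=
  k.force fun k => l.map fun t => (k * t.1).force fun k => (k, t.2)

/-- The cyclic symmetry of `H`. -/
def turn : Vtx → Vtx
  | z i => z (i + 1)
  | b i => b (i + 1)
  | c => c
  | d => d

/-- The vertices of a loop of length `6`. -/
structure Hex where
  v₁ : Vtx
  v₂ : Vtx
  v₃ : Vtx
  v₄ : Vtx
  v₅ : Vtx
  v₆ : Vtx

/-- The loop obtained by rotation by two steps. -/
def Hex.rot (v : Hex) : Hex := ⟨v.v₅, v.v₆, v.v₁, v.v₂, v.v₃, v.v₄⟩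

/-- The image of a loop under the cyclic symmetry of `H`. -/
def Hex.turn (v : Hex) : Hex := ⟨Planar2221.turn v.v₁, Planar2221.turn v.v₂, Planar2221.turn v.v₃,
  Planar2221.turn v.v₄, Planar2221.turn v.v₅, Planar2221.turn v.v₆⟩

/-- The combination obtained by applying `f` to each loop. -/
def Combo.map {α : Type} (f : α → α) (l : Combo α) : Combo α := List.map (fun t => (t.1, f t.2)) l

/-- The sum of a combination and its two images under the cyclic symmetry of `H`. -/
def orbit (l : Combo Hex) : Combo Hex := l ++ l.map Hex.turn ++ (l.map Hex.turn).map Hex.turn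

/-- The combination whose orbit is `∑ i, loopB i (i + k)`, up to the factor `λ(b) λ(c)`.  Loops
stand for weighted loops, which turns the coefficient `-θ` into `-θ²`. -/
def comboB (k : Fin 3) : Combo Hex :=
  [(.nat 1, ⟨c, b 0, c, b 0, c, b k⟩), (-.thetaSq, ⟨c, b 0, z 0, b 0, c, b k⟩)]

/-- The combination whose orbit is `∑ i, loopD i`, up to the factor `R λ(b) λ(c)`. -/
def comboD : Combo Hex :=
  [(.nat 1, ⟨c, d, c, b 0, c, b 0⟩), (-.thetaSq, ⟨c, d, c, b 0, z 0, b 0⟩)]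

/-- The combination whose orbit is `∑ i, loop c d c (b i) c (b (i + k))`, up to the factor
`R λ(b) λ(c)`. -/
def comboE (k : Fin 3) : Combo Hex := [(.nat 1, ⟨c, d, c, b 0, c, b k⟩)]

/-- `6 t`, where `t` is the coefficient `tT`. -/
def numT : Num := ⟨⟨0, 3, 3⟩, ⟨0, 7, 7⟩, ⟨1, 0, 0⟩, ⟨2, 0, 0⟩⟩

/-- `6 t'`, where `t'` is the coefficient `tT'`. -/
def numT' : Num := ⟨⟨0, 3, 3⟩, ⟨7, 0, 0⟩, ⟨1, 0, 0⟩, ⟨0, 2, 2⟩⟩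

/-- `6 s`, where `s` is the coefficient `sT`. -/
def numS : Num := ⟨⟨9, 0, 0⟩, ⟨7, 0, 14⟩, ⟨0, 3, 3⟩, ⟨2, 4, 0⟩⟩

/-- `6` times the complex conjugate of `sT`. -/
def numSbar : Num := ⟨⟨9, 0, 0⟩, ⟨7, 14, 0⟩, ⟨0, 3, 3⟩, ⟨2, 0, 4⟩⟩

/-- `2 Ψ`. -/
def numPsi : Num := ⟨⟨1, 0, 0⟩, ⟨0, 1, 1⟩, ⟨0, 1, 1⟩, ⟨0, 0, 0⟩⟩

/-- The combination whose orbit is `seedT` without the terms with the coefficients `s` and its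
conjugate, up to the factor `18 λ(b) λ(c)`.  The factors `θ²` come from `3 / R = θ² R`. -/
def comboSeedT : Combo Hex :=
  Combo.smul (.nat 3 * numT) (comboB 1) ++ Combo.smul (.nat 3 * numT') (comboB 2) ++
  Combo.smul (-((numT + numT') * .thetaSq)) comboD ++
  Combo.smul (-((numT + numT' + numS) * .thetaSq)) (comboE 1) ++
  Combo.smul ((.nat 2 * (numT + numT') + numS) * .thetaSq) (comboE 2)

/-- The terms of `seedT` with the coefficients `s` and its conjugate, up to the factor
`18 λ(b) λ(c)`.  The rotation acts on these loops as the inverse of the symmetry of `H`, so their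
orbit is the image of their sum under `1 + ρ + ρ²`. -/
def comboS : Combo Hex :=
  [(.nat 3 * numS, ⟨c, b 0, c, b 1, c, b 2⟩), (.nat 3 * numSbar, ⟨c, b 0, c, b 2, c, b 1⟩)]

/-- The combination whose orbit is `T`, up to the factor `18 λ(b) λ(c)`. -/
def comboT : Combo Hex :=
  comboSeedT ++ comboSeedT.map Hex.rot ++ (comboSeedT.map Hex.rot).map Hex.rot ++ comboS

/-- The combination whose orbit is `seedQ`, up to a nonzero scalar. -/
def comboSeedQ : Combo Hex :=
  Combo.smul (.nat 6) (comboB 1) ++ Combo.smul (.nat 3 * numPsi) (comboB 2) ++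
  Combo.smul (-(.om * .om * (.nat 2 + numPsi) * .thetaSq)) comboD ++
  Combo.smul (-((.nat 2 + .om * numPsi) * .thetaSq)) (comboE 1) ++
  Combo.smul (-((numPsi + .om * .nat 2) * .thetaSq)) (comboE 2)

/-- The combination whose orbit is `Q`, up to a nonzero scalar. -/
def comboQ : Combo Hex :=
  comboSeedQ ++ Combo.smul (.om * .om) (comboSeedQ.map Hex.rot) ++
    Combo.smul .om ((comboSeedQ.map Hex.rot).map Hex.rot)

/-! ### Formal combinations of words -/

/-- A sequence of vertices of `H`, to be read as a path. -/
abbrev Word : Type := List Vtx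

/-- `3 λ(x) / λ(a)`, where `a` is the vertex `b 0` or `c` of the same parity as `x`. -/
def rel : Vtx → Num
  | z _ => ⟨⟨0, 3, 3⟩, ⟨0, 0, 0⟩, ⟨1, 0, 0⟩, ⟨0, 0, 0⟩⟩
  | b _ => .nat 3
  | c => .nat 3
  | d => ⟨⟨0, 9, 9⟩, ⟨0, 0, 0⟩, ⟨3, 0, 0⟩, ⟨0, 0, 0⟩⟩

/-- `3 λ(a) / λ(x)`, where `a` is the vertex `b 0` or `c` of the same parity as `x`. -/
def relInv : Vtx → Num
  | z _ => .nat 3 * .thetaSq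
  | b _ => .nat 3
  | c => .nat 3
  | d => .thetaSq

/-- The neighbours of a vertex of `H`. -/
def nbrs : Vtx → List Vtx
  | z i => [b i]
  | b i => [z i, c]
  | c => [b 0, b 1, b 2, d]
  | d => [c]

/-- The words of `joined F G`: the labels of the nine regions above the Jones-Wenzl idempotent, in
the states that give two loops to the boxes.  The loops have to agree along the common regions. -/
def comboJoined (F G : Combo Hex) : Combo Word := F.flatMap fun s =>
  (rel s.2.v₂ * relInv s.2.v₁ * s.1).force fun k => G.flatMap fun t =>
    if s.2.v₁ = t.2.v₁ ∧ s.2.v₂ = t.2.v₆ ∧ s.2.v₃ = t.2.v₅ then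
      [(k * t.1).force fun k => (k, [s.2.v₁, s.2.v₆, s.2.v₅, s.2.v₄, s.2.v₃, t.2.v₄, t.2.v₃,
        t.2.v₂, t.2.v₁])]
    else []

/-- The words of `capped F`; the outer region is a neighbour `a` of the region below the cap. -/
def comboCapped (F : Combo Hex) : Combo Word := F.flatMap fun s => (nbrs s.2.v₂).map fun a =>
  (relInv a * relInv s.2.v₂ * s.1).force fun k =>
    (k, [a, s.2.v₂, s.2.v₁, s.2.v₆, s.2.v₅, s.2.v₄, s.2.v₃, s.2.v₂, a])

/-- The words of `joinedShaded F G`, as for `comboJoined`. -/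
def comboJoinedShaded (F G : Combo Hex) : Combo Word := F.flatMap fun s =>
  (rel s.2.v₃ * relInv s.2.v₂ * s.1).force fun k => G.flatMap fun t =>
    if s.2.v₂ = t.2.v₆ ∧ s.2.v₃ = t.2.v₅ ∧ s.2.v₄ = t.2.v₄ then
      [(k * t.1).force fun k => (k, [s.2.v₂, s.2.v₁, s.2.v₆, s.2.v₅, s.2.v₄, t.2.v₃, t.2.v₂,
        t.2.v₁, t.2.v₆])]
    else []

/-- The words of `cappedShaded F`, as for `comboCapped`. -/
def comboCappedShaded (F : Combo Hex) : Combo Word := F.flatMap fun s => (nbrs s.2.v₁).map fun a =>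
  (relInv a * relInv s.2.v₁ * s.1).force fun k =>
    (k, [a, s.2.v₁, s.2.v₆, s.2.v₅, s.2.v₄, s.2.v₃, s.2.v₂, s.2.v₁, a])

/-! ### Reduction of words modulo caps -/

/-- The combination of words obtained from the word `a :: w` by eliminating the vertices `z i` and
`d` from its interior, using `b z b = -b c b` and `c d c = -∑ i, c (b i) c`. -/
def expand (k : Num) (a : Vtx) : Word → Combo Word
  | [] => [(k, [a])]
  | [x] => [(k, [a, x])]
  | x :: y :: w =>
    match x with
    | z i =>
      if a = b i ∧ y = b i then (expand (-k) c (y :: w)).map (a :: ·)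
      else (expand k x (y :: w)).map (a :: ·)
    | d =>
      if a = c ∧ y = c then
        (expand (-k) (b 0) (y :: w) ++ expand (-k) (b 1) (y :: w) ++
          expand (-k) (b 2) (y :: w)).map (a :: ·)
      else (expand k x (y :: w)).map (a :: ·)
    | _ => (expand k x (y :: w)).map (a :: ·)

/-- The combination of words obtained from a word by `expand`, which leaves the two ends as they
are. -/
def expandWord (k : Num) : Word → Combo Word
  | [] => [(k, [])]
  | a :: w => expand k a w

/-- The word starts with `z b c b`, `b c b z` or `b c b c b`, with vertices on the same leg. -/
def startsDead : Word → Bool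
  | z i :: b j :: c :: b k :: _ => i == j && i == k
  | b i :: c :: b j :: z k :: _ => i == j && i == k
  | b i :: c :: b j :: c :: b k :: _ => i == j && i == k
  | _ => false

/-- Some final segment of the word starts with `z b c b`, `b c b z` or `b c b c b`. -/
def dead : Word → Bool
  | [] => false
  | x :: w => startsDead (x :: w) || dead w

/-- The leg of the first vertex of a word that lies on one. -/
def firstLeg : Word → Fin 3
  | [] => 0
  | z i :: _ => i
  | b i :: _ => i
  | _ :: w => firstLeg w

/-- The representative of a word modulo the cyclic symmetry of `H`. -/
def canon (w : Word) : Word :=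
  match firstLeg w with
  | 0 => w
  | 1 => (w.map turn).map turn
  | 2 => w.map turn

/-- A code for the vertices of `H`. -/
def vtxCode : Vtx → ℕ
  | z i => i
  | b i => 3 + i
  | c => 6
  | d => 7

/-- A code for words. -/
def code : Word → ℕ
  | [] => 1
  | x :: w => vtxCode x + 8 * code w

/-- The reduction of a combination of words modulo caps and the cyclic symmetry. -/
def reduce (l : Combo Word) : Combo ℕ :=
  ((l.flatMap fun t => expandWord t.1 t.2).filter fun t => !dead t.2).map fun t =>
    forceNat (fun n => (t.1, n)) (code (canon t.2))

/-- The coefficients in a combination of at most `n` different objects are all `0`. -/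
def vanishes : ℕ → Combo ℕ → Bool
  | _, [] => true
  | 0, _ => false
  | n + 1, (k, w) :: l =>
    ((l.filter fun t => Nat.beq t.2 w).foldl (fun s t => s + t.1) k).isZero &&
      vanishes n (l.filter fun t => !Nat.beq t.2 w)

/-- Words that contain `d c d`, each standing for its orbit under the cyclic symmetry of `H`.  They
are `0` modulo caps, but not their expansions: these express the relation
`∑ i, ∑ j, c (b i) c (b j) c = 0` and its multiples. -/
def backtracks (l₀ l₁ l₂ m₀ m₁ r₀ r₁ e : Num) : Combo Word :=
  [(l₀, [c, d, c, d, c, b 0, c, b 0, c]),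
   (l₁, [c, d, c, d, c, b 0, c, b 1, c]),
   (l₂, [c, d, c, d, c, b 0, c, b 2, c]),
   (m₀, [c, b 0, c, d, c, d, c, b 0, c]),
   (m₁, [c, b 0, c, d, c, d, c, b 1, c]),
   (r₀, [c, b 0, c, b 0, c, d, c, d, c]),
   (r₁, [c, b 0, c, b 1, c, d, c, d, c]),
   (e, [z 0, b 0, c, d, c, d, c, b 0, z 0])]

/-- The analogue of `backtracks` for paths that start at an odd vertex. -/
def backtracksShaded (l₀ l₁ l₂ r₀ r₁ m₀ m₁ m₂ n₀ n₁ : Num) : Combo Word :=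
  [(l₀, [d, c, d, c, b 0, c, b 0, c, d]),
   (l₁, [d, c, d, c, b 0, c, b 1, c, d]),
   (l₂, [d, c, d, c, b 0, c, b 2, c, d]),
   (r₀, [d, c, b 0, c, b 0, c, d, c, d]),
   (r₁, [d, c, b 0, c, b 1, c, d, c, d]),
   (m₀, [b 0, c, d, c, d, c, b 0, c, b 0]),
   (m₁, [b 0, c, d, c, d, c, b 1, c, b 0]),
   (m₂, [b 0, c, d, c, d, c, b 2, c, b 0]),
   (n₀, [b 0, c, b 0, c, d, c, d, c, b 0]),
   (n₁, [b 0, c, b 1, c, d, c, d, c, b 0])]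

/-! ### Soundness of the reduction -/

section

variable {M : Type*} [AddCommGroup M]

/-- The relations satisfied by a function of words that comes from a linear map on words that
annihilates all caps, with words weighted so that the relations have integral coefficients. -/
structure IsCapFree (N : Word → M) : Prop where
  at_z : ∀ pre i post, N (pre ++ z i :: b i :: z i :: post) = 0
  at_d : ∀ pre post, N (pre ++ d :: c :: d :: post) = 0
  at_b : ∀ pre i post,
    N (pre ++ b i :: z i :: b i :: post) = -N (pre ++ b i :: c :: b i :: post)
  at_c : ∀ pre post, N (pre ++ c :: d :: c :: post) =
    -(N (pre ++ c :: b 0 :: c :: post) + N (pre ++ c :: b 1 :: c :: post) +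
      N (pre ++ c :: b 2 :: c :: post))

namespace IsCapFree

variable {N : Word → M}

theorem eq_zero_of_startsDead (hN : IsCapFree N) (pre : Word) {w : Word}
    (h : startsDead w = true) : N (pre ++ w) = 0 := by
  unfold startsDead at h
  split at h
  · rename_i i j k l
    obtain ⟨rfl, rfl⟩ : i = j ∧ i = k := by simpa using h
    have h1 := hN.at_b (pre ++ [z i]) i l
    have h2 := hN.at_z pre i (b i :: l)
    simp only [List.append_assoc, List.cons_append, List.nil_append] at h1
    rw [h2] at h1
    simpa using h1.symm
  · rename_i i j k l
    obtain ⟨rfl, rfl⟩ : i = j ∧ i = k := by simpa using h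
    have h1 := hN.at_b pre i (z i :: l)
    have h2 := hN.at_z (pre ++ [b i]) i l
    simp only [List.append_assoc, List.cons_append, List.nil_append] at h2
    rw [h2] at h1
    simpa using h1.symm
  · rename_i i j k l
    obtain ⟨rfl, rfl⟩ : i = j ∧ i = k := by simpa using h
    have h1 := hN.at_b pre i (c :: b i :: l)
    have h2 := hN.at_b (pre ++ [b i, z i]) i l
    have h3 := hN.at_z (pre ++ [b i]) i (b i :: l)
    simp only [List.append_assoc, List.cons_append, List.nil_append] at h2 h3
    rw [h3] at h2
    rw [← neg_eq_zero, ← h1, ← neg_eq_zero, ← h2]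
  · simp at h

theorem eq_zero_of_dead (hN : IsCapFree N) (w pre : Word) (h : dead w = true) :
    N (pre ++ w) = 0 := by
  induction w generalizing pre with
  | nil => simp [dead] at h
  | cons x w ih =>
    rw [dead, Bool.or_eq_true] at h
    rcases h with h | h
    · exact hN.eq_zero_of_startsDead pre h
    · simpa using ih (pre ++ [x]) h

end IsCapFree

theorem vtxCode_lt (x : Vtx) : vtxCode x < 8 := by
  cases x <;> simp [vtxCode] <;> omega

theorem vtxCode_injective : Function.Injective vtxCode := by
  intro x y h
  cases x <;> cases y <;> simp [vtxCode] at h ⊢ <;> omega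

theorem code_pos (w : Word) : 0 < code w := by
  induction w with
  | nil => exact Nat.one_pos
  | cons x w ih => rw [code]; omega

theorem code_injective : Function.Injective code := by
  intro w
  induction w with
  | nil =>
    intro w' h
    cases w' with
    | nil => rfl
    | cons x w' =>
      have := code_pos w'
      simp only [code] at h
      omega
  | cons x w ih =>
    intro w' h
    cases w' with
    | nil =>
      have := code_pos w
      simp only [code] at h
      omega
    | cons y w' =>
      simp only [code] at h
      have hx := vtxCode_lt x
      have hy := vtxCode_lt y
      rw [vtxCode_injective (show vtxCode x = vtxCode y by omega),
        ih (show code w = code w' by omega)]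

/-- The sum of the values of `N` on a word and its images under the cyclic symmetry of `H`. -/
def symm (N : Word → M) (w : Word) : M :=
  N w + N (w.map turn) + N ((w.map turn).map turn)

theorem turn_turn_turn (x : Vtx) : turn (turn (turn x)) = x := by
  cases x <;> simp [turn, add_assoc]

theorem symm_map_turn (N : Word → M) (w : Word) : symm N (w.map turn) = symm N w := by
  have h : ((w.map turn).map turn).map turn = w := by
    simp [Function.comp_def, turn_turn_turn]
  rw [symm, symm, h]
  abel

theorem symm_canon (N : Word → M) (w : Word) : symm N (canon w) = symm N w := by
  unfold canon
  split
  · rfl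
  · rw [symm_map_turn, symm_map_turn]
  · rw [symm_map_turn]

theorem IsCapFree.comp_turn {N : Word → M} (hN : IsCapFree N) :
    IsCapFree fun w => N (w.map turn) where
  at_z pre i post := by simpa [turn] using hN.at_z (pre.map turn) (i + 1) (post.map turn)
  at_d pre post := by simpa [turn] using hN.at_d (pre.map turn) (post.map turn)
  at_b pre i post := by simpa [turn] using hN.at_b (pre.map turn) (i + 1) (post.map turn)
  at_c pre post := by
    have h := hN.at_c (pre.map turn) (post.map turn)
    have e : (2 : Fin 3) + 1 = 0 := rfl
    have e' : (1 : Fin 3) + 1 = 2 := rfl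
    simp only [List.map_append, List.map_cons, turn, e, e', zero_add, h]
    abel

theorem IsCapFree.symm {N : Word → M} (hN : IsCapFree N) : IsCapFree (symm N) where
  at_z pre i post := by
    have h1 := hN.comp_turn.at_z pre i post
    have h2 := hN.comp_turn.comp_turn.at_z pre i post
    beta_reduce at h1 h2
    rw [Planar2221.symm, hN.at_z, h1, h2, add_zero, add_zero]
  at_d pre post := by
    have h1 := hN.comp_turn.at_d pre post
    have h2 := hN.comp_turn.comp_turn.at_d pre post
    beta_reduce at h1 h2
    rw [Planar2221.symm, hN.at_d, h1, h2, add_zero, add_zero]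
  at_b pre i post := by
    have h1 := hN.comp_turn.at_b pre i post
    have h2 := hN.comp_turn.comp_turn.at_b pre i post
    beta_reduce at h1 h2
    rw [Planar2221.symm, hN.at_b, h1, h2, Planar2221.symm]
    abel
  at_c pre post := by
    have h1 := hN.comp_turn.at_c pre post
    have h2 := hN.comp_turn.comp_turn.at_c pre post
    beta_reduce at h1 h2
    rw [Planar2221.symm, hN.at_c, h1, h2, Planar2221.symm, Planar2221.symm, Planar2221.symm]
    abel

variable [Module ℂ M]

/-- The value of a formal combination under the linear extension of `N`. -/
noncomputable def eval {α : Type} (N : α → M) (l : Combo α) : M :=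
  (List.map (fun t => t.1.ev • N t.2) l).sum

theorem eval_nil {α : Type} (N : α → M) : eval N [] = 0 := rfl

theorem eval_cons {α : Type} (N : α → M) (t : Num × α) (l : Combo α) :
    eval N (t :: l) = t.1.ev • N t.2 + eval N l := by
  simp [eval]

theorem eval_append {α : Type} (N : α → M) (l l' : Combo α) :
    eval N (l ++ l') = eval N l + eval N l' := by
  simp [eval]

theorem eval_smul {α : Type} (N : α → M) (k : Num) (l : Combo α) :
    eval N (Combo.smul k l) = k.ev • eval N l := by
  simp only [eval, Combo.smul, Num.force_eq, List.map_map, List.smul_sum]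
  congr 1
  refine List.map_congr_left fun t _ => ?_
  simp [Num.ev_mul, mul_smul]

theorem eval_map {α : Type} (N : α → M) (f : α → α) (l : Combo α) :
    eval N (l.map f) = eval (fun x => N (f x)) l := by
  simp [eval, Combo.map, Function.comp_def]

theorem eval_flatMap {α β : Type} (N : β → M) (N' : α → M) (f : Num × α → Combo β)
    (h : ∀ t, eval N (f t) = t.1.ev • N' t.2) (l : Combo α) :
    eval N (l.flatMap f) = eval N' l := by
  induction l with
  | nil => rfl
  | cons t l ih => rw [List.flatMap_cons, eval_append, eval_cons, ih, h]

theorem eval_eq_filter_add {α : Type} (N : α → M) (p : Num × α → Bool) (l : Combo α) :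
    eval N l = eval N (l.filter p) + eval N (l.filter fun t => !p t) := by
  induction l with
  | nil => simp [eval]
  | cons t l ih =>
    cases h : p t <;> simp [h, eval_cons, ih] <;> abel

theorem eval_eq_zero_of_forall {α : Type} {N : α → M} {l : Combo α} (h : ∀ t ∈ l, N t.2 = 0) :
    eval N l = 0 := by
  refine List.sum_eq_zero fun x hx => ?_
  obtain ⟨t, ht, rfl⟩ := List.mem_map.1 hx
  rw [h t ht, smul_zero]

theorem smul_foldl_ev {α : Type} (x : M) (l : Combo α) (k : Num) :
    (l.foldl (fun s t => s + t.1) k).ev • x = k.ev • x + eval (fun _ => x) l := by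
  induction l generalizing k with
  | nil => simp [eval]
  | cons t l ih => rw [List.foldl_cons, ih, eval_cons, Num.ev_add, add_smul, add_assoc]

theorem eval_eq_zero_of_vanishes (N : ℕ → M) {n : ℕ} {l : Combo ℕ} (h : vanishes n l = true) :
    eval N l = 0 := by
  induction n generalizing l with
  | zero =>
    cases l with
    | nil => rfl
    | cons t l => simp [vanishes] at h
  | succ n ih =>
    cases l with
    | nil => rfl
    | cons t l =>
      obtain ⟨k, w⟩ := t
      rw [vanishes, Bool.and_eq_true] at h
      have h1 := Num.ev_of_isZero h.1
      have h2 := smul_foldl_ev (N w) (l.filter fun t => Nat.beq t.2 w) k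
      have h3 : eval (fun _ => N w) (l.filter fun t => Nat.beq t.2 w) =
          eval N (l.filter fun t => Nat.beq t.2 w) := by
        refine congrArg List.sum (List.map_congr_left fun t ht => ?_)
        rw [Nat.eq_of_beq_eq_true (List.mem_filter.1 ht).2]
      rw [h1, zero_smul, h3] at h2
      rw [eval_cons, eval_eq_filter_add N (fun t => Nat.beq t.2 w), ih h.2, add_zero, ← h2]

namespace IsCapFree

variable {N : Word → M}

theorem eval_expand (hN : IsCapFree N) : ∀ (w : Word) (k : Num) (a : Vtx) (pre : Word),
    eval (fun u => N (pre ++ u)) (expand k a w) = k.ev • N (pre ++ a :: w)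
  | [], k, a, pre => by simp [expand, eval]
  | [x], k, a, pre => by simp [expand, eval]
  | x :: y :: w, k, a, pre => by
    have ih : ∀ k x, eval (fun u => N (pre ++ a :: u)) (expand k x (y :: w)) =
        k.ev • N (pre ++ a :: x :: y :: w) := fun k x => by
      simpa using eval_expand hN (y :: w) k x (pre ++ [a])
    cases x with
    | z i =>
      by_cases h : a = b i ∧ y = b i
      · obtain ⟨rfl, rfl⟩ := h
        simp [expand, eval_map, ih, hN.at_b, Num.ev_neg]
      · simp [expand, h, eval_map, ih]
    | d =>
      by_cases h : a = c ∧ y = c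
      · obtain ⟨rfl, rfl⟩ := h
        simp only [expand, and_self, if_true, eval_map, eval_append, ih, hN.at_c, Num.ev_neg]
        module
      · simp [expand, h, eval_map, ih]
    | b i => simp [expand, eval_map, ih]
    | c => simp [expand, eval_map, ih]

theorem eval_expandWord (hN : IsCapFree N) (k : Num) (w : Word) :
    eval N (expandWord k w) = k.ev • N w := by
  cases w with
  | nil => simp [expandWord, eval]
  | cons a w => exact hN.eval_expand w k a []

end IsCapFree

/-- A combination whose reduction has vanishing coefficients is `0` modulo caps, after
symmetrisation. -/
theorem IsCapFree.eval_symm_eq_zero {N : Word → M} (hN : IsCapFree N) {n : ℕ} {l : Combo Word}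
    (h : vanishes n (reduce l) = true) : eval (Planar2221.symm N) l = 0 := by
  set S := Planar2221.symm N with hS
  have hS' : IsCapFree S := hN.symm
  have h1 := eval_eq_zero_of_vanishes (Function.extend code S 0) h
  have h2 : eval (Function.extend code S 0) (reduce l) =
      eval S ((l.flatMap fun t => expandWord t.1 t.2).filter fun t => !dead t.2) := by
    simp only [eval, reduce, forceNat_eq, List.map_map, Function.comp_def,
      code_injective.extend_apply]
    simp only [hS, symm_canon]
  have h3 := eval_eq_filter_add S (fun t => dead t.2) (l.flatMap fun t => expandWord t.1 t.2)
  rw [eval_eq_zero_of_forall (l := List.filter (fun t => dead t.2) _) fun t ht =>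
    hS'.eq_zero_of_dead t.2 [] (List.mem_filter.1 ht).2, zero_add, ← h2, h1,
    eval_flatMap S S _ fun t => hS'.eval_expandWord t.1 t.2] at h3
  exact h3

theorem IsCapFree.eval_backtracks {N : Word → M} (hN : IsCapFree N)
    (l₀ l₁ l₂ m₀ m₁ r₀ r₁ e : Num) : eval N (backtracks l₀ l₁ l₂ m₀ m₁ r₀ r₁ e) = 0 := by
  refine eval_eq_zero_of_forall fun t ht => ?_
  simp only [backtracks, List.mem_cons, List.not_mem_nil, or_false] at ht
  rcases ht with rfl | rfl | rfl | rfl | rfl | rfl | rfl | rfl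
  any_goals exact hN.at_d [_] _
  any_goals exact hN.at_d [_, _, _] _
  any_goals exact hN.at_d [_, _, _, _, _] _

theorem IsCapFree.eval_backtracksShaded {N : Word → M} (hN : IsCapFree N)
    (l₀ l₁ l₂ r₀ r₁ m₀ m₁ m₂ n₀ n₁ : Num) :
    eval N (backtracksShaded l₀ l₁ l₂ r₀ r₁ m₀ m₁ m₂ n₀ n₁) = 0 := by
  refine eval_eq_zero_of_forall fun t ht => ?_
  simp only [backtracksShaded, List.mem_cons, List.not_mem_nil, or_false] at ht
  rcases ht with rfl | rfl | rfl | rfl | rfl | rfl | rfl | rfl | rfl | rfl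
  any_goals exact hN.at_d [] _
  any_goals exact hN.at_d [_, _] _
  any_goals exact hN.at_d [_, _, _, _] _
  any_goals exact hN.at_d [_, _, _, _, _, _] _

end

/-! ### Weighted words modulo caps -/

/-- The square root of the weight of a vertex. -/
noncomputable def rt (x : Vtx) : ℂ := ((√(lam x) : ℝ) : ℂ)

theorem rt_ne_zero (x : Vtx) : rt x ≠ 0 :=
  Complex.ofReal_ne_zero.2 (Real.sqrt_pos.2 (lam_pos x)).ne'

theorem rt_sq (x : Vtx) : rt x ^ 2 = lam x := by
  rw [rt, ← Complex.ofReal_pow, Real.sq_sqrt (lam_pos x).le]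

theorem sqrt_ratio (x a : Vtx) : ((√(lam x / lam a) : ℝ) : ℂ) = rt x / rt a := by
  rw [Real.sqrt_div (lam_pos x).le, Complex.ofReal_div, rt, rt]

/-- The sequence of vertices of a word; the value `c` beyond its end is irrelevant. -/
def seq (w : Word) : ℕ → Vtx := fun j => w.getD j c

theorem seq_append_cons (pre : Word) (a : Vtx) (post : Word) :
    seq (pre ++ a :: post) pre.length = a := by
  simp [seq]

theorem seq_append_of_le (pre post : Word) {j : ℕ} (hj : pre.length ≤ j) :
    seq (pre ++ post) j = seq post (j - pre.length) := by
  rw [seq, seq, List.getD_append_right _ _ _ _ hj]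

theorem seq_append_of_lt (pre post : Word) {j : ℕ} (hj : j < pre.length) :
    seq (pre ++ post) j = seq pre j := by
  rw [seq, seq, List.getD_append _ _ _ _ hj]

theorem ins_seq (pre : Word) (a x : Vtx) (post : Word) :
    ins (seq (pre ++ a :: post)) pre.length x = seq (pre ++ a :: x :: a :: post) := by
  funext j
  rcases lt_or_ge j pre.length with hj | hj
  · rw [ins, if_pos hj.le, seq_append_of_lt _ _ hj, seq_append_of_lt _ _ hj]
  · obtain ⟨k, rfl⟩ := Nat.exists_eq_add_of_le hj
    rw [seq_append_of_le _ _ hj, Nat.add_sub_cancel_left]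
    match k with
    | 0 => simp [ins, seq]
    | 1 => simp [ins, seq]
    | k + 2 =>
      rw [ins, if_neg (by omega), if_neg (by omega), seq_append_of_le _ _ (by omega),
        show pre.length + (k + 2) - 2 - pre.length = k by omega]
      cases k <;> rfl

theorem del_seq (pre : Word) (a x : Vtx) (post : Word) :
    del (seq (pre ++ a :: x :: a :: post)) pre.length = seq (pre ++ a :: post) := by
  funext j
  rcases lt_or_ge j pre.length with hj | hj
  · rw [del, if_pos hj.le, seq_append_of_lt _ _ hj, seq_append_of_lt _ _ hj]
  · obtain ⟨k, rfl⟩ := Nat.exists_eq_add_of_le hj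
    rw [seq_append_of_le _ _ hj, Nat.add_sub_cancel_left]
    match k with
    | 0 => simp [del, seq]
    | k + 1 =>
      rw [del, if_neg (by omega), seq_append_of_le _ _ (by omega),
        show pre.length + (k + 1) + 2 - pre.length = k + 3 by omega]
      rfl

theorem seq_vecMul_cap {n : ℕ} (pre : Word) (a : Vtx) (post : Word) (hn : pre.length ≤ n) :
    vec n (seq (pre ++ a :: post)) ᵥ* cap n pre.length =
      ∑ x, (rt x / rt a) • vec (n + 2) (seq (pre ++ a :: x :: a :: post)) := by
  simp only [vec_vecMul_cap hn, seq_append_cons, ins_seq, sqrt_ratio]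

theorem seq_vecMul_cup {n : ℕ} (pre : Word) {a x : Vtx} (a' : Vtx) (post : Word)
    (hn : pre.length ≤ n) (h : H.Adj a x) :
    vec (n + 2) (seq (pre ++ a :: x :: a' :: post)) ᵥ* cup n pre.length =
      if a = a' then (rt x / rt a) • vec n (seq (pre ++ a :: post)) else 0 := by
  have e1 : seq (pre ++ a :: x :: a' :: post) (pre.length + 1) = x := by
    rw [seq_append_of_le _ _ (by omega), Nat.add_sub_cancel_left]; rfl
  have e2 : seq (pre ++ a :: x :: a' :: post) (pre.length + 2) = a' := by
    rw [seq_append_of_le _ _ (by omega), Nat.add_sub_cancel_left]; rfl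
  rw [vec_vecMul_cup hn (by rwa [seq_append_cons, e1]), seq_append_cons, e1, e2, sqrt_ratio]
  split_ifs with h'
  · subst h'
    rw [del_seq]
  · rfl

/-- The row of a word that starts with `a`, multiplied by the Jones-Wenzl idempotent and by the
square root of the weights of its vertices, the first one excepted; it is `0` for other words. -/
noncomputable def row (a : Vtx) (w : Word) : Path 8 → ℂ :=
  if w.length = 9 ∧ w.head? = some a then (w.tail.map rt).prod • (vec 8 (seq w) ᵥ* jw 8) else 0

theorem row_of_not_adj (a : Vtx) (pre : Word) {x y : Vtx} (post : Word) (h : ¬ H.Adj x y) :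
    row a (pre ++ x :: y :: post) = 0 := by
  rw [row]
  split_ifs with hw
  · rw [vec_of_not_isPath, zero_vecMul, smul_zero]
    intro hp
    have hl := hw.1
    simp only [List.length_append, List.length_cons] at hl
    have := hp pre.length (by omega)
    rw [seq_append_cons, seq_append_of_le _ _ (by omega), Nat.add_sub_cancel_left] at this
    exact h this
  · rfl

/-- The sum over all detours at a given place is the row of a cap, which the Jones-Wenzl idempotent
annihilates; the weights in `row` turn the local factors of the cap into a constant. -/
theorem sum_row (a : Vtx) (pre : Word) (a' : Vtx) (post : Word) :
    ∑ x, row a (pre ++ a' :: x :: a' :: post) = 0 := by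
  by_cases hl : pre.length + post.length = 6
  · have h := congrArg (· ᵥ* jw 8) (seq_vecMul_cap (n := 6) pre a' post (by omega))
    simp only [vecMul_vecMul, cap_mul_jw (show pre.length ≤ 6 by omega), vecMul_zero,
      sum_vecMul, smul_vecMul] at h
    have key : ∀ x, row a (pre ++ a' :: x :: a' :: post) =
        (if (pre ++ a' :: post).head? = some a then
          ((pre ++ a' :: post).tail.map rt).prod * rt a' ^ 2 else 0) •
        (rt x / rt a') • (vec 8 (seq (pre ++ a' :: x :: a' :: post)) ᵥ* jw 8) := by
      intro x
      have h1 : (pre ++ a' :: x :: a' :: post).length = 9 := by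
        simp only [List.length_append, List.length_cons]; omega
      have h2 : (pre ++ a' :: x :: a' :: post).head? = (pre ++ a' :: post).head? := by
        cases pre <;> rfl
      have h3 : ((pre ++ a' :: x :: a' :: post).tail.map rt).prod =
          ((pre ++ a' :: post).tail.map rt).prod * rt a' ^ 2 * (rt x / rt a') := by
        have := rt_ne_zero a'
        cases pre <;> simp <;> field_simp
      rw [row, h1, h2, h3]
      by_cases h4 : (pre ++ a' :: post).head? = some a
      · rw [if_pos ⟨rfl, h4⟩, if_pos h4, smul_smul]
      · rw [if_neg fun h => h4 h.2, if_neg h4, zero_smul]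
    simp only [key]
    rw [← Finset.smul_sum, ← h, smul_zero]
  · refine Finset.sum_eq_zero fun x _ => ?_
    rw [row, if_neg]
    intro h
    have := h.1
    simp only [List.length_append, List.length_cons] at this
    omega

theorem eq_of_adj_z {i : Fin 3} {x : Vtx} (h : H.Adj (z i) x) : x = b i := by
  revert h; revert x; revert i; decide

theorem eq_of_adj_d {x : Vtx} (h : H.Adj d x) : x = c := by
  revert h; revert x; decide

theorem eq_of_adj_b {i : Fin 3} {x : Vtx} (h : H.Adj (b i) x) : x = z i ∨ x = c := by
  revert h; revert x; revert i; decide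

theorem not_adj_c : ¬ H.Adj c c ∧ ∀ i, ¬ H.Adj c (z i) := by decide

/-- The case distinction over the vertices at which a detour can start. -/
theorem isCapFree_row (a : Vtx) : IsCapFree (row a) where
  at_z pre i post := by
    have h := sum_row a pre (z i) post
    rwa [Fintype.sum_eq_single (b i)] at h
    exact fun x hx => row_of_not_adj a pre _ fun h => hx (eq_of_adj_z h)
  at_d pre post := by
    have h := sum_row a pre d post
    rwa [Fintype.sum_eq_single c] at h
    exact fun x hx => row_of_not_adj a pre _ fun h => hx (eq_of_adj_d h)
  at_b pre i post := by
    have h := sum_row a pre (b i) post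
    rw [Fintype.sum_eq_add (z i) c (by simp)] at h
    · exact eq_neg_of_add_eq_zero_left h
    · intro x hx
      refine row_of_not_adj a pre _ fun h => ?_
      rcases eq_of_adj_b h with h | h
      exacts [hx.1 h, hx.2 h]
  at_c pre post := by
    have h := sum_row a pre c post
    rw [sum_vtx, row_of_not_adj a pre _ not_adj_c.1] at h
    simp only [row_of_not_adj a pre _ (not_adj_c.2 _), Finset.sum_const_zero, zero_add, add_zero,
      Fin.sum_univ_three] at h
    exact eq_neg_of_add_eq_zero_right h

/-! ### Boxes labelled by loops -/

/-- The vertices form a loop on `H` based at an even vertex. -/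
def Hex.IsLoop (v : Hex) : Prop :=
  isEven v.v₁ = true ∧ H.Adj v.v₁ v.v₂ ∧ H.Adj v.v₂ v.v₃ ∧ H.Adj v.v₃ v.v₄ ∧ H.Adj v.v₄ v.v₅ ∧
    H.Adj v.v₅ v.v₆ ∧ H.Adj v.v₆ v.v₁

instance : DecidablePred Hex.IsLoop := fun v => by
  unfold Hex.IsLoop
  infer_instance

/-- The basis element of `PABG(H)_{3,+}` given by a loop. -/
noncomputable def Hex.basis (v : Hex) : PABG 3 := loop v.v₁ v.v₂ v.v₃ v.v₄ v.v₅ v.v₆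

theorem Hex.basis_apply (v : Hex) (l : Loop 3) : v.basis l =
    if l.1.vtx 0 = v.v₁ ∧ l.1.vtx 1 = v.v₂ ∧ l.1.vtx 2 = v.v₃ ∧ l.1.vtx 3 = v.v₄ ∧
      l.1.vtx 4 = v.v₅ ∧ l.1.vtx 5 = v.v₆ then 1 else 0 := rfl

theorem coeff_basis {v : Hex} (hv : v.IsLoop) (w : ℕ → Vtx) :
    v.basis.coeff w = if w 0 = v.v₁ ∧ w 1 = v.v₂ ∧ w 2 = v.v₃ ∧ w 3 = v.v₄ ∧ w 4 = v.v₅ ∧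
      w 5 = v.v₆ ∧ w 6 = v.v₁ then 1 else 0 := by
  rw [PABG.coeff]
  split_ifs with h
  · obtain ⟨h0, h1, h2, h3, h4, h5, h6⟩ := h
    obtain ⟨e, a1, a2, a3, a4, a5, a6⟩ := hv
    have hw : IsPath (2 * 3) w := by
      intro j hj
      interval_cases j <;> simp only [Nat.reduceAdd, h0, h1, h2, h3, h4, h5, h6] <;> assumption
    have hofSeq : ∀ j ≤ 6, (Path.ofSeq w hw).vtx j = w j := fun j hj => Path.vtx_ofSeq hw hj
    obtain ⟨l₀, hl₀⟩ : ∃ l : Loop 3, ∀ j ≤ 6, l.1.vtx j = w j :=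
      ⟨⟨Path.ofSeq w hw, by
        rw [hofSeq 0 (by omega), hofSeq (2 * 3) le_rfl, h0, show w (2 * 3) = v.v₁ from h6],
        by rwa [hofSeq 0 (by omega), h0]⟩, hofSeq⟩
    refine (Finset.sum_eq_single l₀ ?_ ?_).trans ?_
    rotate_right
    · rw [if_pos hl₀, Hex.basis_apply, if_pos]
      simp only [hl₀ 0 (by omega), hl₀ 1 (by omega), hl₀ 2 (by omega), hl₀ 3 (by omega),
        hl₀ 4 (by omega), hl₀ 5 (by omega)]
      exact ⟨h0, h1, h2, h3, h4, h5⟩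
    · intro l _ hl
      rw [if_neg]
      intro h
      exact hl (Subtype.ext (Path.ext_vtx fun j hj => (h j hj).trans (hl₀ j hj).symm))
    · exact fun h => absurd (Finset.mem_univ _) h
  · refine Finset.sum_eq_zero fun l _ => ?_
    split_ifs with h'
    · rw [Hex.basis_apply, if_neg]
      simp only [h' 0 (by omega), h' 1 (by omega), h' 2 (by omega), h' 3 (by omega),
        h' 4 (by omega), h' 5 (by omega)]
      rintro ⟨h0, h1, h2, h3, h4, h5⟩
      refine h ⟨h0, h1, h2, h3, h4, h5, ?_⟩
      rw [← h0, ← h' 0 (by omega), l.2.1]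
      exact (h' 6 le_rfl).symm
    · rfl

theorem isPath_of_eq_outside {n i : ℕ} {w w' : ℕ → Vtx}
    (h : ∀ j, j ≤ i ∨ i + 3 ≤ j → w' j = w j) (h0 : H.Adj (w i) (w (i + 1)))
    (h1 : H.Adj (w (i + 1)) (w (i + 2))) (h2 : H.Adj (w (i + 2)) (w (i + 3)))
    (hw : IsPath n w') : IsPath n w := by
  intro j hj
  by_cases hj' : j = i ∨ j = i + 1 ∨ j = i + 2
  · rcases hj' with rfl | rfl | rfl <;> assumption
  · rw [← h j (by omega), ← h (j + 1) (by omega)]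
    exact hw j hj

theorem vec_vecMul_box {n i : ℕ} (hi : i + 3 ≤ n) {v : Hex} (hv : v.IsLoop) {w w' : ℕ → Vtx}
    (h : ∀ j, j ≤ i ∨ i + 3 ≤ j → w' j = w j) (h1 : w' (i + 1) = v.v₆) (h2 : w' (i + 2) = v.v₅) :
    vec n w ᵥ* box n i v.basis =
      if w i = v.v₁ ∧ w (i + 1) = v.v₂ ∧ w (i + 2) = v.v₃ ∧ w (i + 3) = v.v₄
        then vec n w' else 0 := by
  by_cases hw : IsPath n w
  · rw [vec_vecMul hw]
    funext p
    simp only [box, coeff_basis hv]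
    have e : ∀ j ≤ n, (Path.ofSeq w hw).vtx j = w j := fun j hj => Path.vtx_ofSeq hw hj
    have e3 := h (i + 3) (by omega)
    have e0 := h i (by omega)
    simp +decide only [if_true, if_false, add_zero,
      show i + 2 * 3 - 4 = i + 2 by omega,
      show i + 2 * 3 - 5 = i + 1 by omega, show i + 2 * 3 - 6 = i by omega,
      e i (by omega), e (i + 1) (by omega), e (i + 2) (by omega), e (i + 3) (by omega)]
    by_cases hc : w i = v.v₁ ∧ w (i + 1) = v.v₂ ∧ w (i + 2) = v.v₃ ∧ w (i + 3) = v.v₄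
    · rw [if_pos hc, vec]
      obtain ⟨c0, c1, c2, c3⟩ := hc
      simp only [c0, c1, c2, c3, true_and]
      by_cases hp : ∀ j ≤ n, p.vtx j = w' j
      · rw [if_pos hp, if_pos, if_pos]
        · rw [hp _ (by omega), hp _ (by omega), hp _ (by omega), h2, h1, e0, c0]
          exact ⟨rfl, rfl, rfl⟩
        · intro j hj hj'
          rw [e j hj, hp j hj, h j hj']
      · rw [if_neg hp]
        split_ifs with h3 h4
        · refine absurd (fun j hj => ?_) hp
          by_cases hj' : j ≤ i ∨ i + 3 ≤ j
          · rw [← h3 j hj hj', e j hj, h j hj']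
          · obtain rfl | rfl : j = i + 1 ∨ j = i + 2 := by omega
            · rw [h4.2.1, h1]
            · rw [h4.1, h2]
        · rfl
        · rfl
    · rw [if_neg hc]
      split_ifs with h3 h4
      · exact absurd ⟨h4.1, h4.2.1, h4.2.2.1, h4.2.2.2.1⟩ hc
      · rfl
      · rfl
  · rw [vec_of_not_isPath hw, zero_vecMul]
    split_ifs with hc
    · obtain ⟨_, a1, a2, a3, -⟩ := hv
      refine (vec_of_not_isPath fun hw' => hw (isPath_of_eq_outside h ?_ ?_ ?_ hw')).symm
      · rwa [hc.1, hc.2.1]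
      · rwa [hc.2.1, hc.2.2.1]
      · rwa [hc.2.2.1, hc.2.2.2]
    · rfl

/-- A box labelled by a loop replaces the upper half of the loop by the lower half. -/
theorem seq_vecMul_box {n : ℕ} (pre : Word) (a₁ a₂ a₃ a₄ : Vtx) (post : Word)
    (hn : pre.length + 3 ≤ n) {v : Hex} (hv : v.IsLoop) :
    vec n (seq (pre ++ a₁ :: a₂ :: a₃ :: a₄ :: post)) ᵥ* box n pre.length v.basis =
      if a₁ = v.v₁ ∧ a₂ = v.v₂ ∧ a₃ = v.v₃ ∧ a₄ = v.v₄
        then vec n (seq (pre ++ v.v₁ :: v.v₆ :: v.v₅ :: v.v₄ :: post)) else 0 := by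
  have e : ∀ (u : Word) k, seq (pre ++ u) (pre.length + k) = seq u k := fun u k => by
    rw [seq_append_of_le _ _ (by omega), Nat.add_sub_cancel_left]
  have e0 : ∀ (u : Word), seq (pre ++ u) pre.length = seq u 0 := fun u => e u 0
  rw [vec_vecMul_box hn hv (w' := seq (pre ++ a₁ :: v.v₆ :: v.v₅ :: a₄ :: post))]
  · simp only [e, e0]
    change (if a₁ = v.v₁ ∧ a₂ = v.v₂ ∧ a₃ = v.v₃ ∧ a₄ = v.v₄ then _ else _) = _
    refine if_ctx_congr Iff.rfl (fun h => ?_) fun _ => rfl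
    rw [h.1, h.2.2.2]
  · intro j hj
    rcases lt_or_ge j pre.length with hj' | hj'
    · rw [seq_append_of_lt _ _ hj', seq_append_of_lt _ _ hj']
    · obtain ⟨k, rfl⟩ := Nat.exists_eq_add_of_le hj'
      rw [e, e]
      obtain rfl | ⟨k, rfl⟩ : k = 0 ∨ ∃ m, k = m + 3 := by
        rcases hj with h | h
        · left; omega
        · right; exact ⟨k - 3, by omega⟩
      · rfl
      · rfl
  · rw [e]; rfl
  · rw [e]; rfl

/-- The basis element of a loop, weighted by the square roots of the weights of its vertices other
than the first and the fourth; this normalisation is preserved by the rotation. -/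
noncomputable def Hex.weighted (v : Hex) : PABG 3 :=
  (rt v.v₂ * rt v.v₃ * rt v.v₅ * rt v.v₆) • v.basis

theorem rho_weighted {v : Hex} (hv : v.IsLoop) : rho v.weighted = v.rot.weighted := by
  funext l
  have h6 : l.1.vtx 6 = l.1.vtx 0 := l.2.1.symm
  rw [rho]
  have hc : v.weighted.coeff (fun j => l.1.vtx ((j + 2) % 6)) =
      (rt v.v₂ * rt v.v₃ * rt v.v₅ * rt v.v₆) * v.basis.coeff fun j => l.1.vtx ((j + 2) % 6) := by
    simp only [PABG.coeff, Hex.weighted, Finset.mul_sum, mul_ite, mul_zero, Pi.smul_apply,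
      smul_eq_mul]
  rw [hc, coeff_basis hv]
  simp only [Hex.weighted, Pi.smul_apply, Hex.basis_apply, smul_eq_mul, Nat.reduceAdd,
    Nat.reduceMod, Hex.rot]
  by_cases h : l.1.vtx 0 = v.v₅ ∧ l.1.vtx 1 = v.v₆ ∧ l.1.vtx 2 = v.v₁ ∧ l.1.vtx 3 = v.v₂ ∧
      l.1.vtx 4 = v.v₃ ∧ l.1.vtx 5 = v.v₄
  · obtain ⟨h0, h1, h2, h3, h4, h5⟩ := h
    rw [if_pos ⟨h2, h3, h4, h5, h0, h1, h2⟩, if_pos ⟨h0, h1, h2, h3, h4, h5⟩]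
    have hs : ((√(lam (l.1.vtx 2) * lam (l.1.vtx 5) / (lam (l.1.vtx 0) * lam (l.1.vtx 3))) : ℝ) : ℂ)
        = rt v.v₁ * rt v.v₄ / (rt v.v₅ * rt v.v₂) := by
      rw [h0, h2, h3, h5, Real.sqrt_div (mul_nonneg (lam_pos _).le (lam_pos _).le),
        Real.sqrt_mul (lam_pos _).le, Real.sqrt_mul (lam_pos _).le]
      push_cast
      rfl
    rw [hs]
    have := rt_ne_zero v.v₅
    have := rt_ne_zero v.v₂
    field_simp
  · rw [if_neg h, if_neg fun ⟨h2, h3, h4, h5, h0, h1, _⟩ => h ⟨h0, h1, h2, h3, h4, h5⟩,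
      mul_zero, mul_zero, mul_zero]

/-! ### The diagrams of weighted loops -/

theorem cap_zero_row (a : Path 0) : cap 0 0 a =
    ∑ x, (rt x / rt (a.vtx 0)) • vec 2 (seq [a.vtx 0, x, a.vtx 0]) := by
  refine Eq.trans ?_ (seq_vecMul_cap (n := 0) [] (a.vtx 0) [] le_rfl)
  rw [← vec_vtx_vecMul a (cap 0 0)]
  congr 1
  refine vec_congr fun j hj => ?_
  rw [Nat.le_zero.1 hj]
  rfl

theorem PABG.coeff_smul {k : ℕ} (r : ℂ) (X : PABG k) (w : ℕ → Vtx) :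
    (r • X).coeff w = r * X.coeff w := by
  simp only [PABG.coeff, Pi.smul_apply, smul_eq_mul, mul_ite, mul_zero, Finset.mul_sum]

theorem PABG.coeff_add {k : ℕ} (X Y : PABG k) (w : ℕ → Vtx) :
    (X + Y).coeff w = X.coeff w + Y.coeff w := by
  refine Eq.trans ?_ Finset.sum_add_distrib
  refine Finset.sum_congr rfl fun l _ => ?_
  split_ifs <;> simp

theorem box_smul {k : ℕ} (n i : ℕ) (r : ℂ) (X : PABG k) : box n i (r • X) = r • box n i X := by
  funext s p
  simp only [box, PABG.coeff_smul, Matrix.smul_apply, smul_eq_mul, mul_ite, mul_zero]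

theorem box_add {k : ℕ} (n i : ℕ) (X Y : PABG k) : box n i (X + Y) = box n i X + box n i Y := by
  funext s p
  simp only [box, PABG.coeff_add, Matrix.add_apply]
  split_ifs
  · rfl
  · rw [add_zero]

theorem seq_vecMul_box_weighted {n : ℕ} (pre : Word) (a₁ a₂ a₃ a₄ : Vtx) (post : Word)
    (hn : pre.length + 3 ≤ n) {v : Hex} (hv : v.IsLoop) :
    vec n (seq (pre ++ a₁ :: a₂ :: a₃ :: a₄ :: post)) ᵥ* box n pre.length v.weighted =
      (if a₁ = v.v₁ ∧ a₂ = v.v₂ ∧ a₃ = v.v₃ ∧ a₄ = v.v₄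
        then rt v.v₂ * rt v.v₃ * rt v.v₅ * rt v.v₆ else 0) •
          vec n (seq (pre ++ v.v₁ :: v.v₆ :: v.v₅ :: v.v₄ :: post)) := by
  rw [Hex.weighted, box_smul, vecMul_smul, seq_vecMul_box pre _ _ _ _ post hn hv, ite_smul,
    smul_ite, zero_smul, smul_zero]

theorem row_cons (a x : Vtx) {w : Word} (h : w.length = 8) : row a (x :: w) =
    if a = x then (w.map rt).prod • (vec 8 (seq (x :: w)) ᵥ* jw 8) else 0 := by
  simp [row, h, eq_comm]

theorem ofReal_lam_div (x y : Vtx) : ((lam x / lam y : ℝ) : ℂ) = rt x ^ 2 / rt y ^ 2 := by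
  rw [Complex.ofReal_div, rt_sq, rt_sq]

/-- The two loops determine the labels of all regions of `joined`, so at most one state remains. -/
theorem joined_weighted {v w : Hex} (hv : v.IsLoop) (hw : w.IsLoop) (a : Path 0) :
    joined v.weighted w.weighted a =
      if v.v₁ = w.v₁ ∧ v.v₂ = w.v₆ ∧ v.v₃ = w.v₅ then
        ((lam v.v₂ / lam v.v₁ : ℝ) : ℂ) •
          row (a.vtx 0) [v.v₁, v.v₆, v.v₅, v.v₄, v.v₃, w.v₄, w.v₃, w.v₂, w.v₁]
      else 0 := by
  have h1 (x : Vtx) := seq_vecMul_cap (n := 2) [a.vtx 0] x [a.vtx 0] (by simp)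
  have h2 (x y : Vtx) := seq_vecMul_cap (n := 4) [a.vtx 0, x] y [x, a.vtx 0] (by simp)
  have h3 (x y u : Vtx) := seq_vecMul_box_weighted (n := 6) [] (a.vtx 0) x y u
    [y, x, a.vtx 0] (by simp) hw
  have h4 (x y : Vtx) := seq_vecMul_cap (n := 6) [w.v₁, w.v₆] w.v₅ [w.v₄, y, x, a.vtx 0] (by simp)
  have h5 (x y t : Vtx) := seq_vecMul_box_weighted (n := 8) [] w.v₁ w.v₆ w.v₅ t
    [w.v₅, w.v₄, y, x, a.vtx 0] (by simp) hv
  simp only [List.length_cons, List.length_nil, List.cons_append, List.nil_append, Nat.reduceAdd]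
    at h1 h2 h3 h4 h5
  rw [joined]
  simp only [mul_apply_eq_vecMul, cap_zero_row, sum_vecMul, smul_vecMul, h1, h2, h3, h4, h5]
  simp only [smul_smul, ite_and, ite_mul, zero_mul, ite_smul, zero_smul, smul_ite, smul_zero,
    Finset.sum_ite_eq', Finset.mem_univ, if_true, Finset.sum_ite_irrel, Finset.sum_const_zero]
  by_cases e1 : v.v₁ = w.v₁
  · by_cases e2 : v.v₂ = w.v₆
    · by_cases e3 : v.v₃ = w.v₅
      · rw [row_cons _ _ (by rfl), ofReal_lam_div]
        by_cases e4 : a.vtx 0 = w.v₁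
        · simp only [← e1, ← e2, ← e3, e4, if_true, smul_smul]
          congr 1
          simp only [List.map_cons, List.map_nil, List.prod_cons, List.prod_nil]
          have := rt_ne_zero
          field_simp
        · simp [e1, e4]
      · simp [Ne.symm e3, e3]
    · simp [Ne.symm e2, e2]
  · simp [Ne.symm e1, e1]

/-- As for `joined_weighted`. -/
theorem joinedShaded_weighted {v w : Hex} (hv : v.IsLoop) (hw : w.IsLoop) (a : Path 0) :
    joinedShaded v.weighted w.weighted a =
      if v.v₂ = w.v₆ ∧ v.v₃ = w.v₅ ∧ v.v₄ = w.v₄ then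
        ((lam v.v₃ / lam v.v₂ : ℝ) : ℂ) •
          row (a.vtx 0) [v.v₂, v.v₁, v.v₆, v.v₅, v.v₄, w.v₃, w.v₂, w.v₁, w.v₆]
      else 0 := by
  have h1 (x : Vtx) := seq_vecMul_cap (n := 2) [a.vtx 0] x [a.vtx 0] (by simp)
  have h2 (x y : Vtx) := seq_vecMul_cap (n := 4) [a.vtx 0, x] y [x, a.vtx 0] (by simp)
  have h3 (x y t : Vtx) := seq_vecMul_cap (n := 6) [a.vtx 0, x, y] t [y, x, a.vtx 0] (by simp)
  have h4 (x y t u : Vtx) := seq_vecMul_cap (n := 8) [a.vtx 0, x, y, t] u [t, y, x, a.vtx 0]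
    (by simp)
  have h5 (x y t u r : Vtx) := seq_vecMul_box_weighted (n := 10) [a.vtx 0, x, y, t, u] r u t y
    [x, a.vtx 0] (by simp) hw
  have h6 (x y t u : Vtx) := seq_vecMul_cup (n := 8) [a.vtx 0, x, y, t, u, w.v₁, w.v₆]
    x [a.vtx 0] (by simp) hw.2.2.2.2.1.symm
  have h7 (x y t u : Vtx) := seq_vecMul_cup (n := 6) [a.vtx 0, x, y, t, u, w.v₁]
    (a.vtx 0) [] (by simp) hw.2.2.2.2.2.1.symm
  have h8 (x y t u : Vtx) := seq_vecMul_cap (n := 6) [] (a.vtx 0) [x, y, t, u, w.v₁, w.v₆]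
    (by simp)
  have h9 (h x y t u : Vtx) := seq_vecMul_box_weighted (n := 8) [a.vtx 0] h (a.vtx 0) x y
    [t, u, w.v₁, w.v₆] (by simp) hv
  simp only [List.length_cons, List.length_nil, List.cons_append, List.nil_append, Nat.reduceAdd]
    at h1 h2 h3 h4 h5 h6 h7 h8 h9
  simp only [← ite_zero_smul] at h6 h7
  rw [joinedShaded]
  simp only [mul_apply_eq_vecMul, cap_zero_row, sum_vecMul, smul_vecMul, h1, h2, h3, h4, h5, h6, h7,
    h8, h9]
  simp only [smul_smul, ite_and, ite_mul, zero_mul, ite_smul, zero_smul, smul_ite, smul_zero,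
    Finset.sum_ite_eq', Finset.mem_univ, if_true, Finset.sum_ite_irrel, Finset.sum_const_zero]
  by_cases e1 : v.v₂ = w.v₆
  · by_cases e2 : v.v₃ = w.v₅
    · by_cases e3 : v.v₄ = w.v₄
      · rw [row_cons _ _ (by rfl), ofReal_lam_div]
        by_cases e4 : a.vtx 0 = w.v₆
        · simp only [← e1, ← e2, ← e3, e4, if_true, smul_smul]
          congr 1
          simp only [List.map_cons, List.map_nil, List.prod_cons, List.prod_nil]
          have := rt_ne_zero
          field_simp
        · simp [e1, e4]
      · simp [e3]
    · simp [Ne.symm e2, e2]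
  · rw [if_neg e1]
    split_ifs <;> first | rfl | (exfalso; simp_all)

theorem sum_eq_sum_nbrs {M : Type*} [AddCommMonoid M] (x : Vtx) {f : Vtx → M}
    (h : ∀ a, ¬ H.Adj x a → f a = 0) : ∑ a, f a = ((nbrs x).map f).sum := by
  have hc := not_adj_c
  cases x with
  | z i =>
    rw [Fintype.sum_eq_single (b i) fun a ha => h a fun h' => ha (eq_of_adj_z h')]
    simp [nbrs]
  | b i =>
    rw [Fintype.sum_eq_add (z i) c (by simp) fun a ha => h a fun h' => ?_]
    · simp [nbrs]
    · rcases eq_of_adj_b h' with h' | h'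
      exacts [ha.1 h', ha.2 h']
  | c =>
    rw [sum_vtx, h c hc.1, Finset.sum_eq_zero fun i _ => h _ (hc.2 i), Fin.sum_univ_three]
    simp [nbrs, add_assoc]
  | d =>
    rw [Fintype.sum_eq_single c fun a ha => h a fun h' => ha (eq_of_adj_d h')]
    simp [nbrs]

/-- The only freedom in a state of `capped` with a given loop is the label of the outer region. -/
theorem capped_weighted {v : Hex} (hv : v.IsLoop) (a : Path 0) :
    capped v.weighted a = ((nbrs v.v₂).map fun x => ((lam x * lam v.v₂ : ℝ) : ℂ)⁻¹ •
      row (a.vtx 0) [x, v.v₂, v.v₁, v.v₆, v.v₅, v.v₄, v.v₃, v.v₂, x]).sum := by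
  have h1 (x : Vtx) := seq_vecMul_cap (n := 2) [a.vtx 0] x [a.vtx 0] (by simp)
  have h2 (x y : Vtx) := seq_vecMul_cap (n := 4) [a.vtx 0, x, y] x [a.vtx 0] (by simp)
  have h3 (x y t : Vtx) := seq_vecMul_cap (n := 6) [a.vtx 0, x, y, x] t [x, a.vtx 0] (by simp)
  have h4 (x y t u : Vtx) := seq_vecMul_box_weighted (n := 8) [a.vtx 0, x] y x t u
    [t, x, a.vtx 0] (by simp) hv
  simp only [List.length_cons, List.length_nil, List.cons_append, List.nil_append, Nat.reduceAdd]
    at h1 h2 h3 h4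
  rw [capped]
  simp only [mul_apply_eq_vecMul, cap_zero_row, sum_vecMul, smul_vecMul, h1, h2, h3, h4]
  simp only [smul_smul, ite_and, ite_smul, zero_smul, smul_ite, smul_zero,
    Finset.sum_ite_eq', Finset.mem_univ, if_true, Finset.sum_ite_irrel, Finset.sum_const_zero]
  rw [← sum_eq_sum_nbrs, Fintype.sum_eq_single (a.vtx 0), row_cons _ _ (by rfl), if_pos rfl,
    smul_smul]
  · congr 1
    simp only [List.map_cons, List.map_nil, List.prod_cons, List.prod_nil, Complex.ofReal_mul,
      ← rt_sq]
    have := rt_ne_zero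
    field_simp
  · intro x hx
    rw [row_cons _ _ (by rfl), if_neg hx.symm, smul_zero]
  · intro x hx
    exact (congrArg _ (row_of_not_adj (a.vtx 0) [] _ fun h => hx h.symm)).trans (smul_zero _)

theorem cappedShaded_weighted {v : Hex} (hv : v.IsLoop) (a : Path 0) :
    cappedShaded v.weighted a = ((nbrs v.v₁).map fun x => ((lam x * lam v.v₁ : ℝ) : ℂ)⁻¹ •
      row (a.vtx 0) [x, v.v₁, v.v₆, v.v₅, v.v₄, v.v₃, v.v₂, v.v₁, x]).sum := by
  have h1 (x : Vtx) := seq_vecMul_cap (n := 2) [a.vtx 0] x [a.vtx 0] (by simp)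
  have h2 (x y : Vtx) := seq_vecMul_cap (n := 4) [a.vtx 0, x] y [x, a.vtx 0] (by simp)
  have h3 (x y t : Vtx) := seq_vecMul_cap (n := 6) [a.vtx 0, x, y] t [y, x, a.vtx 0] (by simp)
  have h4 (x y t u : Vtx) := seq_vecMul_box_weighted (n := 8) [a.vtx 0] x y t u
    [t, y, x, a.vtx 0] (by simp) hv
  simp only [List.length_cons, List.length_nil, List.cons_append, List.nil_append, Nat.reduceAdd]
    at h1 h2 h3 h4
  rw [cappedShaded]
  simp only [mul_apply_eq_vecMul, cap_zero_row, sum_vecMul, smul_vecMul, h1, h2, h3, h4]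
  simp only [smul_smul, ite_and, ite_smul, zero_smul, smul_ite, smul_zero,
    Finset.sum_ite_eq', Finset.mem_univ, if_true, Finset.sum_ite_irrel, Finset.sum_const_zero]
  rw [← sum_eq_sum_nbrs, Fintype.sum_eq_single (a.vtx 0), row_cons _ _ (by rfl), if_pos rfl,
    smul_smul]
  · congr 1
    simp only [List.map_cons, List.map_nil, List.prod_cons, List.prod_nil, Complex.ofReal_mul,
      ← rt_sq]
    have := rt_ne_zero
    field_simp
  · intro x hx
    rw [row_cons _ _ (by rfl), if_neg hx.symm, smul_zero]
  · intro x hx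
    exact (congrArg _ (row_of_not_adj (a.vtx 0) [] _ fun h => hx h.symm)).trans (smul_zero _)

/-! ### The diagrams of formal combinations -/

section

variable {M : Type*} [AddCommGroup M] [Module ℂ M]

theorem eval_congr {α : Type} {N N' : α → M} {l : Combo α} (h : ∀ t ∈ l, N t.2 = N' t.2) :
    eval N l = eval N' l :=
  congrArg List.sum (List.map_congr_left fun t ht => by rw [h t ht])

theorem eval_add_left {α : Type} (N N' : α → M) (l : Combo α) :
    eval (fun x => N x + N' x) l = eval N l + eval N' l := by
  simp only [eval, smul_add, List.sum_map_add]

theorem eval_smul_left {α : Type} (r : ℂ) (N : α → M) (l : Combo α) :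
    eval (fun x => r • N x) l = r • eval N l := by
  simp only [eval, List.smul_sum, List.map_map, Function.comp_def, smul_comm r]

theorem map_eval {M' : Type*} [AddCommGroup M'] [Module ℂ M'] {α : Type} {f : M → M'}
    (hf : IsLinearMap ℂ f) (N : α → M) (l : Combo α) :
    f (eval N l) = eval (fun x => f (N x)) l := by
  induction l with
  | nil => exact hf.map_zero
  | cons t l ih => rw [eval_cons, eval_cons, hf.map_add, hf.map_smul, ih]

theorem eval_orbit (N : Hex → M) (l : Combo Hex) :
    eval N (orbit l) = eval N l + eval (fun v => N v.turn) l + eval (fun v => N v.turn.turn) l := by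
  simp only [orbit, eval_append, eval_map]

theorem Hex.turn_turn_turn (v : Hex) : v.turn.turn.turn = v := by
  simp [Hex.turn, Planar2221.turn_turn_turn]

theorem eval_turn_orbit (N : Hex → M) (l : Combo Hex) :
    eval (fun v => N v.turn) (orbit l) = eval N (orbit l) := by
  simp only [eval_orbit, Hex.turn_turn_turn]
  abel

/-- The value of `N` on the words of `joined v w`. -/
noncomputable def pairing (N : Word → M) (v w : Hex) : M :=
  ((rel v.v₂).ev * (relInv v.v₁).ev) • if v.v₁ = w.v₁ ∧ v.v₂ = w.v₆ ∧ v.v₃ = w.v₅ then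
    N [v.v₁, v.v₆, v.v₅, v.v₄, v.v₃, w.v₄, w.v₃, w.v₂, w.v₁] else 0

/-- The value of `N` on the words of `joinedShaded v w`. -/
noncomputable def pairingShaded (N : Word → M) (v w : Hex) : M :=
  ((rel v.v₃).ev * (relInv v.v₂).ev) • if v.v₂ = w.v₆ ∧ v.v₃ = w.v₅ ∧ v.v₄ = w.v₄ then
    N [v.v₂, v.v₁, v.v₆, v.v₅, v.v₄, w.v₃, w.v₂, w.v₁, w.v₆] else 0

/-- The value of `N` on the words of `capped v`. -/
noncomputable def capping (N : Word → M) (v : Hex) : M :=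
  ((nbrs v.v₂).map fun a => ((relInv a).ev * (relInv v.v₂).ev) •
    N [a, v.v₂, v.v₁, v.v₆, v.v₅, v.v₄, v.v₃, v.v₂, a]).sum

/-- The value of `N` on the words of `cappedShaded v`. -/
noncomputable def cappingShaded (N : Word → M) (v : Hex) : M :=
  ((nbrs v.v₁).map fun a => ((relInv a).ev * (relInv v.v₁).ev) •
    N [a, v.v₁, v.v₆, v.v₅, v.v₄, v.v₃, v.v₂, v.v₁, a]).sum

theorem eval_comboJoined (N : Word → M) (F G : Combo Hex) :
    eval N (comboJoined F G) = eval (fun v => eval (pairing N v) G) F := by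
  refine eval_flatMap N _ _ (fun s => ?_) F
  rw [Num.force_eq, ← eval_smul_left]
  refine eval_flatMap N _ _ (fun t => ?_) G
  rw [pairing]
  split_ifs
  · rw [Num.force_eq, eval_cons, eval_nil, add_zero, Num.ev_mul, Num.ev_mul, Num.ev_mul]
    module
  · simp [eval_nil]

theorem eval_comboJoinedShaded (N : Word → M) (F G : Combo Hex) :
    eval N (comboJoinedShaded F G) = eval (fun v => eval (pairingShaded N v) G) F := by
  refine eval_flatMap N _ _ (fun s => ?_) F
  rw [Num.force_eq, ← eval_smul_left]
  refine eval_flatMap N _ _ (fun t => ?_) G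
  rw [pairingShaded]
  split_ifs
  · rw [Num.force_eq, eval_cons, eval_nil, add_zero, Num.ev_mul, Num.ev_mul, Num.ev_mul]
    module
  · simp [eval_nil]

theorem eval_comboCapped (N : Word → M) (F : Combo Hex) :
    eval N (comboCapped F) = eval (capping N) F := by
  refine eval_flatMap N _ _ (fun s => ?_) F
  simp only [eval, capping, List.map_map, List.smul_sum]
  congr 1
  refine List.map_congr_left fun a _ => ?_
  simp only [Function.comp_apply, Num.force_eq, Num.ev_mul]
  module

theorem eval_comboCappedShaded (N : Word → M) (F : Combo Hex) :
    eval N (comboCappedShaded F) = eval (cappingShaded N) F := by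
  refine eval_flatMap N _ _ (fun s => ?_) F
  simp only [eval, cappingShaded, List.map_map, List.smul_sum]
  congr 1
  refine List.map_congr_left fun a _ => ?_
  simp only [Function.comp_apply, Num.force_eq, Num.ev_mul]
  module

theorem turn_injective : Function.Injective turn := fun x y h => by
  rw [← turn_turn_turn x, ← turn_turn_turn y, h]

theorem rel_turn (x : Vtx) : rel (turn x) = rel x := by cases x <;> rfl

theorem relInv_turn (x : Vtx) : relInv (turn x) = relInv x := by cases x <;> rfl

theorem nbrs_turn_perm (x : Vtx) : (nbrs (turn x)).Perm ((nbrs x).map turn) := by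
  revert x; decide

theorem pairing_turn (N : Word → M) (v w : Hex) :
    pairing N v.turn w.turn = pairing (fun u => N (u.map turn)) v w := by
  simp only [pairing, Hex.turn, turn_injective.eq_iff, rel_turn, relInv_turn, List.map_cons,
    List.map_nil]

theorem pairingShaded_turn (N : Word → M) (v w : Hex) :
    pairingShaded N v.turn w.turn = pairingShaded (fun u => N (u.map turn)) v w := by
  simp only [pairingShaded, Hex.turn, turn_injective.eq_iff, rel_turn, relInv_turn, List.map_cons,
    List.map_nil]

theorem capping_turn (N : Word → M) (v : Hex) :
    capping N v.turn = capping (fun u => N (u.map turn)) v := by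
  refine ((nbrs_turn_perm v.v₂).map _).sum_eq.trans ?_
  simp only [capping, Hex.turn, relInv_turn, List.map_cons, List.map_nil, List.map_map,
    Function.comp_def]

theorem cappingShaded_turn (N : Word → M) (v : Hex) :
    cappingShaded N v.turn = cappingShaded (fun u => N (u.map turn)) v := by
  refine ((nbrs_turn_perm v.v₁).map _).sum_eq.trans ?_
  simp only [cappingShaded, Hex.turn, relInv_turn, List.map_cons, List.map_nil, List.map_map,
    Function.comp_def]

theorem eval_comboCapped_orbit (N : Word → M) (F : Combo Hex) :
    eval N (comboCapped (orbit F)) = eval (symm N) (comboCapped F) := by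
  simp only [eval_comboCapped, eval_orbit, capping_turn, ← eval_add_left]
  refine eval_congr fun t _ => ?_
  simp only [capping, ← List.sum_map_add, ← smul_add]
  rfl

theorem eval_comboCappedShaded_orbit (N : Word → M) (F : Combo Hex) :
    eval N (comboCappedShaded (orbit F)) = eval (symm N) (comboCappedShaded F) := by
  simp only [eval_comboCappedShaded, eval_orbit, cappingShaded_turn, ← eval_add_left]
  refine eval_congr fun t _ => ?_
  simp only [cappingShaded, ← List.sum_map_add, ← smul_add]
  rfl

/-- The sum over the orbits of both boxes is the symmetrised sum over one box and the orbit of the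
other.  This gives the symmetrised functional to which the reduction of words applies. -/
theorem eval_comboJoined_orbit (N : Word → M) (F G : Combo Hex) :
    eval N (comboJoined (orbit F) (orbit G)) = eval (symm N) (comboJoined F (orbit G)) := by
  have h (N : Word → M) (v : Hex) : eval (pairing N v.turn) (orbit G) =
      eval (pairing (fun u => N (u.map turn)) v) (orbit G) := by
    rw [← eval_turn_orbit (pairing N v.turn)]
    simp only [pairing_turn]
  simp only [eval_comboJoined, eval_orbit _ F, h, ← eval_add_left]
  refine eval_congr fun t _ => eval_congr fun t' _ => ?_
  simp only [pairing, symm]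
  split_ifs <;> simp only [smul_add, smul_zero, add_zero]

theorem eval_comboJoinedShaded_orbit (N : Word → M) (F G : Combo Hex) :
    eval N (comboJoinedShaded (orbit F) (orbit G)) =
      eval (symm N) (comboJoinedShaded F (orbit G)) := by
  have h (N : Word → M) (v : Hex) : eval (pairingShaded N v.turn) (orbit G) =
      eval (pairingShaded (fun u => N (u.map turn)) v) (orbit G) := by
    rw [← eval_turn_orbit (pairingShaded N v.turn)]
    simp only [pairingShaded_turn]
  simp only [eval_comboJoinedShaded, eval_orbit _ F, h, ← eval_add_left]
  refine eval_congr fun t _ => eval_congr fun t' _ => ?_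
  simp only [pairingShaded, symm]
  split_ifs <;> simp only [smul_add, smul_zero, add_zero]

end

theorem theta_real_sq_mul : theta ^ 2 * (theta ^ 2 - 3) = 3 := by
  rw [theta_sq]
  linear_combination (1 / 4) * sq_sqrt_twentyone

theorem lam_c_eq_theta : lam c = theta ^ 2 * lam (z 0) := by rw [lam_c_eq, theta_sq]

theorem lam_d_eq_theta : lam d = (theta ^ 2 - 3) * lam (b 0) := by
  rw [lam_d_eq, theta_sq]; ring

/-- The vertex `b 0` or `c`, of the same parity as `x`. -/
def base (x : Vtx) : Vtx := if isEven x then c else b 0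

theorem ev_rel (x : Vtx) : (rel x).ev = 3 * (lam x / lam (base x) : ℝ) := by
  have hb := (lam_pos (b 0)).ne'
  have hz := (lam_pos (z 0)).ne'
  have h3 : (theta : ℂ) ^ 2 * ((theta : ℂ) ^ 2 - 3) = 3 := by exact_mod_cast theta_real_sq_mul
  have ht : (theta : ℂ) ≠ 0 := by rintro h; simp [h] at h3
  cases x with
  | z i =>
    simp only [base, isEven, if_true, lam_z i, lam_c_eq_theta]
    rw [div_mul_cancel_right₀ hz]
    push_cast
    simp only [rel, Num.ev, Eis.ev]
    push_cast
    field_simp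
    linear_combination 3 * (theta : ℂ) ^ 2 * omega_sq + h3
  | b i => simp [base, isEven, lam_b i, rel, hb, Num.ev_nat]
  | c => simp [base, isEven, rel, (lam_pos c).ne', Num.ev_nat]
  | d =>
    simp only [base, isEven, Bool.false_eq_true, if_false, lam_d_eq_theta]
    rw [mul_div_cancel_right₀ _ hb]
    simp only [rel, Num.ev, Eis.ev]
    push_cast
    linear_combination 9 * omega_sq

theorem ev_relInv (x : Vtx) : (relInv x).ev = 3 * (lam (base x) / lam x : ℝ) := by
  have hb := (lam_pos (b 0)).ne'
  have hz := (lam_pos (z 0)).ne'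
  have h3 : (theta : ℂ) ^ 2 * ((theta : ℂ) ^ 2 - 3) = 3 := by exact_mod_cast theta_real_sq_mul
  have ht : (theta : ℂ) ^ 2 - 3 ≠ 0 := by rintro h; simp [h] at h3
  cases x with
  | z i =>
    simp only [base, isEven, if_true, lam_z i, lam_c_eq_theta]
    rw [mul_div_cancel_right₀ _ hz]
    simp [relInv, Num.ev_mul, Num.ev_nat, Num.ev_thetaSq]
  | b i => simp [base, isEven, lam_b i, relInv, hb, Num.ev_nat]
  | c => simp [base, isEven, relInv, (lam_pos c).ne', Num.ev_nat]
  | d =>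
    simp only [base, isEven, Bool.false_eq_true, if_false, lam_d_eq_theta]
    rw [div_mul_cancel_right₀ hb]
    simp only [relInv, Num.ev_thetaSq]
    push_cast
    field_simp
    linear_combination h3

theorem isLinearMap_joined_left (G : PABG 3) : IsLinearMap ℂ fun F => joined F G where
  map_add _ _ := by simp only [joined, box_add, Matrix.mul_add, Matrix.add_mul]
  map_smul _ _ := by simp only [joined, box_smul, Matrix.mul_smul, Matrix.smul_mul]

theorem isLinearMap_joined_right (F : PABG 3) : IsLinearMap ℂ fun G => joined F G where
  map_add _ _ := by simp only [joined, box_add, Matrix.mul_add, Matrix.add_mul]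
  map_smul _ _ := by simp only [joined, box_smul, Matrix.mul_smul, Matrix.smul_mul]

theorem isLinearMap_joinedShaded_left (G : PABG 3) : IsLinearMap ℂ fun F => joinedShaded F G where
  map_add _ _ := by simp only [joinedShaded, box_add, Matrix.mul_add, Matrix.add_mul]
  map_smul _ _ := by simp only [joinedShaded, box_smul, Matrix.mul_smul, Matrix.smul_mul]

theorem isLinearMap_joinedShaded_right (F : PABG 3) : IsLinearMap ℂ fun G => joinedShaded F G where
  map_add _ _ := by simp only [joinedShaded, box_add, Matrix.mul_add, Matrix.add_mul]
  map_smul _ _ := by simp only [joinedShaded, box_smul, Matrix.mul_smul, Matrix.smul_mul]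

theorem isLinearMap_capped : IsLinearMap ℂ capped where
  map_add _ _ := by simp only [capped, box_add, Matrix.mul_add, Matrix.add_mul]
  map_smul _ _ := by simp only [capped, box_smul, Matrix.mul_smul, Matrix.smul_mul]

theorem isLinearMap_cappedShaded : IsLinearMap ℂ cappedShaded where
  map_add _ _ := by simp only [cappedShaded, box_add, Matrix.mul_add, Matrix.add_mul]
  map_smul _ _ := by simp only [cappedShaded, box_smul, Matrix.mul_smul, Matrix.smul_mul]

theorem isLinearMap_apply (a : Path 0) : IsLinearMap ℂ fun A : FourBox => A a where
  map_add _ _ := rfl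
  map_smul _ _ := rfl

/-- The element of `PABG(H)_{3,+}` given by the orbit of a combination of loops. -/
noncomputable def realize (F : Combo Hex) : PABG 3 := eval Hex.weighted (orbit F)

theorem isEven_of_adj {x y : Vtx} (h : H.Adj x y) : isEven y = !isEven x := by
  revert h; revert y; revert x; decide

theorem adj_of_mem_nbrs {x y : Vtx} (h : y ∈ nbrs x) : H.Adj x y := by
  revert h; revert y; revert x; decide

theorem joined_realize {F G : Combo Hex} (hF : ∀ t ∈ orbit F, t.2.IsLoop)
    (hG : ∀ t ∈ orbit G, t.2.IsLoop) (a : Path 0) :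
    eval (symm (row (a.vtx 0))) (comboJoined F (orbit G)) =
      (9 * (lam c / lam (b 0) : ℝ) : ℂ) • joined (realize F) (realize G) a := by
  have h : joined (realize F) (realize G) a =
      eval (fun v => eval (fun w => joined v.weighted w.weighted a) (orbit G)) (orbit F) := by
    rw [realize, realize, map_eval (isLinearMap_joined_left _), map_eval (isLinearMap_apply a)]
    refine eval_congr fun s _ => ?_
    rw [map_eval (isLinearMap_joined_right _), map_eval (isLinearMap_apply a)]
  rw [h, ← eval_comboJoined_orbit, eval_comboJoined, ← eval_smul_left]
  refine eval_congr fun s hs => ?_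
  rw [← eval_smul_left]
  refine eval_congr fun t ht => ?_
  have hv := hF s hs
  have e2 := isEven_of_adj hv.2.1
  rw [hv.1] at e2
  rw [joined_weighted hv (hG t ht), pairing, ev_rel, ev_relInv, base, base, hv.1, e2]
  simp only [Bool.not_true, if_true, Bool.false_eq_true, if_false]
  split_ifs
  · rw [smul_smul]
    congr 1
    push_cast
    ring
  · rw [smul_zero, smul_zero]

theorem joinedShaded_realize {F G : Combo Hex} (hF : ∀ t ∈ orbit F, t.2.IsLoop)
    (hG : ∀ t ∈ orbit G, t.2.IsLoop) (a : Path 0) :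
    eval (symm (row (a.vtx 0))) (comboJoinedShaded F (orbit G)) =
      (9 * (lam (b 0) / lam c : ℝ) : ℂ) • joinedShaded (realize F) (realize G) a := by
  have h : joinedShaded (realize F) (realize G) a =
      eval (fun v => eval (fun w => joinedShaded v.weighted w.weighted a) (orbit G)) (orbit F) := by
    rw [realize, realize, map_eval (isLinearMap_joinedShaded_left _),
      map_eval (isLinearMap_apply a)]
    refine eval_congr fun s _ => ?_
    rw [map_eval (isLinearMap_joinedShaded_right _), map_eval (isLinearMap_apply a)]
  rw [h, ← eval_comboJoinedShaded_orbit, eval_comboJoinedShaded, ← eval_smul_left]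
  refine eval_congr fun s hs => ?_
  rw [← eval_smul_left]
  refine eval_congr fun t ht => ?_
  have hv := hF s hs
  have e2 := isEven_of_adj hv.2.1
  have e3 := isEven_of_adj hv.2.2.1
  rw [hv.1] at e2
  rw [e2] at e3
  rw [joinedShaded_weighted hv (hG t ht), pairingShaded, ev_rel, ev_relInv, base, base, e2, e3]
  simp only [Bool.not_true, Bool.not_false, if_true, Bool.false_eq_true, if_false]
  split_ifs
  · rw [smul_smul]
    congr 1
    push_cast
    ring
  · rw [smul_zero, smul_zero]

theorem capped_realize {F : Combo Hex} (hF : ∀ t ∈ orbit F, t.2.IsLoop) (a : Path 0) :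
    eval (symm (row (a.vtx 0))) (comboCapped F) =
      (9 * (lam (b 0) * lam c : ℝ) : ℂ) • capped (realize F) a := by
  have h : capped (realize F) a = eval (fun v => capped v.weighted a) (orbit F) := by
    rw [realize, map_eval isLinearMap_capped, map_eval (isLinearMap_apply a)]
  rw [h, ← eval_comboCapped_orbit, eval_comboCapped, ← eval_smul_left]
  refine eval_congr fun s hs => ?_
  have hv := hF s hs
  have e2 := isEven_of_adj hv.2.1
  rw [hv.1] at e2
  rw [capped_weighted hv, capping, List.smul_sum, List.map_map]
  congr 1
  refine List.map_congr_left fun x hx => ?_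
  have e3 := isEven_of_adj (adj_of_mem_nbrs hx)
  rw [e2] at e3
  rw [Function.comp_apply, ev_relInv, ev_relInv, base, base, e2, e3, smul_smul]
  congr 1
  simp only [Bool.not_true, Bool.not_false, if_true, Bool.false_eq_true, if_false]
  push_cast
  ring

theorem cappedShaded_realize {F : Combo Hex} (hF : ∀ t ∈ orbit F, t.2.IsLoop) (a : Path 0) :
    eval (symm (row (a.vtx 0))) (comboCappedShaded F) =
      (9 * (lam (b 0) * lam c : ℝ) : ℂ) • cappedShaded (realize F) a := by
  have h : cappedShaded (realize F) a = eval (fun v => cappedShaded v.weighted a) (orbit F) := by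
    rw [realize, map_eval isLinearMap_cappedShaded, map_eval (isLinearMap_apply a)]
  rw [h, ← eval_comboCappedShaded_orbit, eval_comboCappedShaded, ← eval_smul_left]
  refine eval_congr fun s hs => ?_
  have hv := hF s hs
  rw [cappedShaded_weighted hv, cappingShaded, List.smul_sum, List.map_map]
  congr 1
  refine List.map_congr_left fun x hx => ?_
  have e3 := isEven_of_adj (adj_of_mem_nbrs hx)
  rw [hv.1] at e3
  rw [Function.comp_apply, ev_relInv, ev_relInv, base, base, hv.1, e3, smul_smul]
  congr 1
  simp only [Bool.not_true, if_true, Bool.false_eq_true, if_false]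
  push_cast
  ring

theorem isLoop_of_mem_comboT : ∀ t ∈ orbit comboT, t.2.IsLoop := by decide +kernel

theorem isLoop_of_mem_comboQ : ∀ t ∈ orbit comboQ, t.2.IsLoop := by decide +kernel

/-! ### The generators as formal combinations -/

theorem isLinearMap_rho : IsLinearMap ℂ rho where
  map_add X Y := by
    funext l
    simp only [rho, PABG.coeff_add, Pi.add_apply, mul_add]
  map_smul r X := by
    funext l
    simp only [rho, PABG.coeff_smul, Pi.smul_apply, smul_eq_mul]
    ring

theorem rho_eval_weighted {l : Combo Hex} (hl : ∀ t ∈ l, t.2.IsLoop) :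
    rho (eval Hex.weighted l) = eval (fun v => v.rot.weighted) l := by
  rw [map_eval isLinearMap_rho]
  exact eval_congr fun t ht => rho_weighted (hl t ht)

theorem realize_append (F G : Combo Hex) : realize (F ++ G) = realize F + realize G := by
  simp only [realize, eval_orbit, eval_append]
  abel

theorem realize_smul (k : Num) (F : Combo Hex) : realize (Combo.smul k F) = k.ev • realize F := by
  simp only [realize, eval_orbit, eval_smul, smul_add]

/-- The rotation commutes with the symmetry of `H`. -/
theorem realize_rot {F : Combo Hex} (hF : ∀ t ∈ orbit F, t.2.IsLoop) :
    realize (F.map Hex.rot) = rho (realize F) := by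
  rw [realize, realize, rho_eval_weighted hF]
  simp only [eval_orbit, eval_map]
  rfl

theorem Hex.IsLoop.rot {v : Hex} (hv : v.IsLoop) : v.rot.IsLoop := by
  obtain ⟨h0, h1, h2, h3, h4, h5, h6⟩ := hv
  have e2 := isEven_of_adj h1
  have e3 := isEven_of_adj h2
  have e4 := isEven_of_adj h3
  have e5 := isEven_of_adj h4
  refine ⟨?_, h5, h6, h1, h2, h3, h4⟩
  change isEven v.v₅ = true
  rw [e5, e4, e3, e2, h0]
  rfl

theorem rt_c : rt c = theta * rt (z 0) := by
  rw [show (theta : ℂ) = rt c / rt (z 0) from sqrt_ratio c (z 0), div_mul_cancel₀ _ (rt_ne_zero _)]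

theorem rt_d : rt d = R * rt (b 0) := by
  rw [show (R : ℂ) = rt d / rt (b 0) from sqrt_ratio d (b 0), div_mul_cancel₀ _ (rt_ne_zero _)]

theorem rt_b (i : Fin 3) : rt (b i) = rt (b 0) := rfl

theorem rt_z (i : Fin 3) : rt (z i) = rt (z 0) := rfl

theorem realize_comboB_one : realize (comboB 1) =
    ((rt (b 0)) ^ 2 * rt c ^ 2) • ∑ i : Fin 3, loopB i (i + 1) := by
  simp only [realize, orbit, comboB, Combo.map, List.map_cons, List.map_nil, List.cons_append,
    List.nil_append, eval_cons, eval_nil, Num.ev_nat, Num.ev_neg, Num.ev_thetaSq, Hex.turn, turn,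
    Hex.weighted, Hex.basis, loopB, Fin.sum_univ_three, rt_c, rt_b, rt_z]
  simp only [Fin.isValue, Fin.reduceAdd]
  module

theorem realize_comboB_two : realize (comboB 2) =
    ((rt (b 0)) ^ 2 * rt c ^ 2) • ∑ i : Fin 3, loopB i (i + 2) := by
  simp only [realize, orbit, comboB, Combo.map, List.map_cons, List.map_nil, List.cons_append,
    List.nil_append, eval_cons, eval_nil, Num.ev_nat, Num.ev_neg, Num.ev_thetaSq, Hex.turn, turn,
    Hex.weighted, Hex.basis, loopB, Fin.sum_univ_three, rt_c, rt_b, rt_z]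
  simp only [Fin.isValue, Fin.reduceAdd]
  module

theorem realize_comboD : realize comboD =
    ((rt (b 0)) ^ 2 * rt c ^ 2 * R) • ∑ i : Fin 3, loopD i := by
  simp only [realize, orbit, comboD, Combo.map, List.map_cons, List.map_nil, List.cons_append,
    List.nil_append, eval_cons, eval_nil, Num.ev_nat, Num.ev_neg, Num.ev_thetaSq, Hex.turn, turn,
    Hex.weighted, Hex.basis, loopD, Fin.sum_univ_three, rt_d, rt_c, rt_b, rt_z]
  simp only [Fin.isValue, Fin.reduceAdd]
  module

theorem realize_comboE_one : realize (comboE 1) =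
    ((rt (b 0)) ^ 2 * rt c ^ 2 * R) • ∑ i : Fin 3, loop c d c (b i) c (b (i + 1)) := by
  simp only [realize, orbit, comboE, Combo.map, List.map_cons, List.map_nil, List.cons_append,
    List.nil_append, eval_cons, eval_nil, Num.ev_nat, Hex.turn, turn, Hex.weighted, Hex.basis,
    Fin.sum_univ_three, rt_d, rt_b]
  simp only [Fin.isValue, Fin.reduceAdd]
  module

theorem realize_comboE_two : realize (comboE 2) =
    ((rt (b 0)) ^ 2 * rt c ^ 2 * R) • ∑ i : Fin 3, loop c d c (b i) c (b (i + 2)) := by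
  simp only [realize, orbit, comboE, Combo.map, List.map_cons, List.map_nil, List.cons_append,
    List.nil_append, eval_cons, eval_nil, Num.ev_nat, Hex.turn, turn, Hex.weighted, Hex.basis,
    Fin.sum_univ_three, rt_d, rt_b]
  simp only [Fin.isValue, Fin.reduceAdd]
  module

theorem eval_comboS : eval Hex.weighted comboS = ((rt (b 0)) ^ 2 * rt c ^ 2) •
    ((3 * numS.ev) • loop c (b 0) c (b 1) c (b 2) +
      (3 * numSbar.ev) • loop c (b 0) c (b 2) c (b 1)) := by
  simp only [comboS, eval_cons, eval_nil, Num.ev_mul, Num.ev_nat, Hex.weighted, Hex.basis, rt_b]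
  module

theorem theta_sq_mul : (theta : ℂ) ^ 2 * ((theta : ℂ) ^ 2 - 3) = 3 := by
  exact_mod_cast theta_real_sq_mul

theorem R_ne_zero : (R : ℂ) ≠ 0 := by
  rw [show (R : ℂ) = rt d / rt (b 0) from sqrt_ratio d (b 0)]
  exact div_ne_zero (rt_ne_zero _) (rt_ne_zero _)

theorem theta_sq_mul_R : (theta : ℂ) ^ 2 * R = 3 / R := by
  have h : (R : ℂ) ^ 2 = (theta : ℂ) ^ 2 - 3 := by
    have : R ^ 2 = theta ^ 2 - 3 := by
      rw [R, Real.sq_sqrt (div_nonneg (lam_pos _).le (lam_pos _).le), lam_d_eq_theta,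
        mul_div_cancel_right₀ _ (lam_pos _).ne']
    exact_mod_cast this
  rw [eq_div_iff R_ne_zero, mul_assoc, ← sq, h, theta_sq_mul]

theorem sqrt_twentyone_eq : √21 = 2 * theta ^ 2 - 3 := by rw [theta_sq]; ring

theorem theta_pos : 0 < theta := Real.sqrt_pos.2 (div_pos (lam_pos _) (lam_pos _))

theorem sqrt_eq_theta : √(-114 + 26 * √21) = 4 * theta ^ 3 - 14 * theta := by
  have h := theta_real_sq_mul
  have h4 := four_lt_sqrt_twentyone
  have h0 : 0 ≤ 4 * theta ^ 3 - 14 * theta := by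
    have : 0 ≤ theta * (2 * √21 - 8) := mul_nonneg theta_pos.le (by linarith)
    rw [sqrt_twentyone_eq] at this
    linarith
  rw [← Real.sqrt_sq h0]
  congr 1
  rw [sqrt_twentyone_eq]
  linear_combination (-16 * theta ^ 2 + 64) * h

theorem sqrt_eq_theta' : √(54 + 14 * √21) = 2 * theta ^ 3 - 2 * theta := by
  have h := theta_real_sq_mul
  have h4 := four_lt_sqrt_twentyone
  have h0 : 0 ≤ 2 * theta ^ 3 - 2 * theta := by
    have : 0 ≤ theta * (√21 + 1) := mul_nonneg theta_pos.le (by linarith)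
    rw [sqrt_twentyone_eq] at this
    linarith
  rw [← Real.sqrt_sq h0]
  congr 1
  rw [sqrt_twentyone_eq]
  linear_combination (-4 * theta ^ 2 - 4) * h

theorem ev_numT : numT.ev = 6 * tT := by
  rw [tT, sqrt_eq_theta, sqrt_twentyone_eq]
  simp only [numT, Num.ev, Eis.ev]
  push_cast
  linear_combination (3 + 7 * (theta : ℂ)) * omega_sq

theorem ev_numT' : numT'.ev = 6 * tT' := by
  rw [tT', tT, sqrt_eq_theta, sqrt_eq_theta', sqrt_twentyone_eq]
  simp only [numT', Num.ev, Eis.ev]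
  push_cast
  linear_combination (3 + 2 * (theta : ℂ) ^ 3) * omega_sq +
    (-(theta : ℂ) ^ 2 + theta / 2 + 2) * theta_sq_mul

theorem ev_numPsi : numPsi.ev = 2 * Psi := by
  rw [Psi]
  simp only [numPsi, Num.ev, Eis.ev]
  push_cast
  linear_combination (theta + (theta : ℂ) ^ 2) * omega_sq

theorem sT_eq : sT = (3 - √21 : ℝ) / 4 + (2 * theta ^ 3 - 7 * theta : ℝ) * (1 + 2 * omega) / 6 := by
  have h : √((-57 + 13 * √21) / 6) = (2 * theta ^ 3 - 7 * theta) * √3 / 3 := by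
    have h3 : √(3 : ℝ) ^ 2 = 3 := Real.sq_sqrt (by norm_num)
    have e : (-57 + 13 * √21) / 6 = (-114 + 26 * √21) / (2 * √3) ^ 2 := by
      rw [mul_pow, h3]; ring
    rw [e, Real.sqrt_div' _ (sq_nonneg _), Real.sqrt_sq (by positivity), sqrt_eq_theta]
    field_simp
    rw [h3]
    ring
  rw [sT, h, omega_eq]
  push_cast
  ring

theorem star_omega : star omega = -1 - omega := by
  rw [omega_eq]
  simp only [star_add, star_neg, star_mul', Complex.star_def, Complex.conj_I, Complex.conj_ofReal,
    map_div₀, map_one, map_ofNat]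
  ring

theorem ev_numS : numS.ev = 6 * sT := by
  rw [sT_eq, sqrt_twentyone_eq]
  simp only [numS, Num.ev, Eis.ev]
  push_cast
  linear_combination (14 * (theta : ℂ) + 3 * (theta : ℂ) ^ 2) * omega_sq

theorem ev_numSbar : numSbar.ev = 6 * star sT := by
  have h : star sT = (3 - √21 : ℝ) / 4 +
      (2 * theta ^ 3 - 7 * theta : ℝ) * (1 + 2 * (-1 - omega)) / 6 := by
    rw [← star_omega, sT_eq]
    simp [-Complex.ofReal_sub, -Complex.ofReal_mul, -Complex.ofReal_pow]
  rw [h, sqrt_twentyone_eq]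
  simp only [numSbar, Num.ev, Eis.ev]
  push_cast
  linear_combination (3 * (theta : ℂ) ^ 2 + 4 * (theta : ℂ) ^ 3) * omega_sq

/-- The number `18 λ(b) λ(c)`. -/
noncomputable def scale : ℂ := 18 * (rt (b 0) ^ 2 * rt c ^ 2)

theorem isLoop_of_mem_comboSeedT : ∀ t ∈ orbit comboSeedT, t.2.IsLoop := by decide +kernel

theorem isLoop_of_mem_comboSeedQ : ∀ t ∈ orbit comboSeedQ, t.2.IsLoop := by decide +kernel

theorem isLoop_of_mem_comboS : ∀ t ∈ comboS, t.2.IsLoop := by decide +kernel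

theorem isLoop_orbit_map_rot {F : Combo Hex} (hF : ∀ t ∈ orbit F, t.2.IsLoop) :
    ∀ t ∈ orbit (F.map Hex.rot), t.2.IsLoop := by
  have h : orbit (F.map Hex.rot) = (orbit F).map Hex.rot := by
    simp [orbit, Combo.map, Hex.turn, Hex.rot, Function.comp_def]
  rw [h]
  intro t ht
  obtain ⟨s, hs, rfl⟩ := List.mem_map.1 ht
  exact (hF s hs).rot

theorem scale_smul_seedT : scale • seedT = realize comboSeedT + eval Hex.weighted comboS := by
  have h := theta_sq_mul_R
  simp only [comboSeedT, realize_append, realize_smul, realize_comboB_one, realize_comboB_two,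
    realize_comboD, realize_comboE_one, realize_comboE_two, eval_comboS, Num.ev_mul, Num.ev_neg,
    Num.ev_add, Num.ev_nat, Num.ev_thetaSq, ev_numT, ev_numT', ev_numS, ev_numSbar]
  rw [seedT, scale]
  push_cast
  generalize (∑ i : Fin 3, loopD i) = D
  generalize (∑ i : Fin 3, loop c d c (b i) c (b (i + 1))) = E₁
  generalize (∑ i : Fin 3, loop c d c (b i) c (b (i + 2))) = E₂
  have e (x : ℂ) : x / R = x * ((theta : ℂ) ^ 2 * R) / 3 := by rw [h]; ring
  simp only [e]
  module

theorem scale_smul_T : scale • T = realize comboT := by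
  have hS : realize comboS = eval Hex.weighted comboS + rho (eval Hex.weighted comboS) +
      rho (rho (eval Hex.weighted comboS)) := by
    rw [rho_eval_weighted isLoop_of_mem_comboS, ← eval_map Hex.weighted Hex.rot,
      rho_eval_weighted (l := comboS.map Hex.rot) (by decide +kernel)]
    simp only [realize, eval_orbit, comboS, Combo.map, List.map_cons, List.map_nil,
      eval_cons, eval_nil, Hex.turn, Hex.rot, turn]
    simp only [Fin.isValue, Fin.reduceAdd]
    abel
  have h1 := isLoop_of_mem_comboSeedT
  rw [T, smul_add, smul_add, ← isLinearMap_rho.map_smul, ← isLinearMap_rho.map_smul,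
    ← isLinearMap_rho.map_smul, scale_smul_seedT, comboT, realize_append, realize_append,
    realize_append, realize_rot (isLoop_orbit_map_rot h1), realize_rot h1, hS]
  simp only [isLinearMap_rho.map_add]
  abel

theorem scale_smul_seedQ : scale • seedQ = (3 * tQ : ℂ) • realize comboSeedQ := by
  have h := theta_sq_mul_R
  simp only [comboSeedQ, realize_append, realize_smul, realize_comboB_one, realize_comboB_two,
    realize_comboD, realize_comboE_one, realize_comboE_two, Num.ev_mul, Num.ev_neg,
    Num.ev_add, Num.ev_nat, Num.ev_thetaSq, Num.ev_om, ev_numPsi]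
  rw [seedQ, scale, tQ']
  push_cast
  generalize (∑ i : Fin 3, loopD i) = D
  generalize (∑ i : Fin 3, loop c d c (b i) c (b (i + 1))) = E₁
  generalize (∑ i : Fin 3, loop c d c (b i) c (b (i + 2))) = E₂
  have e (x : ℂ) : x / R = x * ((theta : ℂ) ^ 2 * R) / 3 := by rw [h]; ring
  simp only [e]
  module

theorem scale_smul_Q : scale • Q = (eta * (3 * tQ)) • realize comboQ := by
  have h1 := isLoop_of_mem_comboSeedQ
  have h : scale • (seedQ + omega ^ 2 • rho seedQ + omega • rho (rho seedQ)) =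
      (3 * tQ : ℂ) • realize comboQ := by
    rw [smul_add, smul_add, smul_comm scale (omega ^ 2), smul_comm scale omega,
      ← isLinearMap_rho.map_smul scale, ← isLinearMap_rho.map_smul scale,
      ← isLinearMap_rho.map_smul scale, scale_smul_seedQ, comboQ,
      realize_append, realize_append, realize_smul, realize_smul,
      realize_rot (isLoop_orbit_map_rot h1), realize_rot h1]
    simp only [isLinearMap_rho.map_smul, Num.ev_mul, Num.ev_om]
    module
  rw [Q, smul_comm, h, smul_smul]

theorem scale_ne_zero : scale ≠ 0 := by simp [scale, rt_ne_zero]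

theorem tQ_ne_zero : tQ ≠ 0 := by
  refine (Real.sqrt_pos.2 ?_).ne'
  have := qnum_pos (n := 4) (by norm_num)
  positivity

theorem eta_ne_zero : eta ≠ 0 := by
  intro h
  have := congrArg Complex.re h
  simp [eta] at this

theorem T_eq : T = scale⁻¹ • realize comboT := by
  rw [← scale_smul_T, inv_smul_smul₀ scale_ne_zero]

theorem Q_eq : Q = (scale⁻¹ * (eta * (3 * tQ))) • realize comboQ := by
  rw [mul_smul, ← scale_smul_Q, inv_smul_smul₀ scale_ne_zero]

/-! ### The linear relations between the diagrams -/

/-- The coefficients in this and the following relations solve a linear system over `ℚ(θ, ω)`; the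
kernel verifies them by computing the reduction, in which at most `40` different words occur. -/
theorem vanishes_comboQ_comboT : vanishes 40 (reduce (
    Combo.smul (.nat 1) (comboJoined comboQ (orbit comboT)) ++
    Combo.smul ⟨⟨0, 0, 0⟩, ⟨6, 0, 3⟩, ⟨6, 0, 3⟩, ⟨6, 0, 3⟩⟩ (comboCapped comboT) ++
    Combo.smul ⟨⟨36, 0, 72⟩, ⟨0, 0, 0⟩, ⟨6, 12, 0⟩, ⟨0, 0, 0⟩⟩ (comboCapped comboQ) ++
    Combo.smul ⟨⟨1, 1, 0⟩, ⟨0, 0, 0⟩, ⟨0, 0, 0⟩, ⟨0, 0, 0⟩⟩ (comboJoined comboT (orbit comboQ)) ++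
    Combo.smul (-.nat 162) (backtracks
      ⟨⟨3, 6, 0⟩, ⟨4, 2, 0⟩, ⟨2, 4, 0⟩, ⟨5, 4, 0⟩⟩
      ⟨⟨0, 6, 3⟩, ⟨2, 0, 1⟩, ⟨0, 6, 3⟩, ⟨0, 0, 0⟩⟩
      ⟨⟨0, 0, 0⟩, ⟨2, 0, 1⟩, ⟨2, 0, 1⟩, ⟨2, 0, 1⟩⟩
      ⟨⟨0, 0, 0⟩, ⟨0, 6, 3⟩, ⟨0, 6, 3⟩, ⟨0, 6, 3⟩⟩
      ⟨⟨0, 0, 0⟩, ⟨0, 0, 0⟩, ⟨0, 0, 0⟩, ⟨0, 0, 0⟩⟩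
      ⟨⟨3, 0, 6⟩, ⟨0, 0, 3⟩, ⟨4, 0, 5⟩, ⟨1, 0, 5⟩⟩
      ⟨⟨6, 0, 3⟩, ⟨0, 0, 0⟩, ⟨8, 0, 4⟩, ⟨2, 0, 1⟩⟩
      ⟨⟨36, 0, 18⟩, ⟨48, 0, 24⟩, ⟨48, 0, 24⟩, ⟨60, 0, 30⟩⟩))) = true := by
  decide +kernel

theorem vanishes_comboT_comboT : vanishes 40 (reduce (
    Combo.smul (.nat 4) (comboJoined comboT (orbit comboT)) ++
    Combo.smul ⟨⟨0, 0, 72⟩, ⟨0, 0, 0⟩, ⟨12, 12, 0⟩, ⟨0, 0, 0⟩⟩ (comboCapped comboT) ++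
    Combo.smul ⟨⟨1098, 864, 0⟩, ⟨288, 234, 0⟩, ⟨0, 54, 288⟩, ⟨0, 24, 78⟩⟩ (comboCapped comboQ) ++
    Combo.smul ⟨⟨0, 27, 27⟩, ⟨0, 7, 7⟩, ⟨7, 0, 0⟩, ⟨2, 0, 0⟩⟩ (comboJoined comboT (orbit comboQ)) ++
    Combo.smul (-.nat 324) (backtracks
      ⟨⟨0, 3, 15⟩, ⟨3, 0, 6⟩, ⟨1, 2, 0⟩, ⟨2, 0, 4⟩⟩
      ⟨⟨6, 0, 12⟩, ⟨2, 4, 0⟩, ⟨0, 10, 8⟩, ⟨2, 0, 4⟩⟩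
      ⟨⟨6, 0, 12⟩, ⟨8, 0, 16⟩, ⟨0, 10, 8⟩, ⟨2, 0, 4⟩⟩
      ⟨⟨9, 36, 0⟩, ⟨4, 8, 0⟩, ⟨12, 0, 6⟩, ⟨1, 2, 0⟩⟩
      ⟨⟨0, 0, 0⟩, ⟨8, 16, 0⟩, ⟨0, 0, 0⟩, ⟨2, 4, 0⟩⟩
      ⟨⟨18, 0, 0⟩, ⟨1, 0, 2⟩, ⟨0, 3, 3⟩, ⟨1, 2, 0⟩⟩
      ⟨⟨0, 0, 0⟩, ⟨2, 0, 4⟩, ⟨0, 0, 0⟩, ⟨2, 4, 0⟩⟩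
      ⟨⟨108, 0, 36⟩, ⟨0, 0, 0⟩, ⟨102, 0, 24⟩, ⟨0, 0, 0⟩⟩))) = true := by
  decide +kernel

theorem vanishes_comboQ_comboQ : vanishes 40 (reduce (
    Combo.smul (.nat 60) (comboJoined comboQ (orbit comboQ)) ++
    Combo.smul ⟨⟨720, 1080, 0⟩, ⟨252, 378, 0⟩, ⟨900, 1350, 0⟩, ⟨324, 486, 0⟩⟩
      (comboCapped comboT) ++
    Combo.smul ⟨⟨0, 270, 270⟩, ⟨0, 90, 0⟩, ⟨0, 90, 0⟩, ⟨0, 180, 90⟩⟩ (comboCapped comboQ) ++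
    Combo.smul ⟨⟨0, 0, 3⟩, ⟨0, 0, 6⟩, ⟨0, 0, 6⟩, ⟨0, 0, 7⟩⟩ (comboJoined comboT (orbit comboQ)) ++
    Combo.smul (-.nat 324) (backtracks
      ⟨⟨870, 705, 0⟩, ⟨351, 207, 0⟩, ⟨1095, 885, 0⟩, ⟨447, 264, 0⟩⟩
      ⟨⟨306, 0, 63⟩, ⟨249, 0, 93⟩, ⟨387, 0, 81⟩, ⟨313, 0, 116⟩⟩
      ⟨⟨102, 78, 0⟩, ⟨51, 12, 0⟩, ⟨129, 96, 0⟩, ⟨67, 14, 0⟩⟩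
      ⟨⟨0, 105, 255⟩, ⟨0, 147, 141⟩, ⟨0, 135, 315⟩, ⟨0, 184, 182⟩⟩
      ⟨⟨0, 570, 285⟩, ⟨0, 420, 210⟩, ⟨0, 720, 360⟩, ⟨0, 530, 265⟩⟩
      ⟨⟨975, 915, 0⟩, ⟨360, 315, 0⟩, ⟨1230, 1155, 0⟩, ⟨455, 400, 0⟩⟩
      ⟨⟨120, 0, 60⟩, ⟨90, 0, 45⟩, ⟨150, 0, 75⟩, ⟨110, 0, 55⟩⟩
      ⟨⟨0, 1710, 4230⟩, ⟨0, 612, 1521⟩, ⟨0, 2160, 5355⟩, ⟨0, 774, 1917⟩⟩))) = true := by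
  decide +kernel

theorem vanishes_comboQ_comboT_shaded : vanishes 40 (reduce (
    Combo.smul (.nat 1) (comboJoinedShaded comboQ (orbit comboT)) ++
    Combo.smul ⟨⟨0, 0, 0⟩, ⟨1, 2, 0⟩, ⟨1, 2, 0⟩, ⟨1, 2, 0⟩⟩ (comboCappedShaded comboT) ++
    Combo.smul ⟨⟨0, 24, 12⟩, ⟨0, 0, 0⟩, ⟨4, 0, 2⟩, ⟨0, 0, 0⟩⟩ (comboCappedShaded comboQ) ++
    Combo.smul ⟨⟨1, 0, 1⟩, ⟨0, 0, 0⟩, ⟨0, 0, 0⟩, ⟨0, 0, 0⟩⟩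
      (comboJoinedShaded comboT (orbit comboQ)) ++
    Combo.smul (-.nat 54) (backtracksShaded
      ⟨⟨9, 0, 9⟩, ⟨0, 2, 7⟩, ⟨10, 0, 11⟩, ⟨0, 3, 9⟩⟩
      ⟨⟨6, 0, 12⟩, ⟨1, 0, 2⟩, ⟨7, 0, 14⟩, ⟨1, 0, 2⟩⟩
      ⟨⟨18, 0, 0⟩, ⟨5, 1, 0⟩, ⟨23, 1, 0⟩, ⟨5, 1, 0⟩⟩
      ⟨⟨0, 6, 3⟩, ⟨6, 0, 3⟩, ⟨0, 6, 3⟩, ⟨8, 0, 4⟩⟩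
      ⟨⟨0, 24, 12⟩, ⟨0, 6, 3⟩, ⟨0, 30, 15⟩, ⟨0, 6, 3⟩⟩
      ⟨⟨0, 12, 15⟩, ⟨0, 6, 3⟩, ⟨0, 12, 15⟩, ⟨0, 10, 8⟩⟩
      ⟨⟨0, 12, 15⟩, ⟨0, 0, 0⟩, ⟨0, 18, 18⟩, ⟨0, 4, 5⟩⟩
      ⟨⟨6, 0, 12⟩, ⟨0, 0, 0⟩, ⟨6, 0, 12⟩, ⟨2, 0, 4⟩⟩
      ⟨⟨18, 9, 0⟩, ⟨6, 3, 0⟩, ⟨18, 9, 0⟩, ⟨12, 6, 0⟩⟩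
      ⟨⟨18, 9, 0⟩, ⟨0, 0, 0⟩, ⟨24, 12, 0⟩, ⟨6, 3, 0⟩⟩))) = true := by
  decide +kernel

theorem vanishes_comboT_comboT_shaded : vanishes 40 (reduce (
    Combo.smul (.nat 4) (comboJoinedShaded comboT (orbit comboT)) ++
    Combo.smul ⟨⟨0, 0, 24⟩, ⟨0, 0, 0⟩, ⟨4, 4, 0⟩, ⟨0, 0, 0⟩⟩ (comboCappedShaded comboT) ++
    Combo.smul ⟨⟨0, 366, 288⟩, ⟨0, 96, 78⟩, ⟨96, 0, 18⟩, ⟨26, 0, 8⟩⟩ (comboCappedShaded comboQ) ++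
    Combo.smul ⟨⟨27, 0, 27⟩, ⟨7, 0, 7⟩, ⟨0, 7, 0⟩, ⟨0, 2, 0⟩⟩
      (comboJoinedShaded comboT (orbit comboQ)) ++
    Combo.smul (-.nat 108) (backtracksShaded
      ⟨⟨21, 0, 15⟩, ⟨7, 2, 0⟩, ⟨13, 0, 20⟩, ⟨3, 3, 0⟩⟩
      ⟨⟨3, 0, 6⟩, ⟨9, 0, 3⟩, ⟨2, 1, 0⟩, ⟨9, 3, 0⟩⟩
      ⟨⟨3, 0, 6⟩, ⟨8, 7, 0⟩, ⟨2, 1, 0⟩, ⟨0, 6, 3⟩⟩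
      ⟨⟨6, 21, 0⟩, ⟨0, 5, 7⟩, ⟨9, 24, 0⟩, ⟨0, 0, 3⟩⟩
      ⟨⟨0, 0, 0⟩, ⟨0, 10, 14⟩, ⟨0, 0, 0⟩, ⟨0, 0, 6⟩⟩
      ⟨⟨0, 21, 6⟩, ⟨15, 3, 0⟩, ⟨33, 15, 0⟩, ⟨0, 7, 5⟩⟩
      ⟨⟨33, 0, 21⟩, ⟨33, 0, 12⟩, ⟨15, 6, 0⟩, ⟨0, 8, 1⟩⟩
      ⟨⟨33, 0, 21⟩, ⟨9, 18, 0⟩, ⟨15, 6, 0⟩, ⟨0, 6, 9⟩⟩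
      ⟨⟨9, 0, 9⟩, ⟨0, 12, 15⟩, ⟨6, 0, 21⟩, ⟨7, 0, 2⟩⟩
      ⟨⟨0, 0, 0⟩, ⟨0, 24, 30⟩, ⟨0, 0, 0⟩, ⟨14, 0, 4⟩⟩))) = true := by
  decide +kernel

theorem vanishes_comboQ_comboQ_shaded : vanishes 40 (reduce (
    Combo.smul (.nat 60) (comboJoinedShaded comboQ (orbit comboQ)) ++
    Combo.smul ⟨⟨240, 360, 0⟩, ⟨84, 126, 0⟩, ⟨300, 450, 0⟩, ⟨108, 162, 0⟩⟩
      (comboCappedShaded comboT) ++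
    Combo.smul ⟨⟨90, 0, 90⟩, ⟨0, 0, 30⟩, ⟨0, 0, 30⟩, ⟨30, 0, 60⟩⟩ (comboCappedShaded comboQ) ++
    Combo.smul ⟨⟨3, 0, 0⟩, ⟨6, 0, 0⟩, ⟨6, 0, 0⟩, ⟨7, 0, 0⟩⟩
      (comboJoinedShaded comboT (orbit comboQ)) ++
    Combo.smul (-.nat 108) (backtracksShaded
      ⟨⟨900, 0, 1980⟩, ⟨462, 0, 699⟩, ⟨1140, 0, 2505⟩, ⟨584, 0, 883⟩⟩
      ⟨⟨552, 429, 0⟩, ⟨303, 201, 0⟩, ⟨699, 543, 0⟩, ⟨381, 252, 0⟩⟩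
      ⟨⟨798, 246, 0⟩, ⟨483, 66, 0⟩, ⟨1011, 312, 0⟩, ⟨611, 82, 0⟩⟩
      ⟨⟨0, 615, 2085⟩, ⟨0, 360, 900⟩, ⟨0, 780, 2640⟩, ⟨0, 455, 1135⟩⟩
      ⟨⟨0, 735, 795⟩, ⟨0, 540, 585⟩, ⟨0, 930, 1005⟩, ⟨0, 685, 740⟩⟩
      ⟨⟨0, 135, 2115⟩, ⟨69, 0, 831⟩, ⟨0, 165, 2670⟩, ⟨78, 0, 1047⟩⟩
      ⟨⟨486, 0, 684⟩, ⟨354, 0, 411⟩, ⟨612, 0, 873⟩, ⟨438, 0, 507⟩⟩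
      ⟨⟨144, 0, 486⟩, ⟨99, 0, 261⟩, ⟨183, 0, 627⟩, ⟨123, 0, 327⟩⟩
      ⟨⟨0, 90, 1125⟩, ⟨0, 150, 390⟩, ⟨0, 120, 1410⟩, ⟨0, 180, 495⟩⟩
      ⟨⟨45, 630, 0⟩, ⟨30, 465, 0⟩, ⟨60, 795, 0⟩, ⟨45, 585, 0⟩⟩))) = true := by
  decide +kernel

/-- The relation holds in each row, because the rows are cap free. -/
theorem joined_mem_span {X Y : Combo Hex} (hX : ∀ t ∈ orbit X, t.2.IsLoop)
    (hY : ∀ t ∈ orbit Y, t.2.IsLoop) {m : ℕ} (hm : m ≠ 0) {k₁ k₂ k₃ g l₀ l₁ l₂ m₀ m₁ r₀ r₁ e : Num}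
    (h : vanishes 40 (reduce (
      Combo.smul (.nat m) (comboJoined X (orbit Y)) ++ Combo.smul k₁ (comboCapped comboT) ++
      Combo.smul k₂ (comboCapped comboQ) ++
      Combo.smul k₃ (comboJoined comboT (orbit comboQ)) ++
      Combo.smul g (backtracks l₀ l₁ l₂ m₀ m₁ r₀ r₁ e))) = true) :
    joined (realize X) (realize Y) ∈ Submodule.span ℂ {capped (realize comboT),
      capped (realize comboQ), joined (realize comboT) (realize comboQ)} := by
  have hT := isLoop_of_mem_comboT
  have hQ := isLoop_of_mem_comboQ
  have h1 : (9 * (lam c / lam (b 0) : ℝ) : ℂ) ≠ 0 :=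
    mul_ne_zero (by norm_num) (Complex.ofReal_ne_zero.2 (div_pos (lam_pos _) (lam_pos _)).ne')
  have h2 : (m : ℂ) * (9 * (lam c / lam (b 0) : ℝ)) ≠ 0 := mul_ne_zero (Nat.cast_ne_zero.2 hm) h1
  have key : ((m : ℂ) * (9 * (lam c / lam (b 0) : ℝ))) • joined (realize X) (realize Y) =
      -((k₁.ev * (9 * (lam (b 0) * lam c : ℝ))) • capped (realize comboT) +
        (k₂.ev * (9 * (lam (b 0) * lam c : ℝ))) • capped (realize comboQ) +
        (k₃.ev * (9 * (lam c / lam (b 0) : ℝ))) • joined (realize comboT) (realize comboQ)) := by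
    funext a
    have e := (isCapFree_row (a.vtx 0)).eval_symm_eq_zero h
    simp only [eval_append, eval_smul, joined_realize hX hY, joined_realize hT hQ,
      capped_realize hT, capped_realize hQ, Num.ev_nat, smul_smul,
      (isCapFree_row (a.vtx 0)).symm.eval_backtracks, smul_zero, add_zero] at e
    rw [add_assoc, add_assoc, ← add_assoc (_ • capped (realize comboT) a)] at e
    exact eq_neg_of_add_eq_zero_left e
  rw [← Submodule.smul_mem_iff _ h2, key]
  refine Submodule.neg_mem _ (add_mem (add_mem ?_ ?_) ?_) <;>
    exact Submodule.smul_mem _ _ (Submodule.subset_span (by simp))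

theorem joinedShaded_mem_span {X Y : Combo Hex} (hX : ∀ t ∈ orbit X, t.2.IsLoop)
    (hY : ∀ t ∈ orbit Y, t.2.IsLoop) {m : ℕ} (hm : m ≠ 0)
      {k₁ k₂ k₃ g l₀ l₁ l₂ r₀ r₁ m₀ m₁ m₂ n₀ n₁ : Num}
    (h : vanishes 40 (reduce (
      Combo.smul (.nat m) (comboJoinedShaded X (orbit Y)) ++ Combo.smul k₁
        (comboCappedShaded comboT) ++
      Combo.smul k₂ (comboCappedShaded comboQ) ++
      Combo.smul k₃ (comboJoinedShaded comboT (orbit comboQ)) ++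
      Combo.smul g (backtracksShaded l₀ l₁ l₂ r₀ r₁ m₀ m₁ m₂ n₀ n₁))) = true) :
    joinedShaded (realize X) (realize Y) ∈ Submodule.span ℂ {cappedShaded (realize comboT),
      cappedShaded (realize comboQ), joinedShaded (realize comboT) (realize comboQ)} := by
  have hT := isLoop_of_mem_comboT
  have hQ := isLoop_of_mem_comboQ
  have h1 : (9 * (lam (b 0) / lam c : ℝ) : ℂ) ≠ 0 :=
    mul_ne_zero (by norm_num) (Complex.ofReal_ne_zero.2 (div_pos (lam_pos _) (lam_pos _)).ne')
  have h2 : (m : ℂ) * (9 * (lam (b 0) / lam c : ℝ)) ≠ 0 := mul_ne_zero (Nat.cast_ne_zero.2 hm) h1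
  have key : ((m : ℂ) * (9 * (lam (b 0) / lam c : ℝ))) • joinedShaded (realize X) (realize Y) =
      -((k₁.ev * (9 * (lam (b 0) * lam c : ℝ))) • cappedShaded (realize comboT) +
        (k₂.ev * (9 * (lam (b 0) * lam c : ℝ))) • cappedShaded (realize comboQ) +
        (k₃.ev * (9 * (lam (b 0) / lam c : ℝ))) •
          joinedShaded (realize comboT) (realize comboQ)) := by
    funext a
    have e := (isCapFree_row (a.vtx 0)).eval_symm_eq_zero h
    simp only [eval_append, eval_smul, joinedShaded_realize hX hY, joinedShaded_realize hT hQ,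
      cappedShaded_realize hT, cappedShaded_realize hQ, Num.ev_nat, smul_smul,
      (isCapFree_row (a.vtx 0)).symm.eval_backtracksShaded, smul_zero, add_zero] at e
    rw [add_assoc, add_assoc, ← add_assoc (_ • cappedShaded (realize comboT) a)] at e
    exact eq_neg_of_add_eq_zero_left e
  rw [← Submodule.smul_mem_iff _ h2, key]
  refine Submodule.neg_mem _ (add_mem (add_mem ?_ ?_) ?_) <;>
    exact Submodule.smul_mem _ _ (Submodule.subset_span (by simp))

theorem realize_comboQ : realize comboQ = (eta * (3 * tQ))⁻¹ • scale • Q := by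
  rw [scale_smul_Q, inv_smul_smul₀]
  exact mul_ne_zero eta_ne_zero (mul_ne_zero three_ne_zero (Complex.ofReal_ne_zero.2 tQ_ne_zero))

/-- The projections in `M` are multiples of `u` and `v`, whatever the inner products are. -/
theorem span_realize_le : Submodule.span ℂ {capped (realize comboT),
    capped (realize comboQ), joined (realize comboT) (realize comboQ)} ≤
      Submodule.span ℂ {u, v, M} := by
  have hu : u ∈ Submodule.span ℂ {u, v, M} := Submodule.subset_span (by simp)
  have hv : v ∈ Submodule.span ℂ {u, v, M} := Submodule.subset_span (by simp)
  have hM : M ∈ Submodule.span ℂ {u, v, M} := Submodule.subset_span (by simp)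
  rw [Submodule.span_le]
  rintro _ (rfl | rfl | rfl)
  · rw [SetLike.mem_coe, ← scale_smul_T, isLinearMap_capped.map_smul, ← u]
    exact Submodule.smul_mem _ _ hu
  · rw [SetLike.mem_coe, realize_comboQ, isLinearMap_capped.map_smul,
      isLinearMap_capped.map_smul, ← v]
    exact Submodule.smul_mem _ _ (Submodule.smul_mem _ _ hv)
  · have h : joined T Q ∈ Submodule.span ℂ {u, v, M} := by
      have e : joined T Q = M + proj u (joined T Q) + proj v (joined T Q) := by
        rw [M]
        abel
      rw [e, proj, proj]
      exact add_mem (add_mem hM (Submodule.smul_mem _ _ hu)) (Submodule.smul_mem _ _ hv)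
    rw [SetLike.mem_coe, ← scale_smul_T, realize_comboQ,
      (isLinearMap_joined_left _).map_smul, (isLinearMap_joined_right _).map_smul,
      (isLinearMap_joined_right _).map_smul]
    exact Submodule.smul_mem _ _ (Submodule.smul_mem _ _ (Submodule.smul_mem _ _ h))

theorem joined_smul_mem {X Y X' Y' : PABG 3} {x y : ℂ} (hX : X' = x • X) (hY : Y' = y • Y)
    (h : joined X Y ∈ Submodule.span ℂ {capped (realize comboT),
      capped (realize comboQ), joined (realize comboT) (realize comboQ)}) :
    joined X' Y' ∈ Submodule.span ℂ {u, v, M} := by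
  rw [hX, hY, (isLinearMap_joined_left _).map_smul, (isLinearMap_joined_right _).map_smul]
  exact Submodule.smul_mem _ _ (Submodule.smul_mem _ _ (span_realize_le h))

theorem span_realize_le_shaded : Submodule.span ℂ {cappedShaded (realize comboT),
    cappedShaded (realize comboQ), joinedShaded (realize comboT) (realize comboQ)} ≤
      Submodule.span ℂ {uShaded, vShaded, MShaded} := by
  have hu : uShaded ∈ Submodule.span ℂ {uShaded, vShaded, MShaded} :=
    Submodule.subset_span (by simp)
  have hv : vShaded ∈ Submodule.span ℂ {uShaded, vShaded, MShaded} :=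
    Submodule.subset_span (by simp)
  have hM : MShaded ∈ Submodule.span ℂ {uShaded, vShaded, MShaded} :=
    Submodule.subset_span (by simp)
  rw [Submodule.span_le]
  rintro _ (rfl | rfl | rfl)
  · rw [SetLike.mem_coe, ← scale_smul_T, isLinearMap_cappedShaded.map_smul, ← uShaded]
    exact Submodule.smul_mem _ _ hu
  · rw [SetLike.mem_coe, realize_comboQ, isLinearMap_cappedShaded.map_smul,
      isLinearMap_cappedShaded.map_smul, ← vShaded]
    exact Submodule.smul_mem _ _ (Submodule.smul_mem _ _ hv)
  · have h : joinedShaded T Q ∈ Submodule.span ℂ {uShaded, vShaded, MShaded} := by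
      have e : joinedShaded T Q = MShaded + proj uShaded (joinedShaded T Q) + proj vShaded
        (joinedShaded T Q) := by
        rw [MShaded]
        abel
      rw [e, proj, proj]
      exact add_mem (add_mem hM (Submodule.smul_mem _ _ hu)) (Submodule.smul_mem _ _ hv)
    rw [SetLike.mem_coe, ← scale_smul_T, realize_comboQ,
      (isLinearMap_joinedShaded_left _).map_smul, (isLinearMap_joinedShaded_right _).map_smul,
      (isLinearMap_joinedShaded_right _).map_smul]
    exact Submodule.smul_mem _ _ (Submodule.smul_mem _ _ (Submodule.smul_mem _ _ h))

theorem joinedShaded_smul_mem {X Y X' Y' : PABG 3} {x y : ℂ} (hX : X' = x • X) (hY : Y' = y • Y)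
    (h : joinedShaded X Y ∈ Submodule.span ℂ {cappedShaded (realize comboT),
      cappedShaded (realize comboQ), joinedShaded (realize comboT) (realize comboQ)}) :
    joinedShaded X' Y' ∈ Submodule.span ℂ {uShaded, vShaded, MShaded} := by
  rw [hX, hY, (isLinearMap_joinedShaded_left _).map_smul,
    (isLinearMap_joinedShaded_right _).map_smul]
  exact Submodule.smul_mem _ _ (Submodule.smul_mem _ _ (span_realize_le_shaded h))

end Planar2221

theorem theorem5p2p9 :
    (Planar2221.joined Planar2221.T Planar2221.Q ∈
        Submodule.span ℂ {Planar2221.u, Planar2221.v, Planar2221.M} ∧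
      Planar2221.joined Planar2221.Q Planar2221.T ∈
        Submodule.span ℂ {Planar2221.u, Planar2221.v, Planar2221.M} ∧
      Planar2221.joined Planar2221.T Planar2221.T ∈
        Submodule.span ℂ {Planar2221.u, Planar2221.v, Planar2221.M} ∧
      Planar2221.joined Planar2221.Q Planar2221.Q ∈
        Submodule.span ℂ {Planar2221.u, Planar2221.v, Planar2221.M}) ∧
    (Planar2221.joinedShaded Planar2221.T Planar2221.Q ∈
        Submodule.span ℂ {Planar2221.uShaded, Planar2221.vShaded, Planar2221.MShaded} ∧
      Planar2221.joinedShaded Planar2221.Q Planar2221.T ∈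
        Submodule.span ℂ {Planar2221.uShaded, Planar2221.vShaded, Planar2221.MShaded} ∧
      Planar2221.joinedShaded Planar2221.T Planar2221.T ∈
        Submodule.span ℂ {Planar2221.uShaded, Planar2221.vShaded, Planar2221.MShaded} ∧
      Planar2221.joinedShaded Planar2221.Q Planar2221.Q ∈
        Submodule.span ℂ {Planar2221.uShaded, Planar2221.vShaded, Planar2221.MShaded}) := by
  have hT := Planar2221.isLoop_of_mem_comboT
  have hQ := Planar2221.isLoop_of_mem_comboQ
  have eT := Planar2221.T_eq
  have eQ := Planar2221.Q_eq
  refine ⟨⟨?_, ?_, ?_, ?_⟩, ?_, ?_, ?_, ?_⟩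
  · exact Planar2221.joined_smul_mem eT eQ (Submodule.subset_span (by simp))
  · exact Planar2221.joined_smul_mem eQ eT
      (Planar2221.joined_mem_span hQ hT (by norm_num) Planar2221.vanishes_comboQ_comboT)
  · exact Planar2221.joined_smul_mem eT eT
      (Planar2221.joined_mem_span hT hT (by norm_num) Planar2221.vanishes_comboT_comboT)
  · exact Planar2221.joined_smul_mem eQ eQ
      (Planar2221.joined_mem_span hQ hQ (by norm_num) Planar2221.vanishes_comboQ_comboQ)
  · exact Planar2221.joinedShaded_smul_mem eT eQ (Submodule.subset_span (by simp))
  · exact Planar2221.joinedShaded_smul_mem eQ eT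
      (Planar2221.joinedShaded_mem_span hQ hT (by norm_num)
        Planar2221.vanishes_comboQ_comboT_shaded)
  · exact Planar2221.joinedShaded_smul_mem eT eT
      (Planar2221.joinedShaded_mem_span hT hT (by norm_num)
        Planar2221.vanishes_comboT_comboT_shaded)
  · exact Planar2221.joinedShaded_smul_mem eQ eQ
      (Planar2221.joinedShaded_mem_span hQ hQ (by norm_num)
        Planar2221.vanishes_comboQ_comboQ_shaded)
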